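/- Let $V$ be a finite-dimensional real vector space and $\Delta$ a (not necessarily rational) fan in $V$: a finite non-empty set of strictly convex polyhedral cones, closed under taking faces, any two of which meet in a common face. Write $\tau\preceq\sigma$ if $\tau$ is a face of $\sigma$ and $\tau\prec_1\sigma$ if it is a facet. For $\sigma\in\Delta$ let $V_\sigma$ be the linear span of $\sigma$, let $A_\sigma=S(V_\sigma^*)$ with $V_\sigma^*$ in degree $2$, let $\mathfrak m_\sigma=A_\sigma^{>0}$, and let $\det V_\sigma^*=\bigwedge^{\dim\sigma}V_\sigma^*$, placed in degree $2\dim\sigma$. Fix an orientation of every $V_\sigma$. A sheaf $\mathcal F$ of graded $\mathcal A$-modules on $\Delta$ consists of $\mathbb Z$-graded $A_\sigma$-modules $F_\sigma$ ($\sigma\in\Delta$) and functorial degree-$0$ restriction maps $F_\sigma\to F_\tau$ ($\tau\preceq\sigma$) that are linear over the restriction of polynomial functions $A_\sigma\to A_\tau$. Its sections over a subfan $\Lambda$ form $F_\Lambda=\varprojlim_{\tau\in\Lambda}F_\tau$; put $\partial\sigma=\{\tau\in\Delta:\tau\precneqq\sigma\}$ and $F_{(\sigma,\partial\sigma)}=\ker(F_\sigma\to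 F_{\partial\sigma})$. The sheaf is pure if it is flabby and every $F_\sigma$ is a finitely generated free $A_\sigma$-module. For $\sigma\in\Delta$, the simple pure sheaf ${}_\sigma\mathcal L$ is constructed by induction on the dimension: ${}_\sigma L_\gamma=0$ if $\gamma\not\succeq\sigma$; ${}_\sigma L_\sigma=A_\sigma$; and for $\gamma\succneqq\sigma$ one sets ${}_\sigma L_\gamma=A_\gamma\otimes_{\mathbb R}\overline{L}_{\partial\gamma}$, where $\overline{L}_{\partial\gamma}={}_\sigma L_{\partial\gamma}/\mathfrak m_\gamma\,{}_\sigma L_{\partial\gamma}$, with restriction $a\otimes y\mapsto a\,s(y)$ to ${}_\sigma L_{\partial\gamma}$ for an $\mathbb R$-linear degree-$0$ section $s$ of the reduction map ${}_\sigma L_{\partial\gamma}\to\overline{L}_{\partial\gamma}$. The equivariant intersection cohomology sheaf is $\mathcal E={}_o\mathcal L$, where $o=\{0\}$. The dual $\mathcal D\mathcal F$ of a pure sheaf $\mathcal F$ has $(\mathcal D\mathcal F)_\sigma=\operatorname{Hom}_{A_\sigma}(F_{(\sigma,\partial\sigma)},A_\sigma)\otimes_{\mathbb R}\det V_\sigma^*$.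 For a facet $\tau\prec_1\sigma$ choose $h\in V_\sigma^*$ with $\ker h=V_\tau$ and $h|_\sigma\ge0$; the restriction to $\tau$ is $\varepsilon_\tau^\sigma\cdot\varphi_h\otimes\psi_h$, where $\varphi_h(f)(s)=f(h\check s)|_\tau$ with $\check s\in F_\sigma$ any extension of $s\in F_{(\tau,\partial\tau)}$ that vanishes on all proper faces of $\sigma$ other than $\tau$, where $\psi_h(h\wedge\eta)=\eta|_{V_\tau}$, and where $\varepsilon_\tau^\sigma=+1$ if $\psi_h$ maps the orientation of $V_\sigma$ to that of $V_\tau$ and $-1$ otherwise. For faces of higher codimension the restriction is the composition along a flag of relative facets. Then for every $\sigma\in\Delta$ a sheaf ${}_\sigma\mathcal L$ as above exists, and for every choice of it ${}_\sigma\mathcal L$ is a pure sheaf, its dual $\mathcal D({}_\sigma\mathcal L)$ is a sheaf of graded $\mathcal A$-modules, and there is an isomorphism of sheaves of graded $\mathcal A$-modules, of degree $0$, $$\mathcal D({}_\sigma\mathcal L)\;\cong\;{}_\sigma\mathcal L\otimes_{\mathbb R}\det V_\sigma^*.$$ In particular, $\mathcal E$ is self-dual: there is an isomorphism $\vartheta:\mathcal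 E\xrightarrow{\ \cong\ }\mathcal D\mathcal E$ of sheaves of graded $\mathcal A$-modules of degree $0$. -/

import Mathlib

open scoped TensorProduct

set_option linter.unusedVariables false
set_option linter.unusedSectionVars false

universe u

noncomputable section

/-- A (not necessarily rational) fan in the real vector space `V`: a finite non-empty set of
strictly convex polyhedral cones, closed under passing to faces, any two of which intersect in a
common face. -/
structure Fan (V : Type u) [AddCommGroup V] [Module ℝ V] where
  cones : Set (PointedCone ℝ V)
  finite : cones.Finite
  nonempty : cones.Nonempty
  polyhedral : ∀ σ ∈ cones, σ.FG
  strictlyConvex : ∀ σ ∈ cones, (σ : ConvexCone ℝ V).Salient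
  face_mem : ∀ σ ∈ cones, ∀ τ : PointedCone ℝ V, τ.IsFaceOf σ → τ ∈ cones
  inter_face : ∀ σ ∈ cones, ∀ τ ∈ cones, (σ ⊓ τ).IsFaceOf σ

namespace Fan

variable {V : Type u} [AddCommGroup V] [Module ℝ V] (Δ : Fan V)

/-- The cones of the fan, ordered by inclusion. For cones of a fan, `τ ≤ σ` says precisely that
`τ` is a face of `σ`, see `Fan.isFaceOf`. -/
abbrev Cone : Type u := {σ : PointedCone ℝ V // σ ∈ Δ.cones}

variable {Δ}

lemma isFaceOf {τ σ : Δ.Cone} (h : τ ≤ σ) : τ.1.IsFaceOf σ.1 := by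
  have := Δ.inter_face σ.1 σ.2 τ.1 τ.2
  rwa [inf_eq_right.mpr (show τ.1 ≤ σ.1 from h)] at this

variable (Δ) in
/-- The zero cone `o`. -/
def zeroCone : Δ.Cone :=
  ⟨⊥, by
    obtain ⟨σ, hσ⟩ := Δ.nonempty
    refine Δ.face_mem σ hσ ⊥ ⟨bot_le, ?_⟩
    intro x y a hx hy ha hxy
    rw [Submodule.mem_bot] at hxy ⊢
    by_contra h0
    have hax : a • x ∈ σ := PointedCone.smul_mem σ ha.le hx
    refine Δ.strictlyConvex σ hσ (a • x) hax (smul_ne_zero ha.ne' h0) ?_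
    rw [neg_eq_of_add_eq_zero_right hxy]
    exact hy⟩

/-- The linear span `V_σ` of a cone. -/
abbrev Sp (σ : Δ.Cone) : Submodule ℝ V := Submodule.span ℝ (σ.1 : Set V)

/-- The dimension of a cone. -/
abbrev dim (σ : Δ.Cone) : ℕ := Module.finrank ℝ (Sp σ)

lemma sp_mono {τ σ : Δ.Cone} (h : τ ≤ σ) : Sp τ ≤ Sp σ := Submodule.span_mono h

/-- The inclusion `V_τ → V_σ` for a face `τ` of `σ`. -/
abbrev incl {τ σ : Δ.Cone} (h : τ ≤ σ) : Sp τ →ₗ[ℝ] Sp σ := Submodule.inclusion (sp_mono h)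

/-- The algebra `A_σ = S(V_σ^*)` of polynomial functions on `σ`. -/
abbrev A (σ : Δ.Cone) : Type u := SymmetricAlgebra ℝ (Module.Dual ℝ (Sp σ))

/-- A linear form on `V_σ` as an element of `A_σ`. -/
abbrev lin (σ : Δ.Cone) : Module.Dual ℝ (Sp σ) →ₗ[ℝ] A σ := SymmetricAlgebra.ι ℝ _

/-- The even grading of `A_σ`: products of `k` linear forms span the part of degree `2k`. -/
def degA (σ : Δ.Cone) (d : ℤ) : Submodule ℝ (A σ) :=
  ⨆ (k : ℕ) (_ : d = 2 * (k : ℤ)), (LinearMap.range (lin σ)) ^ k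

/-- The ideal `𝔪 = A_σ^{>0}`, generated by the linear forms. -/
def maxIdeal (σ : Δ.Cone) : Ideal (A σ) := Ideal.span (Set.range (lin σ))

/-- Restriction `A_σ → A_τ` of polynomial functions to a face. -/
def resA {τ σ : Δ.Cone} (h : τ ≤ σ) : A σ →ₐ[ℝ] A τ :=
  SymmetricAlgebra.lift (lin τ ∘ₗ (incl h).dualMap)

lemma resA_lin {τ σ : Δ.Cone} (h : τ ≤ σ) (x : Module.Dual ℝ (Sp σ)) :
    resA h (lin σ x) = lin τ (x ∘ₗ incl h) :=
  SymmetricAlgebra.lift_ι_apply _ _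

lemma resA_refl (σ : Δ.Cone) (a : A σ) : resA (le_refl σ) a = a := by
  have : resA (le_refl σ) = AlgHom.id ℝ (A σ) := by
    apply SymmetricAlgebra.algHom_ext
    ext x
    exact resA_lin _ _
  rw [this]; rfl

lemma resA_trans {γ τ σ : Δ.Cone} (h : γ ≤ τ) (h' : τ ≤ σ) (a : A σ) :
    resA h (resA h' a) = resA (h.trans h') a := by
  have : (resA h).comp (resA h') = resA (h.trans h') := by
    apply SymmetricAlgebra.algHom_ext
    ext x
    change resA h (resA h' (lin σ x)) = resA _ (lin σ x)
    rw [resA_lin, resA_lin, resA_lin]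
    rfl
  rw [← this]; rfl

lemma resA_surjective {τ σ : Δ.Cone} (h : τ ≤ σ) : Function.Surjective (resA h) := by
  intro a
  induction a using SymmetricAlgebra.induction with
  | algebraMap r => exact ⟨algebraMap ℝ _ r, AlgHom.commutes _ r⟩
  | ι x =>
    obtain ⟨y, hy⟩ := LinearMap.dualMap_surjective_of_injective
      (Submodule.inclusion_injective (sp_mono h)) x
    exact ⟨lin σ y, (resA_lin h y).trans (congrArg (lin τ) hy)⟩
  | mul a b ha hb =>
    obtain ⟨a, rfl⟩ := ha
    obtain ⟨b, rfl⟩ := hb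
    exact ⟨a * b, map_mul _ _ _⟩
  | add a b ha hb =>
    obtain ⟨a, rfl⟩ := ha
    obtain ⟨b, rfl⟩ := hb
    exact ⟨a + b, map_add _ _ _⟩

/-! ### Facets -/

/-- `τ` is a facet of `σ`, i.e. a face of codimension one. -/
def IsFacet (τ σ : Δ.Cone) : Prop := τ ≤ σ ∧ dim τ + 1 = dim σ

/-- A linear combination of elements of a face that lies in the cone lies in the face. -/
lemma mem_of_mem_sp {τ σ : Δ.Cone} (h : τ ≤ σ) {x : V} (hx : x ∈ σ.1) (hx' : x ∈ Sp τ) :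
    x ∈ τ.1 := by
  have key : ∀ y ∈ Sp τ, ∃ a ∈ τ.1, ∃ b ∈ τ.1, y + b = a := by
    intro y hy
    induction hy using Submodule.span_induction with
    | mem y hy => exact ⟨y, hy, 0, τ.1.zero_mem, by simp⟩
    | zero => exact ⟨0, τ.1.zero_mem, 0, τ.1.zero_mem, by simp⟩
    | add y z _ _ hy hz =>
      obtain ⟨a, ha, b, hb, e⟩ := hy
      obtain ⟨a', ha', b', hb', e'⟩ := hz
      exact ⟨a + a', add_mem ha ha', b + b', add_mem hb hb', by rw [← e, ← e']; abel⟩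
    | smul c y _ hy =>
      obtain ⟨a, ha, b, hb, e⟩ := hy
      rcases le_total 0 c with hc | hc
      · exact ⟨c • a, PointedCone.smul_mem _ hc ha, c • b, PointedCone.smul_mem _ hc hb,
          by rw [← e, smul_add]⟩
      · refine ⟨(-c) • b, PointedCone.smul_mem _ (neg_nonneg.mpr hc) hb, (-c) • a,
          PointedCone.smul_mem _ (neg_nonneg.mpr hc) ha, ?_⟩
        rw [← e]; simp
  obtain ⟨a, ha, b, hb, e⟩ := key x hx'
  exact (isFaceOf h).mem_of_add_mem_left hx (h hb) (e ▸ ha)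

variable [FiniteDimensional ℝ V]

lemma dim_lt {τ σ : Δ.Cone} (h : τ < σ) : dim τ < dim σ := by
  refine Submodule.finrank_lt_finrank_of_lt (lt_of_le_of_ne (sp_mono h.le) fun e => ?_)
  refine h.not_ge fun x hx => mem_of_mem_sp h.le hx ?_
  rw [e]
  exact Submodule.subset_span hx

lemma IsFacet.eq_of_le {τ σ γ : Δ.Cone} (h : IsFacet τ σ) (h₁ : τ ≤ γ) (h₂ : γ < σ) : γ = τ := by
  by_contra hne
  have h3 := dim_lt (lt_of_le_of_ne h₁ (Ne.symm hne))
  have h4 := dim_lt h₂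
  have := h.2
  omega

lemma IsFacet.lt {τ σ : Δ.Cone} (h : IsFacet τ σ) : τ < σ := by
  refine lt_of_le_of_ne h.1 ?_
  rintro rfl
  have := h.2
  omega

/-- For a facet `τ` of `σ` there is a linear form `h` on `V_σ` with kernel `V_τ` that is
non-negative on `σ`. -/
lemma IsFacet.exists_form {τ σ : Δ.Cone} (ht : IsFacet τ σ) :
    ∃ h : Module.Dual ℝ (Sp σ), LinearMap.ker h = LinearMap.range (incl ht.1) ∧
      ∀ x : Sp σ, (x : V) ∈ σ.1 → 0 ≤ h x := by
  set W := LinearMap.range (incl ht.1) with hW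
  have hfin : Module.finrank ℝ W = dim τ :=
    LinearMap.finrank_range_of_inj (Submodule.inclusion_injective _)
  have hq : Module.finrank ℝ (Sp σ ⧸ W) = Module.finrank ℝ ℝ := by
    have h1 := Submodule.finrank_quotient_add_finrank W
    have h2 : Module.finrank ℝ (Sp τ) + 1 = Module.finrank ℝ (Sp σ) := ht.2
    change Module.finrank ℝ W = Module.finrank ℝ (Sp τ) at hfin
    rw [Module.finrank_self]
    omega
  let e : (Sp σ ⧸ W) ≃ₗ[ℝ] ℝ := LinearEquiv.ofFinrankEq _ _ hq
  let g : Module.Dual ℝ (Sp σ) := e.toLinearMap ∘ₗ W.mkQ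
  have hg : LinearMap.ker g = W := by
    rw [LinearMap.ker_comp_of_ker_eq_bot _ (LinearEquiv.ker e), Submodule.ker_mkQ]
  by_cases hpos : ∀ x : Sp σ, (x : V) ∈ σ.1 → 0 ≤ g x
  · exact ⟨g, hg, hpos⟩
  push Not at hpos
  obtain ⟨x, hx, hgx⟩ := hpos
  refine ⟨-g, by rw [LinearMap.ker_neg, hg], fun y hy => ?_⟩
  rw [LinearMap.neg_apply, neg_nonneg]
  by_contra! hgy
  have hz : g y • x + (-g x) • y ∈ W := by
    rw [← hg, LinearMap.mem_ker]
    simp only [map_add, map_smul, smul_eq_mul]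
    ring
  obtain ⟨z, hz⟩ := hz
  have hzV : (z : V) = g y • (x : V) + (-g x) • (y : V) := congrArg Subtype.val hz
  have hzσ : g y • (x : V) + (-g x) • (y : V) ∈ σ.1 :=
    add_mem (PointedCone.smul_mem _ hgy.le hx) (PointedCone.smul_mem _ (neg_nonneg.mpr hgx.le) hy)
  have hzτ : g y • (x : V) + (-g x) • (y : V) ∈ τ.1 :=
    mem_of_mem_sp ht.1 hzσ (hzV ▸ z.2)
  have hxτ : (x : V) ∈ τ.1 :=
    (isFaceOf ht.1).mem_of_smul_add_smul_mem_left hx hy hgy (neg_pos.mpr hgx) hzτ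
  have hxW : x ∈ LinearMap.ker g := by
    rw [hg]
    exact ⟨⟨x, Submodule.subset_span hxτ⟩, rfl⟩
  rw [LinearMap.mem_ker] at hxW
  exact hgx.ne hxW

/-- A linear form `h` on `V_σ` with `ker h = V_τ` and `h ≥ 0` on `σ`. -/
def IsFacet.form {τ σ : Δ.Cone} (ht : IsFacet τ σ) : Module.Dual ℝ (Sp σ) := ht.exists_form.choose

lemma IsFacet.ker_form {τ σ : Δ.Cone} (ht : IsFacet τ σ) :
    LinearMap.ker ht.form = LinearMap.range (incl ht.1) := ht.exists_form.choose_spec.1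

lemma IsFacet.resA_form {τ σ : Δ.Cone} (ht : IsFacet τ σ) : resA ht.1 (lin σ ht.form) = 0 := by
  rw [resA_lin]
  have : ht.form ∘ₗ incl ht.1 = 0 := by
    ext x
    have : incl ht.1 x ∈ LinearMap.ker ht.form := by rw [ht.ker_form]; exact ⟨x, rfl⟩
    exact this
  rw [this, map_zero]

lemma IsFacet.exists_vector {τ σ : Δ.Cone} (ht : IsFacet τ σ) : ∃ v : Sp σ, ht.form v = 1 := by
  have hne : ht.form ≠ 0 := by
    intro h0
    have h1 : Module.finrank ℝ (LinearMap.range (incl ht.1)) = dim τ :=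
      LinearMap.finrank_range_of_inj (Submodule.inclusion_injective _)
    rw [← ht.ker_form, h0, LinearMap.ker_zero, finrank_top] at h1
    have h2 : Module.finrank ℝ (Sp τ) + 1 = Module.finrank ℝ (Sp σ) := ht.2
    change Module.finrank ℝ (Sp σ) = Module.finrank ℝ (Sp τ) at h1
    omega
  obtain ⟨w, hw⟩ : ∃ w, ht.form w ≠ 0 := by
    by_contra! h
    exact hne (LinearMap.ext h)
  exact ⟨(ht.form w)⁻¹ • w, by rw [map_smul, smul_eq_mul, inv_mul_cancel₀ hw]⟩

/-- A vector `v ∈ V_σ` with `h(v) = 1`. -/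
def IsFacet.vector {τ σ : Δ.Cone} (ht : IsFacet τ σ) : Sp σ := ht.exists_vector.choose

/-! ### Determinants and orientations -/

/-- `det V_σ^* = ⋀^{dim σ} V_σ^*`, realized as the space of alternating forms of top degree
on `V_σ`. -/
abbrev Det (σ : Δ.Cone) : Type u := Sp σ [⋀^Fin (dim σ)]→ₗ[ℝ] ℝ

/-- The map `ψ_h : det V_σ^* → det V_τ^*`, `h ∧ η ↦ η|_{V_τ}`. It is the contraction with a vector
`v` such that `h(v) = 1`, followed by restriction to `V_τ = ker h`: indeed
`(h ∧ η)(v, w₂, …) = h(v) η(w₂, …)` for `w₂, … ∈ ker h`. -/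
def IsFacet.psi {τ σ : Δ.Cone} (ht : IsFacet τ σ) : Det σ →ₗ[ℝ] Det τ where
  toFun ω := ((AlternatingMap.curryLeft
    (AlternatingMap.domDomCongr (finCongr ht.2.symm) ω)) ht.vector).compLinearMap (incl ht.1)
  map_add' _ _ := rfl
  map_smul' _ _ := rfl

/-- A choice of an orientation of `V_σ` for every cone `σ`. (No agreement between the orientations
of different full-dimensional cones is needed for the dual sheaf, so none is required.) -/
abbrev Orientations (Δ : Fan V) : Type u := ∀ σ : Δ.Cone, Orientation ℝ (Sp σ) (Fin (dim σ))

open Classical in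
/-- The transition coefficient `ε_τ^σ = ± 1`. -/
def IsFacet.sign (or : Orientations Δ) {τ σ : Δ.Cone} (ht : IsFacet τ σ) : ℝ :=
  if ∃ c : ℝ, 0 < c ∧ ht.psi (or σ).someVector = c • (or τ).someVector then 1 else -1

end Fan

/-! ### Gradings -/

section Gradings

variable {M N : Type u} [AddCommGroup M] [Module ℝ M] [AddCommGroup N] [Module ℝ N]

/-- The grading of a tensor product of two graded vector spaces. -/
def tensorDeg (G : ℤ → Submodule ℝ M) (H : ℤ → Submodule ℝ N) (d : ℤ) :
    Submodule ℝ (M ⊗[ℝ] N) :=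
  ⨆ (i : ℤ) (j : ℤ) (_ : i + j = d), Submodule.map₂ (TensorProduct.mk ℝ M N) (G i) (H j)

variable (N) in
/-- The grading of a vector space concentrated in degree `k`. -/
def concentrated (k : ℤ) (d : ℤ) : Submodule ℝ N := if d = k then ⊤ else ⊥

end Gradings

/-! ### Sheaves of graded modules -/

open Fan

section Sheaves

variable {V : Type u} [AddCommGroup V] [Module ℝ V]

/-- The data of a presheaf of `𝓐`-modules on the basis of affine subfans `⟨σ⟩` of the fan space
`Δ`, with a family of homogeneous parts of every stalk `F_σ = F(⟨σ⟩)`. The axioms of a sheaf of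
graded `𝓐`-modules are in `ConeSystem.IsGradedSheaf`. -/
structure ConeSystem (Δ : Fan V) where
  stalk : Δ.Cone → Type u
  [addCommGroup : ∀ σ, AddCommGroup (stalk σ)]
  [moduleReal : ∀ σ, Module ℝ (stalk σ)]
  [module : ∀ σ, Module (A σ) (stalk σ)]
  [tower : ∀ σ, IsScalarTower ℝ (A σ) (stalk σ)]
  deg : ∀ σ, ℤ → Submodule ℝ (stalk σ)
  res : ∀ {τ σ : Δ.Cone}, τ ≤ σ → (stalk σ →ₗ[ℝ] stalk τ)
  res_smul : ∀ {τ σ : Δ.Cone} (h : τ ≤ σ) (a : A σ) (x : stalk σ),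
    res h (a • x) = resA h a • res h x

namespace ConeSystem

attribute [instance] addCommGroup moduleReal module tower

variable {Δ : Fan V}

/-- `F` is a sheaf of graded `𝓐`-modules: a functor on the face poset (a presheaf on the basis of
affine subfans is already a sheaf), with graded stalks and restrictions of degree zero. -/
structure IsGradedSheaf (F : ConeSystem Δ) : Prop where
  isInternal : ∀ σ, DirectSum.IsInternal (F.deg σ)
  smul_mem : ∀ σ (i j : ℤ) (a : A σ) (x : F.stalk σ), a ∈ degA σ i → x ∈ F.deg σ j →
    a • x ∈ F.deg σ (i + j)
  res_mem : ∀ {τ σ : Δ.Cone} (h : τ ≤ σ) (d : ℤ) (x : F.stalk σ), x ∈ F.deg σ d →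
    F.res h x ∈ F.deg τ d
  res_refl : ∀ (σ : Δ.Cone) (x : F.stalk σ), F.res (le_refl σ) x = x
  res_trans : ∀ {γ τ σ : Δ.Cone} (h : γ ≤ τ) (h' : τ ≤ σ) (x : F.stalk σ),
    F.res h (F.res h' x) = F.res (h.trans h') x

/-- The sections `F_Λ` over a subfan `Λ`: compatible families of elements of the stalks. -/
def Sec (F : ConeSystem Δ) (Λ : LowerSet Δ.Cone) : Submodule ℝ (∀ σ : Λ, F.stalk σ.1) where
  carrier := {x | ∀ (σ τ : Λ) (h : τ.1 ≤ σ.1), F.res h (x σ) = x τ}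
  add_mem' hx hy σ τ h := by
    rw [Pi.add_apply, map_add, hx σ τ h, hy σ τ h]; rfl
  zero_mem' σ τ h := by rw [Pi.zero_apply, map_zero]; rfl
  smul_mem' c x hx σ τ h := by
    rw [Pi.smul_apply, map_smul, hx σ τ h]; rfl

/-- `F` is flabby: every section over a subfan extends to the whole fan. -/
def IsFlabby (F : ConeSystem Δ) : Prop :=
  ∀ (Λ : LowerSet Δ.Cone) (x : F.Sec Λ), ∃ y : F.Sec ⊤, ∀ σ : Λ, y.1 ⟨σ.1, trivial⟩ = x.1 σ

/-- Pure sheaves. -/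
structure IsPure (F : ConeSystem Δ) : Prop where
  isGradedSheaf : F.IsGradedSheaf
  isFlabby : F.IsFlabby
  finite : ∀ σ, Module.Finite (A σ) (F.stalk σ)
  free : ∀ σ, Module.Free (A σ) (F.stalk σ)

/-- Isomorphisms of degree zero of sheaves of graded `𝓐`-modules. -/
structure Iso (F G : ConeSystem Δ) where
  equiv : ∀ σ, F.stalk σ ≃ₗ[A σ] G.stalk σ
  mem_iff : ∀ σ (d : ℤ) (x : F.stalk σ), equiv σ x ∈ G.deg σ d ↔ x ∈ F.deg σ d
  naturality : ∀ {τ σ : Δ.Cone} (h : τ ≤ σ) (x : F.stalk σ),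
    equiv τ (F.res h x) = G.res h (equiv σ x)

/-- The sheaf `F ⊗ K` for a graded vector space `K` with homogeneous parts `H d`. -/
def tensor (F : ConeSystem Δ) (K : Type u) [AddCommGroup K] [Module ℝ K]
    (H : ℤ → Submodule ℝ K) : ConeSystem Δ where
  stalk σ := F.stalk σ ⊗[ℝ] K
  deg σ := tensorDeg (F.deg σ) H
  res h := TensorProduct.map (F.res h) LinearMap.id
  res_smul h a x := by
    induction x using TensorProduct.induction_on with
    | zero => simp only [smul_zero, map_zero]
    | tmul x k => simp only [TensorProduct.smul_tmul', TensorProduct.map_tmul, F.res_smul]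
    | add x y hx hy => simp only [smul_add, map_add, hx, hy]

/-! ### Sections over the boundary fan -/

/-- The sections `F_{∂γ}` over the boundary fan `∂γ` of a cone `γ`. -/
abbrev Bd (F : ConeSystem Δ) (γ : Δ.Cone) : Type u := F.Sec (LowerSet.Iio γ)

lemma Bd.le {γ : Δ.Cone} (τ : LowerSet.Iio γ) : τ.1 ≤ γ := le_of_lt (LowerSet.mem_Iio_iff.mp τ.2)

/-- `A_γ` acts on `F_{∂γ}` through the restriction maps `A_γ → A_τ`. -/
instance (F : ConeSystem Δ) (γ : Δ.Cone) : SMul (A γ) (F.Bd γ) where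
  smul a x := ⟨fun τ => resA (Bd.le τ) a • x.1 τ, fun σ τ h => by
    rw [F.res_smul, x.2 σ τ h, resA_trans]⟩

lemma Bd.smul_apply (F : ConeSystem Δ) (γ : Δ.Cone) (a : A γ) (x : F.Bd γ) (τ : LowerSet.Iio γ) :
    (a • x).1 τ = resA (Bd.le τ) a • x.1 τ := rfl

instance (F : ConeSystem Δ) (γ : Δ.Cone) : Module (A γ) (F.Bd γ) where
  one_smul x := Subtype.ext <| funext fun τ => by
    rw [Bd.smul_apply, map_one, one_smul]
  mul_smul a b x := Subtype.ext <| funext fun τ => by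
    simp only [Bd.smul_apply, map_mul, mul_smul]
  smul_zero a := Subtype.ext <| funext fun τ => smul_zero _
  smul_add a x y := Subtype.ext <| funext fun τ => smul_add _ _ _
  add_smul a b x := Subtype.ext <| funext fun τ => by
    change _ = resA (Bd.le τ) a • x.1 τ + resA (Bd.le τ) b • x.1 τ
    rw [Bd.smul_apply, map_add, add_smul]
  zero_smul x := Subtype.ext <| funext fun τ => by
    rw [Bd.smul_apply, map_zero, zero_smul]; rfl

instance (F : ConeSystem Δ) (γ : Δ.Cone) : IsScalarTower ℝ (A γ) (F.Bd γ) where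
  smul_assoc c a x := Subtype.ext <| funext fun τ => by
    change resA (Bd.le τ) (c • a) • x.1 τ = c • (resA (Bd.le τ) a • x.1 τ)
    rw [map_smul, smul_assoc]

/-- The grading of `F_{∂γ}`. -/
def degBd (F : ConeSystem Δ) (γ : Δ.Cone) (d : ℤ) : Submodule ℝ (F.Bd γ) where
  carrier := {x | ∀ τ, x.1 τ ∈ F.deg τ.1 d}
  add_mem' hx hy τ := add_mem (hx τ) (hy τ)
  zero_mem' τ := zero_mem _
  smul_mem' c x hx τ := Submodule.smul_mem _ c (hx τ)

/-- The restriction `F_γ → F_{∂γ}`. -/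
def resBd (F : ConeSystem Δ) (hF : F.IsGradedSheaf) (γ : Δ.Cone) :
    F.stalk γ →ₗ[A γ] F.Bd γ where
  toFun x := ⟨fun τ => F.res (Bd.le τ) x, fun σ τ h => hF.res_trans _ _ _⟩
  map_add' x y := Subtype.ext <| funext fun τ => map_add _ _ _
  map_smul' a x := Subtype.ext <| funext fun τ => F.res_smul _ _ _

/-- The reduction `F_{∂γ} / 𝔪 F_{∂γ}`. -/
abbrev RedBd (F : ConeSystem Δ) (γ : Δ.Cone) : Type u :=
  F.Bd γ ⧸ (maxIdeal γ • ⊤ : Submodule (A γ) (F.Bd γ))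

/-- The reduction map. -/
def redBd (F : ConeSystem Δ) (γ : Δ.Cone) : F.Bd γ →ₗ[ℝ] F.RedBd γ :=
  (Submodule.mkQ (maxIdeal γ • ⊤ : Submodule (A γ) (F.Bd γ))).restrictScalars ℝ

/-- The induced grading of the reduction. -/
def degRedBd (F : ConeSystem Δ) (γ : Δ.Cone) (d : ℤ) : Submodule ℝ (F.RedBd γ) :=
  (F.degBd γ d).map (F.redBd γ)

/-! ### Simple pure sheaves -/

/-- `L` is the simple sheaf `_σL` attached to the cone `σ`, i.e. (up to isomorphisms of the
stalks) the result of the following construction by induction on the dimension: `L` vanishes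
outside of the star of `σ`, `L_σ = A_σ`, and for a cone `γ` properly containing `σ` one has
`L_γ = A_γ ⊗ (L_{∂γ} / 𝔪 L_{∂γ})`, the restriction to `∂γ` being `id ⊗ s` for an `ℝ`-linear
section `s` of the reduction map. (Since restrictions have degree zero, so has `s`.) -/
structure IsSimple (σ : Δ.Cone) (L : ConeSystem Δ) : Prop where
  isGradedSheaf : L.IsGradedSheaf
  outside : ∀ γ : Δ.Cone, ¬ σ ≤ γ → Subsingleton (L.stalk γ)
  center : ∃ e : L.stalk σ ≃ₗ[A σ] A σ, ∀ (d : ℤ) (x : L.stalk σ), e x ∈ degA σ d ↔ x ∈ L.deg σ d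
  extension : ∀ γ : Δ.Cone, σ < γ →
    ∃ (s : L.RedBd γ →ₗ[ℝ] L.Bd γ) (e : L.stalk γ ≃ₗ[A γ] A γ ⊗[ℝ] L.RedBd γ),
      (∀ y, L.redBd γ (s y) = y) ∧
      (∀ (d : ℤ) (x : L.stalk γ), e x ∈ tensorDeg (degA γ) (L.degRedBd γ) d ↔ x ∈ L.deg γ d) ∧
      ∀ (a : A γ) (y : L.RedBd γ), L.resBd isGradedSheaf γ (e.symm (a ⊗ₜ y)) = a • s y

/-! ### The dual sheaf -/

/-- The sections `F_{(σ, ∂σ)}` over `⟨σ⟩` vanishing on `∂σ`. -/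
def Rel (F : ConeSystem Δ) (σ : Δ.Cone) : Submodule (A σ) (F.stalk σ) where
  carrier := {x | ∀ (τ : Δ.Cone) (h : τ < σ), F.res h.le x = 0}
  add_mem' hx hy τ h := by rw [map_add, hx τ h, hy τ h, add_zero]
  zero_mem' τ h := map_zero _
  smul_mem' a x hx τ h := by rw [F.res_smul, hx τ h, smul_zero]

/-- `Hom(F_{(σ, ∂σ)}, A_σ)`. -/
abbrev HomRel (F : ConeSystem Δ) (σ : Δ.Cone) : Type u := F.Rel σ →ₗ[A σ] A σ

/-- The grading of `Hom(F_{(σ, ∂σ)}, A_σ)`: homomorphisms of degree `k`. -/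
def degHom (F : ConeSystem Δ) (σ : Δ.Cone) (k : ℤ) : Submodule ℝ (F.HomRel σ) where
  carrier := {f | ∀ (j : ℤ) (x : F.Rel σ), x.1 ∈ F.deg σ j → f x ∈ degA σ (j + k)}
  add_mem' hf hg j x hx := add_mem (hf j x hx) (hg j x hx)
  zero_mem' j x hx := zero_mem _
  smul_mem' c f hf j x hx := Submodule.smul_mem _ c (hf j x hx)

variable [FiniteDimensional ℝ V]

/-- A section on the facet `τ` vanishing on `∂τ` can be extended by zero to `∂σ` and then to a
section on `σ`. -/
lemma exists_ext {F : ConeSystem Δ} (hF : F.IsPure) {τ σ : Δ.Cone} (ht : IsFacet τ σ)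
    (s : F.Rel τ) : ∃ x : F.stalk σ, F.res ht.1 x = s.1 ∧
      ∀ (γ : Δ.Cone) (h : γ < σ), γ ≠ τ → F.res h.le x = 0 := by
  classical
  have hS := hF.isGradedSheaf
  let t : F.Bd σ := ⟨fun γ => if h : γ.1 ≤ τ then F.res h s.1 else 0, by
    intro γ γ' h
    change F.res h (if h : γ.1 ≤ τ then F.res h s.1 else 0) =
      if h : γ'.1 ≤ τ then F.res h s.1 else 0
    by_cases h1 : γ.1 ≤ τ
    · rw [dif_pos h1, dif_pos (h.trans h1), hS.res_trans]
    · rw [dif_neg h1, map_zero]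
      by_cases h2 : γ'.1 ≤ τ
      · rw [dif_pos h2]
        refine (s.2 γ'.1 (lt_of_le_of_ne h2 fun e => h1 ?_)).symm
        exact (ht.eq_of_le (e ▸ h) (LowerSet.mem_Iio_iff.mp γ.2)).le
      · rw [dif_neg h2]⟩
  have ht0 : ∀ (γ : Δ.Cone) (h : γ < σ), γ ≠ τ → t.1 ⟨γ, h⟩ = 0 := by
    intro γ h hne
    change (if h : γ ≤ τ then F.res h s.1 else 0) = 0
    split_ifs with h1
    · exact s.2 γ (lt_of_le_of_ne h1 hne)
    · rfl
  have ht1 : t.1 ⟨τ, ht.lt⟩ = s.1 := by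
    change (if h : τ ≤ τ then F.res h s.1 else 0) = s.1
    rw [dif_pos le_rfl, hS.res_refl]
  obtain ⟨y, hy⟩ := hF.isFlabby _ t
  refine ⟨y.1 ⟨σ, trivial⟩, ?_, fun γ h hne => ?_⟩
  · exact (y.2 ⟨σ, trivial⟩ ⟨τ, trivial⟩ ht.1).trans ((hy ⟨τ, ht.lt⟩).trans ht1)
  · exact (y.2 ⟨σ, trivial⟩ ⟨γ, trivial⟩ h.le).trans ((hy ⟨γ, h⟩).trans (ht0 γ h hne))

/-- A chosen extension `š` of `s` to `σ`. -/
def ext {F : ConeSystem Δ} (hF : F.IsPure) {τ σ : Δ.Cone} (ht : IsFacet τ σ)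
    (s : F.Rel τ) : F.stalk σ := (exists_ext hF ht s).choose

/-- Multiplication with `h` maps a section vanishing on all faces in `∂σ` other than the facet `τ`
into `F_{(σ, ∂σ)}`. -/
lemma form_smul_mem {F : ConeSystem Δ} {τ σ : Δ.Cone} (ht : IsFacet τ σ)
    {x : F.stalk σ} (hx : ∀ (γ : Δ.Cone) (h : γ < σ), γ ≠ τ → F.res h.le x = 0) :
    lin σ ht.form • x ∈ F.Rel σ := by
  intro γ h
  rw [F.res_smul]
  by_cases e : γ = τ
  · subst e
    rw [ht.resA_form, zero_smul]
  · rw [hx γ h e, smul_zero]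

/-- `h š ∈ F_{(σ, ∂σ)}`. -/
def formExt {F : ConeSystem Δ} (hF : F.IsPure) {τ σ : Δ.Cone} (ht : IsFacet τ σ)
    (s : F.Rel τ) : F.Rel σ :=
  ⟨lin σ ht.form • ext hF ht s, form_smul_mem ht (exists_ext hF ht s).choose_spec.2⟩

/-- The restriction `f(h š)|_τ` does not depend on the choice of the extension `š`. -/
lemma resA_formExt {F : ConeSystem Δ} (hF : F.IsPure) {τ σ : Δ.Cone} (ht : IsFacet τ σ)
    (f : F.HomRel σ) (s : F.Rel τ) {x : F.stalk σ} (h₁ : F.res ht.1 x = s.1)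
    (h₂ : ∀ (γ : Δ.Cone) (h : γ < σ), γ ≠ τ → F.res h.le x = 0) :
    resA ht.1 (f (formExt hF ht s)) = resA ht.1 (f ⟨lin σ ht.form • x, form_smul_mem ht h₂⟩) := by
  obtain ⟨e₁, e₂⟩ := (exists_ext hF ht s).choose_spec
  have hd : ext hF ht s - x ∈ F.Rel σ := by
    intro γ h
    rw [map_sub]
    by_cases e : γ = τ
    · subst e
      exact sub_eq_zero.mpr (e₁.trans h₁.symm)
    · rw [h₂ γ h e, sub_zero]
      exact e₂ γ h e
  have hsplit : formExt hF ht s = (⟨lin σ ht.form • x, form_smul_mem ht h₂⟩ : F.Rel σ)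
      + lin σ ht.form • (⟨ext hF ht s - x, hd⟩ : F.Rel σ) := by
    apply Subtype.ext
    change lin σ ht.form • ext hF ht s = lin σ ht.form • x + lin σ ht.form • (ext hF ht s - x)
    rw [← smul_add, add_sub_cancel]
  rw [hsplit, map_add, map_smul, smul_eq_mul, map_add, map_mul, ht.resA_form, zero_mul, add_zero]

/-- The map `φ_h : Hom(F_{(σ, ∂σ)}, A_σ) → Hom(F_{(τ, ∂τ)}, A_τ)`, `φ_h(f)(s) = f(h š)|_τ`. -/
def phi {F : ConeSystem Δ} (hF : F.IsPure) {τ σ : Δ.Cone} (ht : IsFacet τ σ) :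
    F.HomRel σ →ₗ[ℝ] F.HomRel τ where
  toFun f :=
    { toFun := fun s => resA ht.1 (f (formExt hF ht s))
      map_add' := fun s t => by
        obtain ⟨e₁, e₂⟩ := (exists_ext hF ht s).choose_spec
        obtain ⟨d₁, d₂⟩ := (exists_ext hF ht t).choose_spec
        have h₁ : F.res ht.1 (ext hF ht s + ext hF ht t) = (s + t : F.Rel τ).1 := by
          rw [map_add]
          exact congrArg₂ (· + ·) e₁ d₁
        have h₂ : ∀ (γ : Δ.Cone) (h : γ < σ), γ ≠ τ →
            F.res h.le (ext hF ht s + ext hF ht t) = 0 := by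
          intro γ h hne
          rw [map_add]
          exact (congrArg₂ (· + ·) (e₂ γ h hne) (d₂ γ h hne)).trans (add_zero 0)
        rw [resA_formExt hF ht f (s + t) h₁ h₂, ← map_add, ← map_add]
        refine congrArg (fun z => resA ht.1 (f z)) (Subtype.ext ?_)
        exact smul_add _ _ _
      map_smul' := fun a s => by
        obtain ⟨e₁, e₂⟩ := (exists_ext hF ht s).choose_spec
        obtain ⟨b, rfl⟩ := resA_surjective ht.1 a
        have h₁ : F.res ht.1 (b • ext hF ht s) = (resA ht.1 b • s : F.Rel τ).1 := by
          rw [F.res_smul]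
          exact congrArg (resA ht.1 b • ·) e₁
        have h₂ : ∀ (γ : Δ.Cone) (h : γ < σ), γ ≠ τ → F.res h.le (b • ext hF ht s) = 0 := by
          intro γ h hne
          rw [F.res_smul]
          exact (congrArg (resA h.le b • ·) (e₂ γ h hne)).trans (smul_zero _)
        rw [resA_formExt hF ht f _ h₁ h₂, RingHom.id_apply, smul_eq_mul, ← map_mul, ← smul_eq_mul,
          ← map_smul]
        refine congrArg (fun z => resA ht.1 (f z)) (Subtype.ext ?_)
        exact smul_comm _ _ _ }
  map_add' f g := by ext s; simp
  map_smul' c f := by ext s; simp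

/-- The stalk `(DF)_σ = Hom(F_{(σ, ∂σ)}, A_σ) ⊗ det V_σ^*`. -/
abbrev DualStalk (F : ConeSystem Δ) (σ : Δ.Cone) : Type u := F.HomRel σ ⊗[ℝ] Det σ

/-- The restriction homomorphism of the dual sheaf for a facet: `ε_τ^σ · φ_h ⊗ ψ_h`. -/
def dualResFacet (or : Orientations Δ) {F : ConeSystem Δ} (hF : F.IsPure) {τ σ : Δ.Cone}
    (ht : IsFacet τ σ) : F.DualStalk σ →ₗ[ℝ] F.DualStalk τ :=
  ht.sign or • TensorProduct.map (phi hF ht) ht.psi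

lemma dualResFacet_smul (or : Orientations Δ) {F : ConeSystem Δ} (hF : F.IsPure) {τ σ : Δ.Cone}
    (ht : IsFacet τ σ) (a : A σ) (x : F.DualStalk σ) :
    dualResFacet or hF ht (a • x) = resA ht.1 a • dualResFacet or hF ht x := by
  have hphi : ∀ f : F.HomRel σ, phi hF ht (a • f) = resA ht.1 a • phi hF ht f := by
    intro f
    refine LinearMap.ext fun s => ?_
    exact map_mul (resA ht.1) a (f (formExt hF ht s))
  induction x using TensorProduct.induction_on with
  | zero => simp only [smul_zero, map_zero]
  | tmul f ω =>
    simp only [dualResFacet, LinearMap.smul_apply, TensorProduct.smul_tmul',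
      TensorProduct.map_tmul, hphi]
    rw [smul_comm]
  | add x y hx hy => simp only [smul_add, map_add, hx, hy]

end ConeSystem

/-- A flag `τ = τ₀ ≺₁ τ₁ ≺₁ … ≺₁ τ_r = σ` of relative facets joining `τ` and `σ`. -/
inductive Fan.Flag {Δ : Fan V} (τ : Δ.Cone) : Δ.Cone → Type u
  | refl : Flag τ τ
  | cons {ρ σ : Δ.Cone} (ht : IsFacet ρ σ) (p : Flag τ ρ) : Flag τ σ

lemma Fan.Flag.le {Δ : Fan V} {τ σ : Δ.Cone} (p : Flag τ σ) : τ ≤ σ := by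
  induction p with
  | refl => exact le_refl τ
  | cons ht p ih => exact ih.trans ht.1

namespace ConeSystem

variable {Δ : Fan V} [FiniteDimensional ℝ V]

/-- The composition of the facet restrictions along a flag. -/
def dualResFlag (or : Orientations Δ) {F : ConeSystem Δ} (hF : F.IsPure) :
    ∀ {τ σ : Δ.Cone}, Flag τ σ → (F.DualStalk σ →ₗ[ℝ] F.DualStalk τ)
  | _, _, .refl => LinearMap.id
  | _, _, .cons ht p => dualResFlag or hF p ∘ₗ dualResFacet or hF ht

lemma dualResFlag_smul (or : Orientations Δ) {F : ConeSystem Δ} (hF : F.IsPure) {τ σ : Δ.Cone}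
    (p : Flag τ σ) (h : τ ≤ σ) (a : A σ) (x : F.DualStalk σ) :
    dualResFlag or hF p (a • x) = resA h a • dualResFlag or hF p x := by
  induction p with
  | refl => rw [resA_refl, dualResFlag]; rfl
  | cons ht p ih =>
    rw [dualResFlag, LinearMap.comp_apply, LinearMap.comp_apply, dualResFacet_smul, ih p.le,
      resA_trans]

open Classical in
/-- The restriction homomorphism of the dual sheaf for an arbitrary face: the composition of the
facet restrictions along some flag. (There always is one, so the second case does not occur; that
the choice does not matter amounts to the functoriality of these maps.) -/
def dualRes (or : Orientations Δ) {F : ConeSystem Δ} (hF : F.IsPure) (τ σ : Δ.Cone) :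
    F.DualStalk σ →ₗ[ℝ] F.DualStalk τ :=
  if h : Nonempty (Flag τ σ) then dualResFlag or hF h.some else 0

/-- The dual `DF` of a pure sheaf `F`; `det V_σ^*` is concentrated in degree `2 dim σ`. -/
def dual (or : Orientations Δ) (F : ConeSystem Δ) (hF : F.IsPure) : ConeSystem Δ where
  stalk σ := F.DualStalk σ
  deg σ := tensorDeg (F.degHom σ) (concentrated (Det σ) (2 * (dim σ : ℤ)))
  res {τ σ} _ := dualRes or hF τ σ
  res_smul h a x := by
    unfold dualRes
    split_ifs with hp
    · exact dualResFlag_smul or hF hp.some h a x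
    · simp only [LinearMap.zero_apply, smul_zero]

end ConeSystem

end Sheaves

end

/-! A simple sheaf is characterised by vanishing outside the star of σ, by its stalk `A σ` at σ, and
by minimality at each larger cone γ: L_γ → L_∂γ is onto with kernel in 𝔪 L_γ. The dual turns out to
have the same properties, up to a shift by 2 dim σ. An isomorphism is then built in order of
dimension: the isomorphism over ∂γ is lifted to the stalks at γ using that L_γ is free
(`nonempty_iso_of_step`, `exists_iso_step`). The lift is onto by graded Nakayama and injective by
comparison of ranks, so freeness of the dual stalks need not be known beforehand.

A choice of volume forms replaces the dual by `homDual`, with stalks Hom(F_(σ,∂σ), A_σ) and facet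
restrictions that are positive multiples of φ_h. Functoriality is a local question at ridges. Let ρ
be the common facet of two facets τ₁, τ₂ of σ, with forms g₁, g₂ of ρ in τ₁, τ₂, and let h₂|τ₁ = a
g₁, h₁|τ₂ = b g₂. Both compositions of the φ's evaluate f at h₁h₂x, so a times the first is b times
the second (`smul_phi_phi_eq`); the compositions of the ψ's are opposite with the inverse ratio
(`psi_psi_eq_neg`); the signs ε make all factors positive, and everything cancels. As the facets
containing a given face are connected through ridges (`facets_connected`), all flags give the same
map.

The heart is the surjectivity of the dual onto boundary sections: compatible forms on the facets of
γ come from a form on F_(γ,∂γ) (`exists_form_of_facets`). A line shelling of ∂γ is used. Sections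
vanishing on the facets before τ restrict onto the sections over τ vanishing on the visible part of
∂τ, and by induction all these modules are projective (`projective_relTo`): the kernel of a map from
a projective A_γ-module onto a finitely generated projective module over A_γ/(h) is projective. A
form at the last relevant facet τ is extended to sections vanishing only on the visible part
(`exists_extend_form`), lifted to A_γ and divided by h. This prescribes the restriction to τ without
disturbing later facets, so facets can be peeled off from the end.

Minimality of the dual: a form with zero boundary restriction extends to all of F_γ, by division by
the pairwise non-associated primes h. If F_(γ,∂γ) ⊆ 𝔪 F_γ, as for simple sheaves, then the form lies
in 𝔪 times the dual.

Purity of simple sheaves is again Nakayama, since the section s generates L_∂γ modulo 𝔪. Existence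
is an induction on the dimension that attaches all new stalks of one dimension at once. -/

noncomputable section

/-! ### Internal gradings by the integers -/

section GradedVectorSpaces

variable {M N : Type*} [AddCommGroup M] [Module ℝ M] [AddCommGroup N] [Module ℝ N]
  {G : ℤ → Submodule ℝ M} {H : ℤ → Submodule ℝ N}

/-- The decomposition into homogeneous parts. -/
def gdecomp (h : DirectSum.IsInternal G) : M ≃ₗ[ℝ] DirectSum ℤ fun i => G i :=
  (LinearEquiv.ofBijective (DirectSum.coeLinearMap G) (show Function.Bijective _ from h)).symm

lemma gdecomp_of_mem (h : DirectSum.IsInternal G) {e : ℤ} {x : M} (hx : x ∈ G e) :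
    gdecomp h x = DirectSum.lof ℝ ℤ (fun i => G i) e ⟨x, hx⟩ := by
  rw [gdecomp, LinearEquiv.symm_apply_eq, LinearEquiv.ofBijective_apply]
  exact (DirectSum.coeLinearMap_lof G e ⟨x, hx⟩).symm

/-- The projection to the homogeneous part of degree `d` of an internal grading. -/
def gproj (h : DirectSum.IsInternal G) (d : ℤ) : M →ₗ[ℝ] M :=
  (G d).subtype ∘ₗ DirectSum.component ℝ ℤ (fun i => G i) d ∘ₗ (gdecomp h).toLinearMap

lemma gproj_mem (h : DirectSum.IsInternal G) (d : ℤ) (x : M) : gproj h d x ∈ G d :=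
  Submodule.coe_mem _

lemma gproj_of_mem_ite (h : DirectSum.IsInternal G) {d e : ℤ} {x : M} (hx : x ∈ G e) :
    gproj h d x = if e = d then x else 0 := by
  simp only [gproj, LinearMap.comp_apply, LinearEquiv.coe_coe, gdecomp_of_mem h hx]
  split_ifs with hd
  · subst hd
    simp [DirectSum.component.lof_self]
  · simp [DirectSum.component.of, hd]

lemma gproj_of_mem (h : DirectSum.IsInternal G) {d : ℤ} {x : M} (hx : x ∈ G d) :
    gproj h d x = x := by
  rw [gproj_of_mem_ite h hx, if_pos rfl]

lemma gproj_of_mem_ne (h : DirectSum.IsInternal G) {d e : ℤ} {x : M} (hx : x ∈ G e) (hne : e ≠ d) :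
    gproj h d x = 0 := by
  rw [gproj_of_mem_ite h hx, if_neg hne]

lemma IsInternal.induction (h : DirectSum.IsInternal G) {p : M → Prop} (zero : p 0)
    (add : ∀ x y, p x → p y → p (x + y)) (mem : ∀ d, ∀ x ∈ G d, p x) (x : M) : p x := by
  have hx : x ∈ ⨆ d, G d := by rw [h.submodule_iSup_eq_top]; trivial
  exact Submodule.iSup_induction G (motive := p) hx mem zero add

lemma exists_sum_gproj (h : DirectSum.IsInternal G) (x : M) :
    ∃ s : Finset ℤ, ∀ t : Finset ℤ, s ⊆ t → ∑ d ∈ t, gproj h d x = x := by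
  classical
  induction x using IsInternal.induction h with
  | zero => exact ⟨∅, by simp⟩
  | add x y hx hy =>
    obtain ⟨s, hs⟩ := hx
    obtain ⟨s', hs'⟩ := hy
    refine ⟨s ∪ s', fun t ht => ?_⟩
    simp only [map_add, Finset.sum_add_distrib]
    rw [hs t (Finset.union_subset_left ht), hs' t (Finset.union_subset_right ht)]
  | mem d x hx =>
    refine ⟨{d}, fun t ht => ?_⟩
    rw [Finset.sum_eq_single_of_mem d (ht (Finset.mem_singleton_self d))
      fun e _ he => gproj_of_mem_ne h hx he.symm, gproj_of_mem h hx]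

/-- The map `π d` is the identity on `G d` and kills the sum of the other parts, so the two meet in
zero. The gradings below are all established through candidate projections of this kind. -/
lemma isInternal_of_proj (π : ℤ → M →ₗ[ℝ] M) (h₁ : ∀ d, ∀ x ∈ G d, π d x = x)
    (h₂ : ∀ d e, ∀ x ∈ G e, e ≠ d → π d x = 0) (h₃ : ∀ x, x ∈ ⨆ d, G d) :
    DirectSum.IsInternal G := by
  refine DirectSum.isInternal_submodule_of_iSupIndep_of_iSup_eq_top ?_ (eq_top_iff.mpr fun x _ => h₃ x)
  rw [iSupIndep_def]
  intro d
  rw [Submodule.disjoint_def]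
  intro x hx hx'
  have : ∀ y ∈ ⨆ (j : ℤ) (_ : j ≠ d), G j, π d y = 0 := by
    intro y hy
    have : (⨆ (j : ℤ) (_ : j ≠ d), G j) ≤ LinearMap.ker (π d) :=
      iSup₂_le fun j hj y hy => h₂ d j y hy hj
    exact this hy
  rw [← h₁ d x hx, this x hx']

lemma mem_of_gproj_eq_zero (h : DirectSum.IsInternal G) {d : ℤ} {x : M}
    (hx : ∀ e, e ≠ d → gproj h e x = 0) : x ∈ G d := by
  classical
  obtain ⟨s, hs⟩ := exists_sum_gproj h x
  rw [← hs (insert d s) (Finset.subset_insert d s),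
    Finset.sum_eq_single_of_mem d (Finset.mem_insert_self d s) fun e _ he => hx e he]
  exact gproj_mem h d x

lemma gproj_comm (hG : DirectSum.IsInternal G) (hH : DirectSum.IsInternal H) (f : M →ₗ[ℝ] N)
    (k : ℤ) (hf : ∀ d, ∀ x ∈ G d, f x ∈ H (d + k)) (d : ℤ) (x : M) :
    gproj hH (d + k) (f x) = f (gproj hG d x) := by
  induction x using IsInternal.induction hG with
  | zero => simp
  | add x y hx hy => simp [hx, hy]
  | mem e x hx =>
    rw [gproj_of_mem_ite hG hx, gproj_of_mem_ite hH (hf e x hx)]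
    by_cases h : e = d
    · simp [h]
    · simp [h]

lemma IsInternal.of_equiv (hG : DirectSum.IsInternal G) (e : M ≃ₗ[ℝ] N)
    (he : ∀ d x, e x ∈ H d ↔ x ∈ G d) : DirectSum.IsInternal H := by
  have he' : ∀ d y, e.symm y ∈ G d ↔ y ∈ H d := fun d y => by
    rw [← he, LinearEquiv.apply_symm_apply]
  refine isInternal_of_proj (fun d => e.toLinearMap ∘ₗ gproj hG d ∘ₗ e.symm.toLinearMap) ?_ ?_ ?_
  · intro d y hy
    simp [gproj_of_mem hG ((he' d y).mpr hy)]
  · intro d d' y hy hne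
    simp [gproj_of_mem_ne hG ((he' d' y).mpr hy) hne]
  · intro y
    obtain ⟨x, rfl⟩ := e.surjective y
    induction x using IsInternal.induction hG with
    | zero => simp
    | add x y hx hy => rw [map_add]; exact add_mem hx hy
    | mem d x hx => exact Submodule.mem_iSup_of_mem d ((he d x).mpr hx)

lemma IsInternal.shift (hG : DirectSum.IsInternal G) (k : ℤ) :
    DirectSum.IsInternal fun d => G (d - k) := by
  refine isInternal_of_proj (fun d => gproj hG (d - k)) (fun d x hx => gproj_of_mem hG hx)
    (fun d e x hx hne => gproj_of_mem_ne hG hx fun h => hne (by linarith)) fun x => ?_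
  induction x using IsInternal.induction hG with
  | zero => simp
  | add x y hx hy => exact add_mem hx hy
  | mem d x hx =>
    exact Submodule.mem_iSup_of_mem (d + k) (by simpa using hx)

/-- A surjective map whose kernel is homogeneous transports an internal grading. -/
lemma IsInternal.map_of_ker (hG : DirectSum.IsInternal G) (f : M →ₗ[ℝ] N)
    (hf : Function.Surjective f) (hker : ∀ d x, f x = 0 → f (gproj hG d x) = 0) :
    DirectSum.IsInternal fun d => (G d).map f := by
  let π : ℤ → N →ₗ[ℝ] N := fun d =>
    (LinearMap.ker f).liftQ (f ∘ₗ gproj hG d) (fun x hx => hker d x hx) ∘ₗ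
      (f.quotKerEquivOfSurjective hf).symm.toLinearMap
  have hπ : ∀ d x, π d (f x) = f (gproj hG d x) := by
    intro d x
    have : (f.quotKerEquivOfSurjective hf).symm (f x) = (LinearMap.ker f).mkQ x := by
      rw [LinearEquiv.symm_apply_eq]; rfl
    simp only [π, LinearMap.comp_apply, LinearEquiv.coe_coe, this]
    rfl
  refine isInternal_of_proj π ?_ ?_ ?_
  · rintro d _ ⟨x, hx, rfl⟩
    rw [hπ, gproj_of_mem hG hx]
  · rintro d e _ ⟨x, hx, rfl⟩ hne
    rw [hπ, gproj_of_mem_ne hG hx hne, map_zero]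
  · intro y
    obtain ⟨x, rfl⟩ := hf y
    induction x using IsInternal.induction hG with
    | zero => simp
    | add x y hx hy => rw [map_add]; exact add_mem hx hy
    | mem d x hx => exact Submodule.mem_iSup_of_mem d ⟨x, hx, rfl⟩

/-- A homogeneous subspace inherits an internal grading. -/
lemma IsInternal.comap_of_range (hG : DirectSum.IsInternal G) (f : N →ₗ[ℝ] M)
    (hf : Function.Injective f) (hr : ∀ d y, gproj hG d (f y) ∈ LinearMap.range f) :
    DirectSum.IsInternal fun d => (G d).comap f := by
  have hr' : ∀ d y, ∃ z, f z = gproj hG d (f y) := hr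
  let e := LinearEquiv.ofInjective f hf
  let π : ℤ → N →ₗ[ℝ] N := fun d => e.symm.toLinearMap ∘ₗ
    (gproj hG d ∘ₗ f).codRestrict (LinearMap.range f) (hr d)
  have hπ : ∀ d y, f (π d y) = gproj hG d (f y) := by
    intro d y
    have : ∀ z : LinearMap.range f, f (e.symm z) = z := fun z =>
      congrArg Subtype.val (e.apply_symm_apply z)
    exact this _
  refine isInternal_of_proj π ?_ ?_ ?_
  · intro d y hy
    exact hf (by rw [hπ, gproj_of_mem hG hy])
  · intro d e y hy hne
    exact hf (by rw [hπ, gproj_of_mem_ne hG hy hne, map_zero])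
  · intro y
    obtain ⟨s, hs⟩ := exists_sum_gproj hG (f y)
    have : y = ∑ d ∈ s, π d y := hf (by simp only [map_sum, hπ, hs s subset_rfl])
    rw [this]
    refine sum_mem fun d _ => Submodule.mem_iSup_of_mem d ?_
    change f (π d y) ∈ G d
    rw [hπ]
    exact gproj_mem hG d _

/-- The part of degree `k` of a linear map between graded vector spaces. -/
def gcomp (hG : DirectSum.IsInternal G) (hH : DirectSum.IsInternal H) (f : M →ₗ[ℝ] N) (k : ℤ) :
    M →ₗ[ℝ] N :=
  DirectSum.toModule ℝ ℤ N (fun j => gproj hH (j + k) ∘ₗ f ∘ₗ (G j).subtype) ∘ₗ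
    (gdecomp hG).toLinearMap

lemma gcomp_of_mem (hG : DirectSum.IsInternal G) (hH : DirectSum.IsInternal H) (f : M →ₗ[ℝ] N)
    (k : ℤ) {j : ℤ} {x : M} (hx : x ∈ G j) : gcomp hG hH f k x = gproj hH (j + k) (f x) := by
  simp only [gcomp, LinearMap.comp_apply, LinearEquiv.coe_coe, gdecomp_of_mem hG hx]
  simp [DirectSum.toModule_lof]

lemma gcomp_mem (hG : DirectSum.IsInternal G) (hH : DirectSum.IsInternal H) (f : M →ₗ[ℝ] N)
    (k : ℤ) {j : ℤ} {x : M} (hx : x ∈ G j) : gcomp hG hH f k x ∈ H (j + k) := by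
  rw [gcomp_of_mem hG hH f k hx]
  exact gproj_mem _ _ _

end GradedVectorSpaces

/-! ### Graded modules -/

section GradedModules

variable {R : Type*} [CommRing R] [Algebra ℝ R] {𝒜 : ℤ → Submodule ℝ R}
  {X Y : Type*} [AddCommGroup X] [Module ℝ X] [Module R X] [IsScalarTower ℝ R X]
  [AddCommGroup Y] [Module ℝ Y] [Module R Y] [IsScalarTower ℝ R Y]
  {G : ℤ → Submodule ℝ X} {H : ℤ → Submodule ℝ Y}

variable (𝒜 G) in
/-- The compatibility of the gradings of a ring and a module. -/
def SMulGraded : Prop := ∀ (i j : ℤ) (a : R) (x : X), a ∈ 𝒜 i → x ∈ G j → a • x ∈ G (i + j)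

lemma gproj_smul (hG : DirectSum.IsInternal G) (hs : SMulGraded 𝒜 G) {i : ℤ} {a : R}
    (ha : a ∈ 𝒜 i) (d : ℤ) (x : X) : gproj hG d (a • x) = a • gproj hG (d - i) x := by
  induction x using IsInternal.induction hG with
  | zero => simp
  | add x y hx hy => simp [smul_add, hx, hy]
  | mem e x hx =>
    rw [gproj_of_mem_ite hG hx, gproj_of_mem_ite hG (hs i e a x ha hx)]
    by_cases h : e = d - i
    · rw [if_pos h, if_pos (by linarith)]
    · rw [if_neg h, if_neg (fun h' => h (by linarith)), smul_zero]

/-- On homogeneous scalars and vectors both sides are the same homogeneous part of `f (a • x)`. Thus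
a lift provided by projectivity can be made homogeneous without losing linearity over the ring. -/
lemma gcomp_smul (hA : DirectSum.IsInternal 𝒜) (hG : DirectSum.IsInternal G)
    (hsG : SMulGraded 𝒜 G) (hH : DirectSum.IsInternal H) (hsH : SMulGraded 𝒜 H)
    (f : X →ₗ[ℝ] Y) (hf : ∀ (a : R) x, f (a • x) = a • f x) (k : ℤ) (a : R) (x : X) :
    gcomp hG hH f k (a • x) = a • gcomp hG hH f k x := by
  induction x using IsInternal.induction hG with
  | zero => simp
  | add x y hx hy => simp [smul_add, hx, hy]
  | mem j x hx =>
    induction a using IsInternal.induction hA with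
    | zero => simp
    | add a b ha hb => simp [add_smul, ha, hb]
    | mem i a ha =>
      rw [gcomp_of_mem hG hH f k (hsG i j a x ha hx), gcomp_of_mem hG hH f k hx, hf,
        gproj_smul hH hsH ha]
      congr 3
      ring

/-- The part of degree `k` of a homomorphism between graded modules. -/
def gcompLin (hA : DirectSum.IsInternal 𝒜) (hG : DirectSum.IsInternal G)
    (hsG : SMulGraded 𝒜 G) (hH : DirectSum.IsInternal H) (hsH : SMulGraded 𝒜 H)
    (f : X →ₗ[R] Y) (k : ℤ) : X →ₗ[R] Y where
  toFun := gcomp hG hH (f.restrictScalars ℝ) k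
  map_add' := map_add _
  map_smul' a x := gcomp_smul hA hG hsG hH hsH _ (fun a x => f.map_smul a x) k a x

/-- **Graded Nakayama lemma.** -/
lemma eq_top_of_sup_smul_eq_top (hG : DirectSum.IsInternal G) (hs : SMulGraded 𝒜 G)
    {b : ℤ} (hb : ∀ d < b, G d = ⊥) {S : Set R} (hS : ∀ s ∈ S, ∃ i, 0 < i ∧ s ∈ 𝒜 i)
    {Z : Submodule R X} (hZ : ∀ d, ∀ x ∈ Z, gproj hG d x ∈ Z)
    (htop : Z ⊔ Ideal.span S • (⊤ : Submodule R X) = ⊤) : Z = ⊤ := by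
  -- Induction on the degree, starting from the bound `b`. The part of degree `d` of an element of
  -- `span S • ⊤` only involves vectors of degree less than `d`, because elements of `S` have
  -- positive degree; these already lie in `Z`.
  have key : ∀ n : ℕ, ∀ d < b + n, ∀ x ∈ G d, x ∈ Z := by
    intro n
    induction n with
    | zero =>
      intro d hd x hx
      rw [hb d (by simpa using hd), Submodule.mem_bot] at hx
      rw [hx]; exact zero_mem _
    | succ n ih =>
      intro d hd x hx
      have hz : ∀ z ∈ Ideal.span S • (⊤ : Submodule R X), gproj hG d z ∈ Z := by
        intro z hz
        induction hz using Submodule.smul_induction_on' with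
        | smul r hr n _ =>
          induction hr using Submodule.span_induction generalizing n with
          | mem s hs' =>
            obtain ⟨i, hi, hsi⟩ := hS s hs'
            rw [gproj_smul hG hs hsi]
            refine Z.smul_mem s (ih (d - i) ?_ _ (gproj_mem hG _ _))
            push_cast at hd
            linarith
          | zero => simp
          | add r r' _ _ h h' =>
            rw [add_smul, map_add]
            exact add_mem (h n trivial) (h' n trivial)
          | smul a r _ h =>
            rw [smul_eq_mul, mul_comm, mul_smul]
            exact h (a • n) trivial
        | add z _ z' _ h h' => rw [map_add]; exact add_mem h h'
      have hx' : x ∈ Z ⊔ Ideal.span S • (⊤ : Submodule R X) := by rw [htop]; trivial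
      obtain ⟨y, hy, z, hz', rfl⟩ := Submodule.mem_sup.mp hx'
      rw [← gproj_of_mem hG hx, map_add]
      exact add_mem (hZ d y hy) (hz z hz')
  rw [eq_top_iff]
  intro x _
  induction x using IsInternal.induction hG with
  | zero => exact zero_mem _
  | add x y hx hy => exact add_mem (hx trivial) (hy trivial)
  | mem d x hx =>
    refine key (d - b + 1).toNat d ?_ x hx
    have := Int.self_le_toNat (d - b + 1)
    linarith

end GradedModules
end

noncomputable section

/-! ### Symmetric algebras -/

section SymmetricAlgebras

variable {U W : Type*} [AddCommGroup U] [Module ℝ U] [AddCommGroup W] [Module ℝ W]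

/-- The kernel of the map of symmetric algebras induced by a surjection whose kernel is spanned
by `h` is the principal ideal `(h)`. -/
lemma mem_span_of_lift_eq_zero (f : U →ₗ[ℝ] W) (hf : Function.Surjective f) (h : U)
    (hh : LinearMap.ker f = Submodule.span ℝ {h}) (a : SymmetricAlgebra ℝ U)
    (ha : SymmetricAlgebra.lift (SymmetricAlgebra.ι ℝ W ∘ₗ f) a = 0) :
    a ∈ Ideal.span {SymmetricAlgebra.ι ℝ U h} := by
  obtain ⟨g, hg⟩ := f.exists_rightInverse_of_surjective (LinearMap.range_eq_top.mpr hf)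
  let I : Ideal (SymmetricAlgebra ℝ U) := Ideal.span {SymmetricAlgebra.ι ℝ U h}
  let Sf := SymmetricAlgebra.lift (SymmetricAlgebra.ι ℝ W ∘ₗ f)
  let Sg := SymmetricAlgebra.lift (SymmetricAlgebra.ι ℝ U ∘ₗ g)
  -- For a linear section `g` of `f`, each `g (f u) - u` lies in the kernel, the line through `h`.
  -- So `Sg ∘ Sf` is the identity modulo `(h)`, and an element killed by `Sf` is zero modulo `(h)`.
  have key : ((Ideal.Quotient.mkₐ ℝ I).comp Sg).comp Sf = Ideal.Quotient.mkₐ ℝ I := by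
    apply SymmetricAlgebra.algHom_ext
    ext u
    change Ideal.Quotient.mk I (Sg (Sf (SymmetricAlgebra.ι ℝ U u))) =
      Ideal.Quotient.mk I (SymmetricAlgebra.ι ℝ U u)
    simp only [Sf, Sg, SymmetricAlgebra.lift_ι_apply, LinearMap.comp_apply]
    rw [Ideal.Quotient.eq, ← map_sub]
    have hk : g (f u) - u ∈ LinearMap.ker f := by
      have := LinearMap.congr_fun hg (f u)
      simp only [LinearMap.comp_apply, LinearMap.id_apply] at this
      simp [this]
    rw [hh] at hk
    obtain ⟨c, hc⟩ := Submodule.mem_span_singleton.mp hk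
    rw [← hc, map_smul, Algebra.smul_def]
    exact Ideal.mul_mem_left _ _ (Ideal.subset_span rfl)
  have h2 := AlgHom.congr_fun key a
  simp only [AlgHom.comp_apply] at h2
  rw [show Sf a = 0 from ha, map_zero, map_zero] at h2
  exact Ideal.Quotient.eq_zero_iff_mem.mp h2.symm

lemma SymmetricAlgebra.isNoetherianRing [FiniteDimensional ℝ U] :
    IsNoetherianRing (SymmetricAlgebra ℝ U) :=
  isNoetherianRing_of_ringEquiv _
    (SymmetricAlgebra.equivMvPolynomial (Module.finBasis ℝ U)).symm.toRingEquiv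

/-- In coordinates, powers of the space of linear forms become the spaces of homogeneous
polynomials; this gives access to homogeneous components as projections. -/
lemma SymmetricAlgebra.map_range_ι_pow [FiniteDimensional ℝ U] (k : ℕ) :
    ((LinearMap.range (SymmetricAlgebra.ι ℝ U)) ^ k).map
      (SymmetricAlgebra.equivMvPolynomial (Module.finBasis ℝ U)).toLinearMap =
      MvPolynomial.homogeneousSubmodule _ ℝ k := by
  set b := Module.finBasis ℝ U
  set e := SymmetricAlgebra.equivMvPolynomial b
  have h1 := Submodule.map_pow (LinearMap.range (SymmetricAlgebra.ι ℝ U)) e.toAlgHom k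
  refine h1.trans ?_
  rw [← MvPolynomial.homogeneousSubmodule_one_pow]
  congr 1
  rw [MvPolynomial.homogeneousSubmodule_one_eq_span_X, LinearMap.range_eq_map, ← b.span_eq,
    Submodule.map_span, Submodule.map_span, ← Set.range_comp, ← Set.range_comp]
  congr 2
  ext i
  simp [e]

end SymmetricAlgebras

/-! ### The grading of polynomial functions and the linear forms of facets -/

namespace Fan

variable {V : Type u} [AddCommGroup V] [Module ℝ V] {Δ : Fan V}

lemma degA_two_mul (σ : Δ.Cone) (k : ℕ) :
    degA σ (2 * (k : ℤ)) = (LinearMap.range (lin σ)) ^ k := by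
  refine le_antisymm (iSup₂_le fun j hj => ?_) (le_iSup₂_of_le k rfl le_rfl)
  have : j = k := by omega
  rw [this]

lemma degA_eq_bot (σ : Δ.Cone) (d : ℤ) (hd : ∀ k : ℕ, d ≠ 2 * (k : ℤ)) : degA σ d = ⊥ :=
  le_bot_iff.mp (iSup₂_le fun k hk => (hd k hk).elim)

lemma degA_of_neg (σ : Δ.Cone) (d : ℤ) (hd : d < 0) : degA σ d = ⊥ :=
  degA_eq_bot σ d fun k hk => by omega

lemma degA_cases {σ : Δ.Cone} {d : ℤ} {a : A σ} (ha : a ∈ degA σ d) :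
    a = 0 ∨ ∃ k : ℕ, d = 2 * (k : ℤ) ∧ a ∈ (LinearMap.range (lin σ)) ^ k := by
  by_cases h : ∃ k : ℕ, d = 2 * (k : ℤ)
  · obtain ⟨k, rfl⟩ := h
    rw [degA_two_mul] at ha
    exact Or.inr ⟨k, rfl, ha⟩
  · push Not at h
    rw [degA_eq_bot σ d h] at ha
    exact Or.inl ha

lemma lin_mem_degA (σ : Δ.Cone) (x : Module.Dual ℝ (Sp σ)) : lin σ x ∈ degA σ 2 := by
  have := degA_two_mul σ 1
  rw [pow_one, Nat.cast_one, mul_one] at this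
  rw [this]
  exact ⟨x, rfl⟩

lemma mul_mem_degA {σ : Δ.Cone} {i j : ℤ} {a b : A σ} (ha : a ∈ degA σ i) (hb : b ∈ degA σ j) :
    a * b ∈ degA σ (i + j) := by
  obtain rfl | ⟨k, rfl, ha'⟩ := degA_cases ha
  · rw [zero_mul]; exact zero_mem _
  obtain rfl | ⟨l, rfl, hb'⟩ := degA_cases hb
  · rw [mul_zero]; exact zero_mem _
  have := degA_two_mul σ (k + l)
  rw [Nat.cast_add, mul_add] at this
  rw [this, pow_add]
  exact Submodule.mul_mem_mul ha' hb'

lemma smulGraded_degA (σ : Δ.Cone) : SMulGraded (degA σ) (degA σ) :=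
  fun _ _ _ _ ha hb => mul_mem_degA ha hb

lemma resA_mem_degA {τ σ : Δ.Cone} (h : τ ≤ σ) {d : ℤ} {a : A σ} (ha : a ∈ degA σ d) :
    resA h a ∈ degA τ d := by
  obtain rfl | ⟨k, rfl, ha'⟩ := degA_cases ha
  · rw [map_zero]; exact zero_mem _
  rw [degA_two_mul]
  have h1 := Submodule.map_pow (LinearMap.range (lin σ)) (resA h) k
  have h2 : (LinearMap.range (lin σ)).map (resA h).toLinearMap ≤ LinearMap.range (lin τ) := by
    rintro _ ⟨_, ⟨x, rfl⟩, rfl⟩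
    exact ⟨_, (resA_lin h x).symm⟩
  have h3 : resA h a ∈ ((LinearMap.range (lin σ)) ^ k).map (resA h).toLinearMap := ⟨a, ha', rfl⟩
  rw [h1] at h3
  exact (pow_le_pow_left' h2 k) h3

/-- The evaluation at the origin. -/
def evalZero (σ : Δ.Cone) : A σ →ₐ[ℝ] ℝ := SymmetricAlgebra.algebraMapInv

lemma sub_evalZero_mem (σ : Δ.Cone) (a : A σ) :
    a - algebraMap ℝ (A σ) (evalZero σ a) ∈ maxIdeal σ := by
  induction a using SymmetricAlgebra.induction with
  | algebraMap r => simp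
  | ι x =>
    rw [evalZero, SymmetricAlgebra.algebraMapInv_ι, map_zero, sub_zero]
    exact Ideal.subset_span ⟨x, rfl⟩
  | mul a b ha hb =>
    have : a * b - algebraMap ℝ (A σ) (evalZero σ (a * b)) =
        a * (b - algebraMap ℝ (A σ) (evalZero σ b)) +
        algebraMap ℝ (A σ) (evalZero σ b) * (a - algebraMap ℝ (A σ) (evalZero σ a)) := by
      rw [map_mul, map_mul]; ring
    rw [this]
    exact add_mem (Ideal.mul_mem_left _ _ hb) (Ideal.mul_mem_left _ _ ha)
  | add a b ha hb =>
    rw [map_add, map_add, add_sub_add_comm]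
    exact add_mem ha hb

lemma maxIdeal_generators (σ : Δ.Cone) :
    ∀ s ∈ Set.range (lin σ), ∃ i, 0 < i ∧ s ∈ degA σ i := by
  rintro _ ⟨x, rfl⟩
  exact ⟨2, two_pos, lin_mem_degA σ x⟩

lemma lin_injective (σ : Δ.Cone) [FiniteDimensional ℝ V] : Function.Injective (lin σ) := by
  intro x y hxy
  set b := Module.finBasis ℝ (Module.Dual ℝ (Sp σ))
  have h : ∀ z, SymmetricAlgebra.equivMvPolynomial b (lin σ z) =
      Module.Basis.constr b ℝ (MvPolynomial.X (R := ℝ)) z := fun z =>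
    SymmetricAlgebra.lift_ι_apply _ _
  have h2 := congrArg (SymmetricAlgebra.equivMvPolynomial b) hxy
  rw [h, h, ← sub_eq_zero, ← map_sub] at h2
  rw [← sub_eq_zero]
  set z := x - y
  refine b.ext_elem fun i => ?_
  rw [Module.Basis.constr_apply_fintype] at h2
  have h3 := congrArg (MvPolynomial.coeff (Finsupp.single i 1)) h2
  simp only [MvPolynomial.coeff_sum, MvPolynomial.coeff_smul, MvPolynomial.coeff_X,
    MvPolynomial.coeff_zero, Finsupp.single_left_inj one_ne_zero] at h3
  simpa using h3

variable [FiniteDimensional ℝ V]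

instance (σ : Δ.Cone) : IsNoetherianRing (A σ) := SymmetricAlgebra.isNoetherianRing

lemma isInternal_degA (σ : Δ.Cone) : DirectSum.IsInternal (degA σ) := by
  classical
  let e := SymmetricAlgebra.equivMvPolynomial (Module.finBasis ℝ (Module.Dual ℝ (Sp σ)))
  have he : ∀ (k : ℕ) (a : A σ), a ∈ degA σ (2 * (k : ℤ)) ↔ (e a).IsHomogeneous k := by
    intro k a
    rw [degA_two_mul, ← MvPolynomial.mem_homogeneousSubmodule,
      ← SymmetricAlgebra.map_range_ι_pow]
    refine ⟨fun h => ⟨a, h, rfl⟩, ?_⟩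
    rintro ⟨b, hb, hba⟩
    rwa [← e.injective hba]
  -- Linear forms have degree 2, so the projection to degree `d` is the homogeneous component of
  -- degree `d / 2` for even `d ≥ 0` and zero otherwise.
  let π : ℤ → A σ →ₗ[ℝ] A σ := fun d =>
    if 2 ∣ d ∧ 0 ≤ d then e.symm.toLinearMap ∘ₗ
      MvPolynomial.homogeneousComponent (d / 2).toNat ∘ₗ e.toLinearMap else 0
  have hπ : ∀ (k : ℕ) a, π (2 * (k : ℤ)) a = e.symm (MvPolynomial.homogeneousComponent k (e a)) := by
    intro k a
    have h2 : ((2 * (k : ℤ)) / 2).toNat = k := by omega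
    simp only [π]
    rw [if_pos ⟨dvd_mul_right _ _, by positivity⟩, h2]
    rfl
  refine isInternal_of_proj π ?_ ?_ ?_
  · intro d a ha
    obtain rfl | ⟨k, rfl, -⟩ := degA_cases ha
    · simp
    rw [hπ, MvPolynomial.homogeneousComponent_of_mem ((he k a).mp ha), if_pos rfl]
    simp
  · intro d d' a ha hne
    by_cases hd : 2 ∣ d ∧ 0 ≤ d
    · obtain ⟨⟨c, hc⟩, hd0⟩ := hd
      obtain ⟨k, rfl⟩ : ∃ k : ℕ, d = 2 * (k : ℤ) := ⟨c.toNat, by omega⟩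
      obtain rfl | ⟨l, rfl, -⟩ := degA_cases ha
      · simp
      rw [hπ, MvPolynomial.homogeneousComponent_of_mem ((he l a).mp ha), if_neg]
      · simp
      · rintro rfl; exact hne rfl
    · simp only [π, if_neg hd, LinearMap.zero_apply]
  · intro a
    have : a = e.symm (∑ i ∈ Finset.range ((e a).totalDegree + 1),
        MvPolynomial.homogeneousComponent i (e a)) := by
      rw [MvPolynomial.sum_homogeneousComponent, AlgEquiv.symm_apply_apply]
    rw [this, map_sum]
    refine sum_mem fun k _ => Submodule.mem_iSup_of_mem (2 * (k : ℤ)) ?_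
    rw [he, AlgEquiv.apply_symm_apply]
    exact MvPolynomial.homogeneousComponent_isHomogeneous _ _

lemma IsFacet.form_ne_zero {τ σ : Δ.Cone} (ht : IsFacet τ σ) : ht.form ≠ 0 := by
  obtain ⟨v, hv⟩ := ht.exists_vector
  intro h
  rw [h] at hv
  simp at hv

lemma IsFacet.form_comp_incl {τ σ : Δ.Cone} (ht : IsFacet τ σ) : ht.form ∘ₗ incl ht.1 = 0 := by
  ext x
  have : incl ht.1 x ∈ LinearMap.ker ht.form := by rw [ht.ker_form]; exact ⟨x, rfl⟩
  exact this

lemma IsFacet.form_vector {τ σ : Δ.Cone} (ht : IsFacet τ σ) : ht.form ht.vector = 1 :=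
  ht.exists_vector.choose_spec

/-- A form vanishing on a facet is a multiple of the form defining that facet. -/
lemma IsFacet.eq_smul_form {τ σ : Δ.Cone} (ht : IsFacet τ σ) (g : Module.Dual ℝ (Sp σ))
    (hg : g ∘ₗ incl ht.1 = 0) : g = g ht.vector • ht.form := by
  ext x
  have hx : x - ht.form x • ht.vector ∈ LinearMap.ker ht.form := by
    rw [LinearMap.mem_ker, map_sub, map_smul, ht.form_vector, smul_eq_mul, mul_one, sub_self]
  rw [ht.ker_form] at hx
  obtain ⟨y, hy⟩ := hx
  have h1 : g (incl ht.1 y) = 0 := LinearMap.congr_fun hg y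
  rw [hy, map_sub, map_smul, sub_eq_zero] at h1
  rw [h1, LinearMap.smul_apply, smul_eq_mul, smul_eq_mul, mul_comm]

/-- Restriction is induced by the surjection of dual spaces whose kernel is the line through the
form of the facet. This is the source of all divisions by facet forms. -/
lemma IsFacet.dvd_of_resA_eq_zero {τ σ : Δ.Cone} (ht : IsFacet τ σ) {a : A σ}
    (ha : resA ht.1 a = 0) : lin σ ht.form ∣ a := by
  rw [← Ideal.mem_span_singleton]
  refine mem_span_of_lift_eq_zero _ (LinearMap.dualMap_surjective_of_injective
    (Submodule.inclusion_injective (sp_mono ht.1))) _ (le_antisymm ?_ ?_) a ha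
  · intro g hg
    rw [ht.eq_smul_form g (LinearMap.mem_ker.mp hg)]
    exact Submodule.smul_mem _ _ (Submodule.mem_span_singleton_self _)
  · rw [Submodule.span_singleton_le_iff_mem]
    exact ht.form_comp_incl

lemma IsFacet.resA_eq_zero_iff {τ σ : Δ.Cone} (ht : IsFacet τ σ) {a : A σ} :
    resA ht.1 a = 0 ↔ lin σ ht.form ∣ a := by
  refine ⟨ht.dvd_of_resA_eq_zero, ?_⟩
  rintro ⟨b, rfl⟩
  rw [map_mul, ht.resA_form, zero_mul]

lemma IsFacet.lin_form_ne_zero {τ σ : Δ.Cone} (ht : IsFacet τ σ) : lin σ ht.form ≠ 0 := fun h =>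
  ht.form_ne_zero (lin_injective σ (h.trans (map_zero _).symm))

/-- The quotient of `A σ` by the form embeds into the domain `A τ`. -/
lemma IsFacet.prime_form {τ σ : Δ.Cone} (ht : IsFacet τ σ) : Prime (lin σ ht.form) := by
  refine ⟨ht.lin_form_ne_zero, ?_, ?_⟩
  · intro h
    obtain ⟨b, hb⟩ := h.exists_right_inv
    have := congrArg (resA ht.1) hb
    rw [map_mul, ht.resA_form, zero_mul, map_one] at this
    exact zero_ne_one this
  · intro a b hab
    rw [← ht.resA_eq_zero_iff, map_mul, mul_eq_zero] at hab
    simpa only [← ht.resA_eq_zero_iff] using hab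

/-- If the form of `τ` divided that of `τ'`, the latter would vanish on `τ`, so `τ` would be
contained in `τ'`. -/
lemma IsFacet.not_dvd {τ τ' σ : Δ.Cone} (ht : IsFacet τ σ) (ht' : IsFacet τ' σ) (hne : τ ≠ τ') :
    ¬ lin σ ht.form ∣ lin σ ht'.form := by
  rw [← ht.resA_eq_zero_iff, resA_lin]
  intro h
  have h0 : ht'.form ∘ₗ incl ht.1 = 0 := lin_injective τ (h.trans (map_zero _).symm)
  refine hne (ht.eq_of_le (fun x hx => ?_) ht'.lt).symm
  have hk : (⟨x, Submodule.subset_span (ht.1 hx)⟩ : Sp σ) ∈ LinearMap.ker ht'.form :=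
    LinearMap.congr_fun h0 ⟨x, Submodule.subset_span hx⟩
  rw [ht'.ker_form] at hk
  obtain ⟨y, hy⟩ := hk
  have hyx : (y : V) = x := congrArg Subtype.val hy
  exact mem_of_mem_sp ht'.1 (ht.1 hx) (hyx ▸ y.2)

end Fan
end

noncomputable section

/-! ### Polyhedral geometry -/

/-- **Farkas' lemma**, for linear forms. -/
lemma exists_nonneg_sum_eq {ι N : Type*} [AddCommGroup N] [Module ℝ N] (s : Finset ι)
    (a : ι → Module.Dual ℝ N) (b : Module.Dual ℝ N)
    (h : ∀ x, (∀ i ∈ s, 0 ≤ a i x) → 0 ≤ b x) :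
    ∃ c : ι → ℝ, (∀ i ∈ s, 0 ≤ c i) ∧ b = ∑ i ∈ s, c i • a i := by
  classical
  induction s using Finset.induction_on generalizing a b with
  | empty =>
    refine ⟨0, by simp, ?_⟩
    ext x
    have h1 := h x (by simp)
    have h2 := h (-x) (by simp)
    rw [map_neg] at h2
    simp only [Finset.sum_empty, LinearMap.zero_apply]
    linarith
  | insert m s hm ih =>
    by_cases hb : ∀ x, (∀ i ∈ s, 0 ≤ a i x) → 0 ≤ b x
    · obtain ⟨c, hc, rfl⟩ := ih a b hb
      refine ⟨fun i => if i = m then 0 else c i, ?_, ?_⟩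
      · intro i hi
        change 0 ≤ if i = m then 0 else c i
        split_ifs with him
        · exact le_rfl
        · exact hc i ((Finset.mem_insert.mp hi).resolve_left him)
      · rw [Finset.sum_insert hm]
        beta_reduce
        rw [if_pos rfl, zero_smul, zero_add]
        refine Finset.sum_congr rfl fun i hi => ?_
        rw [if_neg (ne_of_mem_of_not_mem hi hm)]
    · push Not at hb
      obtain ⟨x₀, hx₀, hbx⟩ := hb
      have hm0 : a m x₀ < 0 := by
        by_contra! h0
        refine absurd (h x₀ fun i hi => ?_) (not_le.mpr hbx)
        obtain rfl | hi := Finset.mem_insert.mp hi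
        · exact h0
        · exact hx₀ i hi
      -- The modified form f - (f x₀ / a m x₀) a m is `f` composed with the projection along `x₀`
      -- onto the kernel of `a m`. There the constraint `m` holds automatically, so the remaining
      -- constraints suffice. The resulting coefficient of `a m` is non-negative because `b x₀` and
      -- `a m x₀` are negative and the other `a i x₀` are not.
      obtain ⟨c, hc, hbc⟩ := ih (fun i => a i - (a i x₀ / a m x₀) • a m)
        (b - (b x₀ / a m x₀) • a m) (by
          intro x hx
          have key : ∀ f : Module.Dual ℝ N, (f - (f x₀ / a m x₀) • a m) x =
              f (x - (a m x / a m x₀) • x₀) := by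
            intro f
            simp only [LinearMap.sub_apply, LinearMap.smul_apply, smul_eq_mul, map_sub, map_smul]
            ring
          rw [key]
          refine h _ fun i hi => ?_
          obtain rfl | hi := Finset.mem_insert.mp hi
          · simp only [map_sub, map_smul, smul_eq_mul]
            rw [div_mul_cancel₀ _ hm0.ne, sub_self]
          · rw [← key]; exact hx i hi)
      refine ⟨fun i => if i = m then b x₀ / a m x₀ - ∑ i ∈ s, c i * (a i x₀ / a m x₀) else c i,
        ?_, ?_⟩
      · intro i hi
        change 0 ≤ if i = m then _ else c i
        split_ifs with him
        · rw [sub_nonneg]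
          refine (Finset.sum_nonpos fun i hi => ?_).trans (div_pos_of_neg_of_neg hbx hm0).le
          exact mul_nonpos_of_nonneg_of_nonpos (hc i hi)
            (div_nonpos_of_nonneg_of_nonpos (hx₀ i hi) hm0.le)
        · exact hc i ((Finset.mem_insert.mp hi).resolve_left him)
      · rw [Finset.sum_insert hm]
        beta_reduce
        rw [if_pos rfl]
        have hs : ∑ i ∈ s, (if i = m then b x₀ / a m x₀ - ∑ i ∈ s, c i * (a i x₀ / a m x₀)
            else c i) • a i = ∑ i ∈ s, c i • a i :=
          Finset.sum_congr rfl fun i hi => by rw [if_neg (ne_of_mem_of_not_mem hi hm)]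
        rw [hs]
        rw [sub_eq_iff_eq_add] at hbc
        refine hbc.trans ?_
        ext x
        simp only [smul_sub, Finset.sum_sub_distrib, smul_smul, LinearMap.add_apply,
          LinearMap.sub_apply, LinearMap.sum_apply, LinearMap.smul_apply, smul_eq_mul, sub_mul,
          Finset.sum_mul]
        ring

/-- Farkas' lemma on the dual space, for the evaluations at the generators: without a separating
form, evaluation at `y` would be a non-negative combination of them. -/
lemma exists_separating_form {V : Type*} [AddCommGroup V] [Module ℝ V] [FiniteDimensional ℝ V]
    (C : PointedCone ℝ V) (hC : C.FG) (y : V) (hy : y ∉ C) :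
    ∃ l : Module.Dual ℝ V, (∀ x ∈ C, 0 ≤ l x) ∧ l y < 0 := by
  obtain ⟨S, rfl⟩ := hC
  by_contra! hcon
  apply hy
  obtain ⟨c, hc, hyc⟩ := exists_nonneg_sum_eq S (fun s => Module.Dual.eval ℝ V s)
    (Module.Dual.eval ℝ V y) (by
      intro l hl
      refine hcon l fun x hx => ?_
      induction hx using Submodule.span_induction with
      | mem x hx => exact hl x hx
      | zero => simp
      | add x y _ _ hx hy => rw [map_add]; exact add_nonneg hx hy
      | smul c x _ hx =>
        have : l (c • x) = (c : ℝ) * l x := l.map_smul (c : ℝ) x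
        rw [this]
        exact mul_nonneg c.2 hx)
  have : y = ∑ s ∈ S, c s • s := by
    rw [← sub_eq_zero, ← Module.forall_dual_apply_eq_zero_iff ℝ]
    intro l
    have := LinearMap.congr_fun hyc l
    simp only [Module.Dual.eval_apply, LinearMap.sum_apply, LinearMap.smul_apply] at this
    simp [map_sub, map_sum, this]
  rw [this]
  exact sum_mem fun s hs => PointedCone.smul_mem _ (hc s hs) (Submodule.subset_span hs)

namespace Fan

variable {V : Type u} [AddCommGroup V] [Module ℝ V] {Δ : Fan V}

instance : Finite Δ.Cone := Δ.finite.to_subtype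

/-- A point of a cone as an element of its span. -/
def pt {σ : Δ.Cone} {x : V} (hx : x ∈ σ.1) : Sp σ := ⟨x, Submodule.subset_span hx⟩

/-- Two forms that agree on a cone agree on its span. -/
lemma dual_ext {σ : Δ.Cone} {f g : Module.Dual ℝ (Sp σ)}
    (h : ∀ (x : V) (hx : x ∈ σ.1), f (pt hx) = g (pt hx)) : f = g := by
  ext ⟨x, hx⟩
  induction hx using Submodule.span_induction with
  | mem x hx => exact h x hx
  | zero => exact (map_zero f).trans (map_zero g).symm
  | add x y hx hy h1 h2 =>
    exact (map_add f ⟨x, hx⟩ ⟨y, hy⟩).trans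
      ((congrArg₂ (· + ·) h1 h2).trans (map_add g ⟨x, hx⟩ ⟨y, hy⟩).symm)
  | smul c x hx h1 =>
    exact (map_smul f c ⟨x, hx⟩).trans
      ((congrArg (c • ·) h1).trans (map_smul g c ⟨x, hx⟩).symm)

/-- A form is non-negative on the cone. -/
def NonnegOn (σ : Δ.Cone) (l : Module.Dual ℝ (Sp σ)) : Prop :=
  ∀ (x : V) (hx : x ∈ σ.1), 0 ≤ l (pt hx)

/-- The points of `σ` at which a form vanishes. -/
def zeroSubcone (σ : Δ.Cone) (l : Module.Dual ℝ (Sp σ)) : PointedCone ℝ V where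
  carrier := {x | ∃ hx : x ∈ σ.1, l (pt hx) = 0}
  add_mem' := by
    rintro x y ⟨hx, hx'⟩ ⟨hy, hy'⟩
    refine ⟨add_mem hx hy, ?_⟩
    have : pt (add_mem hx hy) = pt hx + pt hy := rfl
    rw [this, map_add, hx', hy', add_zero]
  zero_mem' := ⟨σ.1.zero_mem, map_zero l⟩
  smul_mem' := by
    rintro c x ⟨hx, hx'⟩
    have hc : c • x ∈ σ.1 := Submodule.smul_mem σ.1 c hx
    refine ⟨hc, ?_⟩
    have : pt hc = (c : ℝ) • pt hx := rfl
    rw [this, map_smul, hx', smul_zero]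

/-- The face of `σ` on which a non-negative form vanishes. -/
def zeroFace (σ : Δ.Cone) (l : Module.Dual ℝ (Sp σ)) (hl : NonnegOn σ l) : Δ.Cone := by
  refine ⟨zeroSubcone σ l, Δ.face_mem σ.1 σ.2 _ ⟨?_, ?_⟩⟩
  · rintro x ⟨hx, -⟩
    exact hx
  · rintro x y a hx hy ha ⟨hxy, h0⟩
    refine ⟨hx, ?_⟩
    have : pt hxy = a • pt hx + pt hy := rfl
    rw [this, map_add, map_smul, smul_eq_mul] at h0
    have h1 := hl x hx
    have h2 := hl y hy
    have h3 : a * l (pt hx) = 0 := le_antisymm (by linarith) (mul_nonneg ha.le h1)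
    exact (mul_eq_zero.mp h3).resolve_left ha.ne'

lemma mem_zeroFace {σ : Δ.Cone} {l : Module.Dual ℝ (Sp σ)} {hl : NonnegOn σ l} {x : V}
    (hx : x ∈ σ.1) : x ∈ (zeroFace σ l hl).1 ↔ l (pt hx) = 0 :=
  ⟨fun ⟨_, h⟩ => h, fun h => ⟨hx, h⟩⟩

lemma zeroFace_le {σ : Δ.Cone} {l : Module.Dual ℝ (Sp σ)} {hl : NonnegOn σ l} :
    zeroFace σ l hl ≤ σ := fun _ hx => hx.1

/-- The intersection of two cones of a fan. -/
def inter (σ τ : Δ.Cone) : Δ.Cone := ⟨σ.1 ⊓ τ.1, Δ.face_mem σ.1 σ.2 _ (Δ.inter_face σ.1 σ.2 τ.1 τ.2)⟩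

/-- Collects what finitely many generators suffice to test: containment in another cone of the fan,
non-negativity of a form, and spanning. -/
lemma exists_generators (σ : Δ.Cone) : ∃ S : Finset V, (∀ x ∈ S, x ∈ σ.1) ∧
    (∀ τ : Δ.Cone, (∀ x ∈ S, x ∈ τ.1) → σ ≤ τ) ∧
    (∀ (l : Module.Dual ℝ (Sp σ)), (∀ x (hx : x ∈ σ.1), x ∈ S → 0 ≤ l (pt hx)) → NonnegOn σ l) ∧
    ∀ W : Submodule ℝ (Sp σ), (∀ x (hx : x ∈ σ.1), x ∈ S → pt hx ∈ W) → W = ⊤ := by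
  obtain ⟨S, hS⟩ := Δ.polyhedral σ.1 σ.2
  have hS' : ∀ x ∈ S, x ∈ σ.1 := fun x hx => hS ▸ Submodule.subset_span hx
  refine ⟨S, hS', fun τ h => ?_, fun l h x hx => ?_, fun W h => ?_⟩
  · change σ.1 ≤ τ.1
    rw [← hS]
    exact Submodule.span_le.mpr h
  · have hx' := hx
    rw [← hS] at hx'
    induction hx' using Submodule.span_induction with
    | mem x hx' => exact h x hx hx'
    | zero => exact (map_zero l).ge
    | add x y hx' hy' h1 h2 =>
      rw [hS] at hx' hy'
      have : pt hx = pt hx' + pt hy' := rfl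
      rw [this, map_add]
      exact add_nonneg (h1 hx') (h2 hy')
    | smul c x hx' h1 =>
      rw [hS] at hx'
      have : pt hx = (c : ℝ) • pt hx' := rfl
      rw [this, map_smul]
      exact mul_nonneg c.2 (h1 hx')
  · rw [eq_top_iff]
    have hle : σ.1 ≤ (W.map (Sp σ).subtype).restrictScalars NNReal := by
      rw [← hS]
      refine Submodule.span_le.mpr fun x hx => ?_
      exact ⟨pt (hS' x hx), h x (hS' x hx) hx, rfl⟩
    have hle' : Sp σ ≤ W.map (Sp σ).subtype := Submodule.span_le.mpr hle
    intro x _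
    obtain ⟨y, hy, hyx⟩ := hle' x.2
    rwa [← Subtype.ext hyx]

/-- A cone has a point that lies in no proper face. -/
lemma exists_interior (σ : Δ.Cone) : ∃ x ∈ σ.1, ∀ τ < σ, x ∉ τ.1 := by
  obtain ⟨S, hS, hS', -⟩ := exists_generators σ
  -- A face containing the sum of the generators contains every generator.
  refine ⟨∑ x ∈ S, x, sum_mem hS, fun τ hτ hx => hτ.not_ge (hS' τ fun x hxS => ?_)⟩
  rw [← Finset.sum_coe_sort] at hx
  exact (isFaceOf hτ.le).mem_of_sum_mem (f := fun x : S => (x : V)) (fun i => hS i.1 i.2) hx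
    ⟨x, hxS⟩

variable [FiniteDimensional ℝ V]

lemma IsFacet.form_nonneg {τ σ : Δ.Cone} (ht : IsFacet τ σ) : NonnegOn σ ht.form :=
  fun x hx => ht.exists_form.choose_spec.2 _ hx

lemma IsFacet.form_eq_zero_iff {τ σ : Δ.Cone} (ht : IsFacet τ σ) {x : V} (hx : x ∈ σ.1) :
    ht.form (pt hx) = 0 ↔ x ∈ τ.1 := by
  constructor
  · intro h
    have : pt hx ∈ LinearMap.ker ht.form := h
    rw [ht.ker_form] at this
    obtain ⟨y, hy⟩ := this
    have hyx : (y : V) = x := congrArg Subtype.val hy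
    exact mem_of_mem_sp ht.1 hx (hyx ▸ y.2)
  · intro h
    exact LinearMap.congr_fun ht.form_comp_incl (pt h)

lemma IsFacet.form_pos {τ σ : Δ.Cone} (ht : IsFacet τ σ) {x : V} (hx : x ∈ σ.1) (hx' : x ∉ τ.1) :
    0 < ht.form (pt hx) :=
  lt_of_le_of_ne (ht.form_nonneg x hx) fun h => hx' ((ht.form_eq_zero_iff hx).mp h.symm)

/-- Separate `-x` from the cone σ + (-ρ). It is not in that cone because `ρ` is a face not
containing `x`, and a form non-negative on σ + (-ρ) vanishes on `ρ`. -/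
lemma exists_form_of_notMem {ρ σ : Δ.Cone} (h : ρ ≤ σ) {x : V} (hx : x ∈ σ.1) (hx' : x ∉ ρ.1) :
    ∃ l : Module.Dual ℝ (Sp σ), NonnegOn σ l ∧ l ∘ₗ incl h = 0 ∧ 0 < l (pt hx) := by
  classical
  obtain ⟨T, hT⟩ := Δ.polyhedral ρ.1 ρ.2
  have hfg : (σ.1 ⊔ Submodule.span NNReal ((T.image Neg.neg : Finset V) : Set V)).FG :=
    (Δ.polyhedral σ.1 σ.2).sup ⟨_, rfl⟩
  have hneg : ∀ y ∈ Submodule.span NNReal ((T.image Neg.neg : Finset V) : Set V), -y ∈ ρ.1 := by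
    intro y hy
    induction hy using Submodule.span_induction with
    | mem y hy =>
      obtain ⟨t, ht, rfl⟩ := Finset.mem_image.mp hy
      rw [neg_neg, ← hT]
      exact Submodule.subset_span ht
    | zero => simp
    | add y z _ _ hy hz => rw [neg_add]; exact add_mem hy hz
    | smul c y _ hy => rw [← smul_neg]; exact Submodule.smul_mem ρ.1 c hy
  obtain ⟨l, hl, hlx⟩ := exists_separating_form _ hfg (-x) (by
    intro hmem
    obtain ⟨c, hc, t, ht, hct⟩ := Submodule.mem_sup.mp hmem
    refine hx' ((isFaceOf h).mem_of_add_mem_left hx hc ?_)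
    have := hneg t ht
    have e : x + c = -t := by
      rw [eq_comm, neg_eq_iff_eq_neg, neg_add, ← hct]; abel
    rwa [e])
  refine ⟨l ∘ₗ (Sp σ).subtype, fun y hy => hl y (Submodule.mem_sup_left hy), ?_, ?_⟩
  · refine dual_ext fun y hy => ?_
    refine le_antisymm ?_ (hl y (Submodule.mem_sup_left (h hy)))
    have hy' : -y ∈ Submodule.span NNReal ((T.image Neg.neg : Finset V) : Set V) := by
      rw [← hT] at hy
      induction hy using Submodule.span_induction with
      | mem y hy => exact Submodule.subset_span (Finset.mem_image_of_mem _ hy)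
      | zero => simp
      | add y z _ _ hy hz => rw [neg_add]; exact add_mem hy hz
      | smul c y _ hy => rw [← smul_neg]; exact Submodule.smul_mem _ c hy
    have := hl (-y) (Submodule.mem_sup_right hy')
    rw [map_neg] at this
    change l y ≤ 0
    linarith
  · rw [map_neg] at hlx
    change 0 < l x
    linarith

/-- The ratio test of the simplex method: `s` is the minimum of `l / (-g)` over the generators where
`g` is negative. Up to `s` no generator becomes negative, and at `s` one more becomes zero. -/
lemma exists_perturbation {σ : Δ.Cone} {S : Finset V} (hS : ∀ x ∈ S, x ∈ σ.1)
    {l g : Module.Dual ℝ (Sp σ)} (hl : NonnegOn σ l)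
    (hg : ∀ x (hx : x ∈ σ.1), x ∈ S → l (pt hx) = 0 → g (pt hx) = 0)
    (hneg : ∃ x, ∃ hx : x ∈ σ.1, x ∈ S ∧ g (pt hx) < 0) :
    ∃ s : ℝ, 0 < s ∧ (∀ x (hx : x ∈ σ.1), x ∈ S → 0 ≤ (l + s • g) (pt hx)) ∧
      ∃ x, ∃ hx : x ∈ σ.1, x ∈ S ∧ l (pt hx) ≠ 0 ∧ (l + s • g) (pt hx) = 0 := by
  classical
  obtain ⟨y, hy, hyS, hgy⟩ := hneg
  let P : Finset S := Finset.univ.filter fun x => g (pt (hS x.1 x.2)) < 0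
  have hP : P.Nonempty := ⟨⟨y, hyS⟩, by simp only [P, Finset.mem_filter, Finset.mem_univ, true_and]; exact hgy⟩
  obtain ⟨z, hz, hmin⟩ := Finset.exists_min_image P
    (fun x => l (pt (hS x.1 x.2)) / (-g (pt (hS x.1 x.2)))) hP
  have hgz : g (pt (hS z.1 z.2)) < 0 := (Finset.mem_filter.mp hz).2
  have hlz : l (pt (hS z.1 z.2)) ≠ 0 := fun h => hgz.ne (hg _ _ z.2 h)
  have hlz' : 0 < l (pt (hS z.1 z.2)) := lt_of_le_of_ne (hl _ _) hlz.symm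
  refine ⟨l (pt (hS z.1 z.2)) / (-g (pt (hS z.1 z.2))), div_pos hlz' (neg_pos.mpr hgz), ?_, ?_⟩
  · intro x hx hxS
    rw [LinearMap.add_apply, LinearMap.smul_apply, smul_eq_mul]
    by_cases hgx : g (pt hx) < 0
    · have := hmin ⟨x, hxS⟩ (by simp only [P, Finset.mem_filter, Finset.mem_univ, true_and]; exact hgx)
      have h2 := mul_le_mul_of_nonneg_right this (neg_pos.mpr hgx).le
      have h3 : l (pt hx) / (-g (pt hx)) * (-g (pt hx)) = l (pt hx) :=
        div_mul_cancel₀ _ (neg_pos.mpr hgx).ne'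
      change _ ≤ l (pt hx) / (-g (pt hx)) * (-g (pt hx)) at h2
      rw [h3] at h2
      linarith
    · exact add_nonneg (hl x hx) (mul_nonneg (div_pos hlz' (neg_pos.mpr hgz)).le (not_lt.mp hgx))
  · refine ⟨z.1, hS z.1 z.2, z.2, hlz, ?_⟩
    rw [LinearMap.add_apply, LinearMap.smul_apply, smul_eq_mul, div_mul_eq_mul_div, div_neg,
      mul_div_assoc, div_self hgz.ne, mul_one, add_neg_cancel]

/-- A vector on the non-negative side of all facets containing `ρ` is on the non-negative side of
every supporting hyperplane containing `ρ`. -/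
lemma nonneg_of_facets {ρ σ : Δ.Cone} (h : ρ ≤ σ) (q : Sp σ)
    (hq : ∀ (τ : Δ.Cone) (ht : IsFacet τ σ), ρ ≤ τ → 0 ≤ ht.form q)
    (l : Module.Dual ℝ (Sp σ)) (hl : NonnegOn σ l) (hlρ : l ∘ₗ incl h = 0) : 0 ≤ l q := by
  classical
  obtain ⟨S, hS, hSle, hSnn, hSspan⟩ := exists_generators σ
  -- Induction on the number of generators at which `l` does not vanish. Either the zero face of `l`
  -- is a facet and `l` is a positive multiple of its form, or `l` is a positive combination of two
  -- forms with more zeros.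
  let N : Module.Dual ℝ (Sp σ) → Finset S := fun l =>
    Finset.univ.filter fun x => l (pt (hS x.1 x.2)) ≠ 0
  induction hn : (N l).card using Nat.strong_induction_on generalizing l with
  | _ n ih =>
  by_cases hl0 : l = 0
  · simp [hl0]
  let φ := zeroFace σ l hl
  have hφ : φ < σ := by
    refine lt_of_le_of_ne zeroFace_le fun e => hl0 (dual_ext fun x hx => ?_)
    exact (mem_zeroFace (hl := hl) hx).mp (by change x ∈ φ.1; rw [e]; exact hx)
  have hρφ : ρ ≤ φ := fun x hx => (mem_zeroFace (h hx)).mpr (LinearMap.congr_fun hlρ (pt hx))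
  have hlφ : l ∘ₗ incl hφ.le = 0 := dual_ext fun x hx => (mem_zeroFace (hφ.le hx)).mp hx
  have hdim := dim_lt hφ
  by_cases hfac : dim φ + 1 = dim σ
  · have ht : IsFacet φ σ := ⟨hφ.le, hfac⟩
    rw [ht.eq_smul_form l hlφ, LinearMap.smul_apply, smul_eq_mul]
    refine mul_nonneg ?_ (hq φ ht hρφ)
    obtain ⟨x, hx, hx'⟩ := exists_interior σ
    have h1 := hl x hx
    rw [ht.eq_smul_form l hlφ, LinearMap.smul_apply, smul_eq_mul] at h1
    exact nonneg_of_mul_nonneg_left h1 (ht.form_pos hx (hx' φ hφ))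
  · let W := LinearMap.range (incl hφ.le)
    have hW : Module.finrank ℝ W = dim φ :=
      LinearMap.finrank_range_of_inj (Submodule.inclusion_injective _)
    have hex : ∀ U : Submodule ℝ (Sp σ), U ≠ ⊤ → ∃ x, ∃ hx : x ∈ σ.1, x ∈ S ∧ pt hx ∉ U := by
      intro U hU
      by_contra! hcon
      exact hU (hSspan U hcon)
    obtain ⟨x, hx, hxS, hxW⟩ := hex W (by
      intro e
      have : Module.finrank ℝ W = dim σ := by rw [e, finrank_top]
      omega)
    obtain ⟨y, hy, hyS, hyW⟩ := hex (W ⊔ Submodule.span ℝ {pt hx}) (by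
      intro e
      have h1 : Module.finrank ℝ (W ⊔ Submodule.span ℝ {pt hx} : Submodule ℝ (Sp σ)) = dim σ := by
        rw [e, finrank_top]
      have h2 := Submodule.finrank_add_le_finrank_add_finrank W (Submodule.span ℝ {pt hx})
      have h3 := finrank_span_singleton (K := ℝ) (v := pt hx) fun h0 => hxW (h0 ▸ zero_mem _)
      omega)
    -- The zero face has codimension at least two, so `x` and `y` are independent modulo its span
    -- `W`. A form vanishing on `W` and on `x + y` but not at `x` takes opposite signs at `x` and
    -- `y`; hence both `g` and `-g` are negative at some generator and can be used to perturb `l`.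
    obtain ⟨g, hgx, hgW⟩ := Submodule.exists_le_ker_of_notMem (v := pt hx)
      (p := W ⊔ Submodule.span ℝ {pt hx + pt hy}) (by
        intro hmem
        obtain ⟨w, hw, z, hz, hwz⟩ := Submodule.mem_sup.mp hmem
        obtain ⟨c, rfl⟩ := Submodule.mem_span_singleton.mp hz
        by_cases hc : c = 0
        · rw [hc, zero_smul, add_zero] at hwz
          exact hxW (hwz ▸ hw)
        · refine hyW (Submodule.mem_sup.mpr ⟨-(c⁻¹ • w), neg_mem (W.smul_mem _ hw),
            (c⁻¹ - 1) • pt hx, Submodule.mem_span_singleton.mpr ⟨_, rfl⟩, ?_⟩)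
          have : pt hy = c⁻¹ • (c • (pt hx + pt hy)) - pt hx := by
            rw [smul_smul, inv_mul_cancel₀ hc, one_smul]; abel
          rw [this, eq_sub_iff_add_eq'.mpr hwz, smul_sub, sub_smul, one_smul]
          abel)
    have hgφ : ∀ z (hz : z ∈ σ.1), z ∈ S → l (pt hz) = 0 → g (pt hz) = 0 := by
      intro z hz _ hlz
      exact hgW (Submodule.mem_sup_left ⟨pt ((mem_zeroFace (hl := hl) hz).mpr hlz), rfl⟩)
    have hgxy : g (pt hy) = -g (pt hx) := by
      have : g (pt hx + pt hy) = 0 :=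
        hgW (Submodule.mem_sup_right (Submodule.mem_span_singleton_self _))
      rw [map_add] at this
      linarith
    have hgρ : g ∘ₗ incl h = 0 := dual_ext fun z hz =>
      hgW (Submodule.mem_sup_left ⟨pt (hρφ hz), rfl⟩)
    have step : ∀ g' : Module.Dual ℝ (Sp σ), (g' = g ∨ g' = -g) → ∃ s : ℝ, 0 < s ∧
        0 ≤ (l + s • g') q := by
      intro g' hg'
      have hg'φ : ∀ z (hz : z ∈ σ.1), z ∈ S → l (pt hz) = 0 → g' (pt hz) = 0 := by
        intro z hz hzS hlz
        obtain rfl | rfl := hg'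
        · exact hgφ z hz hzS hlz
        · rw [LinearMap.neg_apply, hgφ z hz hzS hlz, neg_zero]
      have hg'ρ : g' ∘ₗ incl h = 0 := by
        obtain rfl | rfl := hg'
        · exact hgρ
        · rw [LinearMap.neg_comp, hgρ, neg_zero]
      have hneg : ∃ x, ∃ hx : x ∈ σ.1, x ∈ S ∧ g' (pt hx) < 0 := by
        rcases lt_or_gt_of_ne hgx with h0 | h0
        · obtain rfl | rfl := hg'
          · exact ⟨x, hx, hxS, h0⟩
          · exact ⟨y, hy, hyS, by rw [LinearMap.neg_apply, hgxy, neg_neg]; exact h0⟩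
        · obtain rfl | rfl := hg'
          · exact ⟨y, hy, hyS, by rw [hgxy]; linarith⟩
          · exact ⟨x, hx, hxS, by rw [LinearMap.neg_apply]; linarith⟩
      obtain ⟨s, hs, hnn, z, hz, hzS, hlz, hz0⟩ := exists_perturbation hS hl hg'φ hneg
      refine ⟨s, hs, ih _ ?_ (l + s • g') (hSnn _ hnn) ?_ rfl⟩
      · rw [← hn]
        refine Finset.card_lt_card ⟨fun w hw => ?_, fun hsub => ?_⟩
        · simp only [N, Finset.mem_filter, Finset.mem_univ, true_and] at hw ⊢
          intro hlw
          apply hw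
          rw [LinearMap.add_apply, LinearMap.smul_apply, hlw, hg'φ _ _ w.2 hlw, smul_zero, add_zero]
        · have := hsub (show (⟨z, hzS⟩ : S) ∈ N l by
            simp only [N, Finset.mem_filter, Finset.mem_univ, true_and]; exact hlz)
          simp only [N, Finset.mem_filter, Finset.mem_univ, true_and] at this
          exact this hz0
      · rw [LinearMap.add_comp, LinearMap.smul_comp, hlρ, hg'ρ, smul_zero, add_zero]
    obtain ⟨s, hs, h1⟩ := step g (Or.inl rfl)
    obtain ⟨t, ht, h2⟩ := step (-g) (Or.inr rfl)
    simp only [LinearMap.add_apply, LinearMap.smul_apply, smul_eq_mul, LinearMap.neg_apply] at h1 h2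
    have h3 : 0 ≤ t * (l q + s * g q) + s * (l q + t * -g q) :=
      add_nonneg (mul_nonneg ht.le h1) (mul_nonneg hs.le h2)
    have h4 : t * (l q + s * g q) + s * (l q + t * -g q) = (s + t) * l q := by ring
    rw [h4] at h3
    exact nonneg_of_mul_nonneg_right h3 (add_pos hs ht)

/-- Every face is the intersection of the facets containing it. -/
lemma exists_facet_notMem {ρ σ : Δ.Cone} (h : ρ ≤ σ) {x : V} (hx : x ∈ σ.1) (hx' : x ∉ ρ.1) :
    ∃ τ : Δ.Cone, IsFacet τ σ ∧ ρ ≤ τ ∧ x ∉ τ.1 := by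
  obtain ⟨l, hl, hlρ, hlx⟩ := exists_form_of_notMem h hx hx'
  by_contra! hcon
  -- If `x` lay in every facet containing `ρ`, all those forms would vanish at `-x`, so `l (-x)`
  -- would be non-negative.
  have := nonneg_of_facets h (-pt hx) (fun τ ht hρτ => by
    rw [map_neg, (ht.form_eq_zero_iff hx).mpr (hcon τ ht hρτ), neg_zero]) l hl hlρ
  rw [map_neg] at this
  linarith

lemma exists_facet {ρ σ : Δ.Cone} (h : ρ < σ) : ∃ τ : Δ.Cone, IsFacet τ σ ∧ ρ ≤ τ := by
  obtain ⟨x, hx, hx'⟩ := exists_interior σ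
  obtain ⟨τ, ht, hρ, -⟩ := exists_facet_notMem h.le hx (hx' ρ h)
  exact ⟨τ, ht, hρ⟩

/-- The intersection of the two distinct facets is a proper face of `τ` containing its facet `ρ`, so
it is `ρ`. -/
lemma inter_eq_of_ridge {ρ τ τ' σ : Δ.Cone} (hr : IsFacet ρ τ) (ht : IsFacet τ σ)
    (ht' : IsFacet τ' σ) (hne : τ ≠ τ') (h : ρ ≤ τ') {x : V} (hx : x ∈ τ.1) (hx' : x ∈ τ'.1) :
    x ∈ ρ.1 := by
  have hi : inter τ τ' = ρ := by
    refine hr.eq_of_le (fun y hy => ⟨hr.1 hy, h hy⟩) (lt_of_le_of_ne (fun y hy => hy.1) fun e => hne ?_)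
    refine (ht.eq_of_le (fun y hy => ?_) ht'.lt).symm
    rw [← e] at hy
    exact hy.2
  rw [← hi]
  exact ⟨hx, hx'⟩

/-- The restriction of the form of a facet to an adjacent facet is a positive multiple of the form
of the common ridge. -/
lemma exists_form_restrict {ρ τ τ' σ : Δ.Cone} (hr : IsFacet ρ τ) (ht : IsFacet τ σ)
    (ht' : IsFacet τ' σ) (hne : τ ≠ τ') (h : ρ ≤ τ') :
    ∃ c : ℝ, 0 < c ∧ ht'.form ∘ₗ incl ht.1 = c • hr.form := by
  have h0 := hr.eq_smul_form (ht'.form ∘ₗ incl ht.1) (dual_ext fun x hx =>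
    (ht'.form_eq_zero_iff (ht.1 (hr.1 hx))).mpr (h hx))
  refine ⟨_, ?_, h0⟩
  obtain ⟨x, hx, hx'⟩ := exists_interior τ
  have hxρ := hx' ρ hr.lt
  have h1 : 0 < ht'.form (incl ht.1 (pt hx)) :=
    ht'.form_pos (ht.1 hx) fun hc => hxρ (inter_eq_of_ridge hr ht ht' hne h hx hc)
  have h2 := LinearMap.congr_fun h0 (pt hx)
  rw [LinearMap.comp_apply, LinearMap.smul_apply, smul_eq_mul] at h2
  rw [h2] at h1
  exact pos_of_mul_pos_left h1 (hr.form_pos hx hxρ).le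

/-- The ridge is the intersection of the facets containing it, so one of these misses an interior
point of `τ`; by dimension `ρ` is a facet of that one too. -/
lemma exists_other_facet {ρ τ σ : Δ.Cone} (hr : IsFacet ρ τ) (ht : IsFacet τ σ) :
    ∃ τ' : Δ.Cone, IsFacet τ' σ ∧ IsFacet ρ τ' ∧ τ ≠ τ' := by
  obtain ⟨x, hx, hx'⟩ := exists_interior τ
  obtain ⟨τ', ht', hρ, hnot⟩ := exists_facet_notMem (hr.1.trans ht.1) (ht.1 hx) (hx' ρ hr.lt)
  refine ⟨τ', ht', ⟨hρ, ?_⟩, ?_⟩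
  · have h1 := ht.2
    have h2 := ht'.2
    have h3 := hr.2
    omega
  · rintro rfl
    exact hnot hx

/-- A face of codimension two lies in at most two facets. -/
lemma eq_or_eq_of_ridge {ρ τ₁ τ₂ τ₃ σ : Δ.Cone} (h₁ : IsFacet τ₁ σ) (h₂ : IsFacet τ₂ σ)
    (h₃ : IsFacet τ₃ σ) (hr₁ : IsFacet ρ τ₁) (hr₂ : IsFacet ρ τ₂) (hr₃ : IsFacet ρ τ₃)
    (h₁₂ : τ₁ ≠ τ₂) : τ₃ = τ₁ ∨ τ₃ = τ₂ := by
  by_contra! hne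
  obtain ⟨h₃₁, h₃₂⟩ := hne
  obtain ⟨c, hc, hc'⟩ := exists_form_restrict hr₁ h₁ h₂ h₁₂ hr₂.1
  obtain ⟨d, hd, hd'⟩ := exists_form_restrict hr₁ h₁ h₃ h₃₁.symm hr₃.1
  -- The form c h₃ - d h₂ vanishes on `τ₁`, hence is k h₁. An interior point of `τ₂` shows k > 0, an
  -- interior point of `τ₃` shows k < 0.
  have hk := h₁.eq_smul_form (c • h₃.form - d • h₂.form) (by
    rw [LinearMap.sub_comp, LinearMap.smul_comp, LinearMap.smul_comp, hc', hd', smul_comm, sub_self])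
  set k := (c • h₃.form - d • h₂.form) h₁.vector
  have hval : ∀ y (hy : y ∈ σ.1), c * h₃.form (pt hy) - d * h₂.form (pt hy) = k * h₁.form (pt hy) := by
    intro y hy
    have := LinearMap.congr_fun hk (pt hy)
    simpa only [LinearMap.sub_apply, LinearMap.smul_apply, smul_eq_mul] using this
  obtain ⟨x, hx, hx'⟩ := exists_interior τ₂
  have hxρ := hx' ρ hr₂.lt
  have e1 := hval x (h₂.1 hx)
  rw [(h₂.form_eq_zero_iff (h₂.1 hx)).mpr hx, mul_zero, sub_zero] at e1
  have p1 := h₃.form_pos (h₂.1 hx) fun h => hxρ (inter_eq_of_ridge hr₂ h₂ h₃ h₃₂.symm hr₃.1 hx h)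
  have p2 := h₁.form_pos (h₂.1 hx) fun h => hxρ (inter_eq_of_ridge hr₂ h₂ h₁ h₁₂.symm hr₁.1 hx h)
  have hkpos : 0 < k := pos_of_mul_pos_left (e1 ▸ mul_pos hc p1) p2.le
  obtain ⟨y, hy, hy'⟩ := exists_interior τ₃
  have hyρ := hy' ρ hr₃.lt
  have e2 := hval y (h₃.1 hy)
  rw [(h₃.form_eq_zero_iff (h₃.1 hy)).mpr hy, mul_zero, zero_sub] at e2
  have p3 := h₂.form_pos (h₃.1 hy) fun h => hyρ (inter_eq_of_ridge hr₃ h₃ h₂ h₃₂ hr₂.1 hy h)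
  have p4 := h₁.form_pos (h₃.1 hy) fun h => hyρ (inter_eq_of_ridge hr₃ h₃ h₁ h₃₁ hr₁.1 hy h)
  have := mul_pos hkpos p4
  have := mul_pos hd p3
  linarith

/-- A vector in the kernel of the form of a facet, as a vector in the span of the facet. -/
lemma IsFacet.exists_incl_eq {τ σ : Δ.Cone} (ht : IsFacet τ σ) {q : Sp σ} (hq : ht.form q = 0) :
    ∃ q' : Sp τ, incl ht.1 q' = q := by
  have : q ∈ LinearMap.ker ht.form := hq
  rwa [ht.ker_form] at this

/-- The facets of `σ` that contain `ρ` are connected through ridges containing `ρ`. -/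
lemma facets_connected {ρ σ : Δ.Cone} (P : Δ.Cone → Prop)
    (hP : ∀ τ τ' κ : Δ.Cone, IsFacet τ σ → IsFacet τ' σ → IsFacet κ τ → IsFacet κ τ' → ρ ≤ κ →
      τ ≠ τ' → P τ' → P τ)
    {τ₀ : Δ.Cone} (h₀ : IsFacet τ₀ σ) (hρ₀ : ρ ≤ τ₀) (hP₀ : P τ₀)
    {τ : Δ.Cone} (ht : IsFacet τ σ) (hρ : ρ ≤ τ) : P τ := by
  classical
  obtain ⟨x, hx, hx'⟩ := exists_interior τ₀
  obtain ⟨v, hv, hv'⟩ := exists_interior σ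
  have hpos : ∀ {δ} (hδ : IsFacet δ σ), 0 < hδ.form (pt hv) := fun hδ =>
    hδ.form_pos hv (hv' _ hδ.lt)
  -- The line x - t v, with `v` interior to `σ`, crosses the hyperplane of the facet `δ` at t = μ δ.
  -- The induction walks to facets with smaller μ. The default value 0 is harmless: only strict
  -- decrease of the count under strict decrease of μ is used.
  let μ : Δ.Cone → ℝ := fun δ =>
    if hδ : IsFacet δ σ then hδ.form (pt (h₀.1 hx)) / hδ.form (pt hv) else 0
  have hμ : ∀ {δ} (hδ : IsFacet δ σ), μ δ = hδ.form (pt (h₀.1 hx)) / hδ.form (pt hv) :=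
    fun hδ => dif_pos hδ
  have : Fintype Δ.Cone := Fintype.ofFinite _
  induction hn : (Finset.univ.filter fun δ => μ δ < μ τ).card using Nat.strong_induction_on
    generalizing τ with
  | _ n ih =>
  by_cases hτ : τ = τ₀
  · rwa [hτ]
  have hxτ : x ∉ τ.1 := by
    intro hxτ
    have hle : τ₀ ≤ inter τ₀ τ := by
      by_contra hnle
      exact hx' (inter τ₀ τ) (lt_of_le_of_ne (fun y hy => hy.1) fun e => hnle e.ge) ⟨hx, hxτ⟩
    exact hτ (h₀.eq_of_le (fun y hy => (hle hy).2) ht.lt)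
  have hμpos : 0 < μ τ := by
    rw [hμ ht]
    exact div_pos (ht.form_pos _ hxτ) (hpos ht)
  -- The crossing point lies in the span of `τ`, and the form of `τ₀` is negative there. So the form
  -- of some facet `δ` of `τ` containing `ρ` is negative there as well, and the facet on the other
  -- side of `δ` was crossed at a smaller parameter.
  have hq0 : ht.form (pt (h₀.1 hx) - μ τ • pt hv) = 0 := by
    rw [map_sub, map_smul, hμ ht, smul_eq_mul, div_mul_cancel₀ _ (hpos ht).ne', sub_self]
  obtain ⟨q, hq⟩ := ht.exists_incl_eq hq0
  have hl : ¬ 0 ≤ (h₀.form ∘ₗ incl ht.1) q := by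
    rw [LinearMap.comp_apply, hq, map_sub, (h₀.form_eq_zero_iff (h₀.1 hx)).mpr hx, map_smul,
      smul_eq_mul, zero_sub, not_le]
    exact neg_neg_of_pos (mul_pos hμpos (hpos h₀))
  have hex : ∃ δ, ∃ hδ : IsFacet δ τ, ρ ≤ δ ∧ hδ.form q < 0 := by
    by_contra! hcon
    refine hl (nonneg_of_facets hρ q hcon _ (fun y hy => h₀.form_nonneg y (ht.1 hy)) ?_)
    exact dual_ext fun y hy => (h₀.form_eq_zero_iff (ht.1 (hρ hy))).mpr (hρ₀ hy)
  obtain ⟨δ, hδ, hρδ, hδq⟩ := hex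
  obtain ⟨τ₁, ht₁, hδ₁, hne⟩ := exists_other_facet hδ ht
  obtain ⟨c, hc, hc'⟩ := exists_form_restrict hδ ht ht₁ hne hδ₁.1
  have hlt : μ τ₁ < μ τ := by
    have h1 := LinearMap.congr_fun hc' q
    rw [LinearMap.comp_apply, hq, LinearMap.smul_apply, smul_eq_mul, map_sub, map_smul,
      smul_eq_mul] at h1
    have h2 : c * hδ.form q < 0 := mul_neg_of_pos_of_neg hc hδq
    rw [hμ ht₁, div_lt_iff₀ (hpos ht₁)]
    linarith
  refine hP τ τ₁ δ ht ht₁ hδ hδ₁ hρδ hne (ih _ ?_ ht₁ (hρδ.trans hδ₁.1) rfl)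
  rw [← hn]
  refine Finset.card_lt_card ⟨fun w hw => ?_, fun hsub => ?_⟩
  · simp only [Finset.mem_filter, Finset.mem_univ, true_and] at hw ⊢
    exact hw.trans hlt
  · have := hsub (show τ₁ ∈ _ by simpa using hlt)
    simp at this

/-- For a vector `q` off all facet hyperplanes there is an interior point `v` such that the
quotients `h_τ(q) / h_τ(v)` are pairwise distinct. -/
lemma exists_generic_interior (σ : Δ.Cone) (q : Sp σ)
    (hq : ∀ (τ : Δ.Cone) (ht : IsFacet τ σ), ht.form q ≠ 0) :
    ∃ v : Sp σ, (∀ (τ : Δ.Cone) (ht : IsFacet τ σ), 0 < ht.form v) ∧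
      ∀ (τ τ' : Δ.Cone) (ht : IsFacet τ σ) (ht' : IsFacet τ' σ), τ ≠ τ' →
        ht.form q / ht.form v ≠ ht'.form q / ht'.form v := by
  classical
  obtain ⟨v₀, hv₀, hv₀'⟩ := exists_interior σ
  have hpos : ∀ {δ} (hδ : IsFacet δ σ), 0 < hδ.form (pt hv₀) := fun hδ =>
    hδ.form_pos hv₀ (hv₀' _ hδ.lt)
  let I := {p : {τ : Δ.Cone // IsFacet τ σ} × {τ : Δ.Cone // IsFacet τ σ} // p.1.1 ≠ p.2.1}
  -- At a point where the facet forms are positive, `g p` vanishes exactly if the two quotients of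
  -- the pair `p` coincide. It is not the zero form, as a point of one facet outside the other
  -- shows.
  let g : I → Module.Dual ℝ (Sp σ) := fun p =>
    p.1.1.2.form q • p.1.2.2.form - p.1.2.2.form q • p.1.1.2.form
  have hg : ∀ p, g p ≠ 0 := by
    intro p h0
    have hx : ∃ x ∈ p.1.1.1.1, x ∉ p.1.2.1.1 := by
      by_contra! hcon
      exact p.2 (p.1.1.2.eq_of_le hcon p.1.2.2.lt).symm
    obtain ⟨x, hx, hx'⟩ := hx
    have h1 := LinearMap.congr_fun h0 (pt (p.1.1.2.1 hx))
    simp only [g, LinearMap.sub_apply, LinearMap.smul_apply, smul_eq_mul, LinearMap.zero_apply] at h1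
    rw [(p.1.1.2.form_eq_zero_iff _).mpr hx, mul_zero, sub_zero] at h1
    exact (mul_ne_zero (hq _ p.1.1.2) (p.1.2.2.form_pos (p.1.1.2.1 hx) hx').ne') h1
  obtain ⟨w, hw⟩ := Module.Dual.exists_forall_ne_zero_of_forall_exists g fun p => by
    by_contra! hcon
    exact hg p (LinearMap.ext hcon)
  -- Adding a large multiple of an interior point to `w` makes the facet forms positive, while each
  -- `g p`, affine and not identically zero along this ray, is eventually nonzero.
  have hev : ∀ᶠ n : ℕ in Filter.atTop, (∀ τ : {τ : Δ.Cone // IsFacet τ σ},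
      0 < τ.2.form (w + (n : ℝ) • pt hv₀)) ∧ ∀ p, g p (w + (n : ℝ) • pt hv₀) ≠ 0 := by
    refine Filter.Eventually.and (Filter.eventually_all.mpr fun τ => ?_)
      (Filter.eventually_all.mpr fun p => ?_)
    · obtain ⟨N, hN⟩ := exists_nat_gt (-τ.2.form w / τ.2.form (pt hv₀))
      filter_upwards [Filter.eventually_ge_atTop N] with n hn
      rw [map_add, map_smul, smul_eq_mul]
      have h1 : -τ.2.form w / τ.2.form (pt hv₀) < n := hN.trans_le (by exact_mod_cast hn)
      rw [div_lt_iff₀ (hpos τ.2)] at h1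
      linarith
    · by_cases h0 : g p (pt hv₀) = 0
      · refine Filter.Eventually.of_forall fun n => ?_
        rw [map_add, map_smul, h0, smul_zero, add_zero]
        exact hw p
      · obtain ⟨N, hN⟩ := exists_nat_gt (-g p w / g p (pt hv₀))
        filter_upwards [Filter.eventually_ge_atTop N] with n hn
        rw [map_add, map_smul, smul_eq_mul]
        have h1 : -g p w / g p (pt hv₀) < n := hN.trans_le (by exact_mod_cast hn)
        intro h2
        apply h1.ne
        rw [div_eq_iff h0]
        linarith
  obtain ⟨n, h1, h2⟩ := hev.exists
  refine ⟨w + (n : ℝ) • pt hv₀, fun τ ht => h1 ⟨τ, ht⟩, fun τ τ' ht ht' hne heq => ?_⟩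
  have h3 := h2 ⟨(⟨τ, ht⟩, ⟨τ', ht'⟩), hne⟩
  rw [div_eq_div_iff (h1 ⟨τ, ht⟩).ne' (h1 ⟨τ', ht'⟩).ne'] at heq
  apply h3
  simp only [g, LinearMap.sub_apply, LinearMap.smul_apply, smul_eq_mul]
  linarith

end Fan
end

noncomputable section
open Fan

/-! ### Projective modules and hypersurfaces -/

section Projective

variable {R R' : Type*} [CommRing R] [CommRing R'] {f : R →+* R'}
  {Y : Type*} [AddCommGroup Y] [Module R' Y] {X : Type*} [AddCommGroup X] [Module R X]

/-- A semilinear form on a projective module lifts along a surjection of rings. -/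
lemma exists_lift_of_projective {P : Type*} [AddCommGroup P] [Module R P] [Module.Projective R P]
    (hf : Function.Surjective f) (u : P → R') (hadd : ∀ x y, u (x + y) = u x + u y)
    (hsmul : ∀ (a : R) x, u (a • x) = f a * u x) :
    ∃ v : P →ₗ[R] R, ∀ x, f (v x) = u x := by
  let := f.toAlgebra
  let u' : P →ₗ[R] R' :=
    { toFun := u
      map_add' := hadd
      map_smul' := fun a x => by rw [hsmul, RingHom.id_apply, Algebra.smul_def]; rfl }
  obtain ⟨v, hv⟩ := Module.projective_lifting_property (Algebra.linearMap R R') u' hf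
  exact ⟨v, fun x => LinearMap.congr_fun hv x⟩

/-- Division of a linear form by a ring element. -/
lemma exists_div_form [IsDomain R] {h : R} (hh : h ≠ 0) (u : X →ₗ[R] R) (hu : ∀ x, h ∣ u x) :
    ∃ v : X →ₗ[R] R, ∀ x, u x = h * v x := by
  choose v hv using hu
  refine ⟨{ toFun := v, map_add' := fun x y => ?_, map_smul' := fun a x => ?_ }, hv⟩
  · apply mul_left_cancel₀ hh
    rw [mul_add, ← hv, ← hv, ← hv, map_add]
  · apply mul_left_cancel₀ hh
    rw [← hv, map_smul, hv, RingHom.id_apply, smul_eq_mul, smul_eq_mul]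
    ring

/-- The kernel of a semilinear map from a projective module over `R` onto a finitely generated
projective module over `R / h` is projective. -/
lemma projective_of_ker [IsDomain R] (hf : Function.Surjective f) {h : R} (hh : h ≠ 0)
    (hker : ∀ a, f a = 0 → h ∣ a) (hh0 : f h = 0) (π : X → Y) (hadd : ∀ x y, π (x + y) = π x + π y)
    (hsmul : ∀ (a : R) x, π (a • x) = f a • π x)
    {P K : Submodule R X} {Q : Submodule R' Y} (hP : Module.Projective R P)
    (hQ : Module.Projective R' Q) (hQf : Module.Finite R' Q) (hmap : ∀ x ∈ P, π x ∈ Q)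
    (hsurj : ∀ y ∈ Q, ∃ x ∈ P, π x = y) (hK : ∀ x, x ∈ K ↔ x ∈ P ∧ π x = 0) :
    Module.Projective R K := by
  -- `Q` is a retract of a free module over `R'`. Lifting its coordinates to forms `u j` on `P` and
  -- its generators to `p j` in `P` gives the endomorphism e = Σ u_j p_j of `P` with π ∘ e = π.
  obtain ⟨n, g, s, -, -, hgs⟩ := Module.Finite.exists_comp_eq_id_of_projective R' Q
  have hzero : π 0 = 0 := by simpa using hadd 0 0
  have hsum : ∀ (c : Fin n → X), π (∑ j, c j) = ∑ j, π (c j) := fun c =>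
    map_sum (AddMonoidHom.mk' π hadd) c Finset.univ
  have hbasis : ∀ j : Fin n, ∃ x : P, π x = (g (Pi.single j 1) : Q) := fun j => by
    obtain ⟨x, hx, hxy⟩ := hsurj _ (g (Pi.single j 1)).2
    exact ⟨⟨x, hx⟩, hxy⟩
  choose p hp using hbasis
  have hlift : ∀ j : Fin n, ∃ u : P →ₗ[R] R, ∀ x : P, f (u x) = s ⟨π x, hmap x x.2⟩ j := by
    intro j
    refine exists_lift_of_projective hf (fun x : P => s ⟨π x, hmap x x.2⟩ j) ?_ ?_
    · intro x y
      have : (⟨π (x + y : P), hmap _ (x + y).2⟩ : Q) =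
          ⟨π x, hmap x x.2⟩ + ⟨π y, hmap y y.2⟩ := Subtype.ext (hadd x y)
      rw [this, map_add, Pi.add_apply]
    · intro a x
      have : (⟨π (a • x : P), hmap _ (a • x).2⟩ : Q) = f a • ⟨π x, hmap x x.2⟩ :=
        Subtype.ext (hsmul a x)
      rw [this, map_smul, Pi.smul_apply, smul_eq_mul]
  choose u hu using hlift
  have hKP : K ≤ P := fun x hx => ((hK x).mp hx).1
  have hdvd : ∀ j, ∃ w : K →ₗ[R] R, ∀ k : K, u j (Submodule.inclusion hKP k) = h * w k := by
    intro j
    refine exists_div_form hh (u j ∘ₗ Submodule.inclusion hKP) fun k => hker _ ?_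
    have h0 : (⟨π (Submodule.inclusion hKP k), hmap _ (Submodule.inclusion hKP k).2⟩ : Q) = 0 :=
      Subtype.ext ((hK k).mp k.2).2
    rw [LinearMap.comp_apply, hu, h0, map_zero, Pi.zero_apply]
  choose w hw using hdvd
  let e : P →ₗ[R] P := ∑ j, (u j).smulRight (p j)
  have he : ∀ x : P, π (e x) = π x := by
    intro x
    have h1 : ((e x : P) : X) = ∑ j, u j x • (p j : X) := by
      simp [e, LinearMap.sum_apply]
    rw [h1, hsum]
    simp only [hsmul, hp, hu]
    have h2 := LinearMap.congr_fun hgs ⟨π x, hmap x x.2⟩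
    rw [LinearMap.comp_apply, LinearMap.id_apply, LinearMap.pi_apply_eq_sum_univ g] at h2
    have h3 := congrArg Subtype.val h2
    have h4 : ∀ j : Fin n, (fun k => if j = k then (1 : R') else 0) = Pi.single j 1 := fun j => by
      funext k
      simp only [Pi.single_apply, eq_comm]
    simpa [h4] using h3
  -- On `K` the `u j` are divisible, u_j = h w_j, so e k = h Σ w_j(k) p_j. Hence k ↦ (k, Σ w_j(k)
  -- p_j) is split by (x, y) ↦ x - e x + h y, which takes values in `K`.
  let i : K →ₗ[R] P × P :=
    (Submodule.inclusion hKP).prod (∑ j, (w j).smulRight (p j))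
  let r₀ : P × P →ₗ[R] P := (LinearMap.id - e) ∘ₗ LinearMap.fst R P P + h • LinearMap.snd R P P
  let r : P × P →ₗ[R] K := (P.subtype ∘ₗ r₀).codRestrict K fun x => (hK _).mpr ⟨(r₀ x).2, by
    change π ((x.1 - e x.1 + h • x.2 : P) : X) = 0
    have h1 : (x.1 : X) = (x.1 - e x.1 : P) + (e x.1 : P) := by simp
    have h2 : π (x.1 - e x.1 : P) = 0 := by
      have := hadd (x.1 - e x.1 : P) (e x.1 : P)
      rw [← h1, he] at this
      simpa using this
    have h3 : ((x.1 - e x.1 + h • x.2 : P) : X) = (x.1 - e x.1 : P) + h • (x.2 : X) := by simp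
    rw [h3, hadd, h2, hsmul, hh0, zero_smul, add_zero]⟩
  refine Module.Projective.of_split i r (LinearMap.ext fun k => Subtype.ext ?_)
  change ((Submodule.inclusion hKP k - e (Submodule.inclusion hKP k) +
    h • (∑ j, (w j).smulRight (p j)) k : P) : X) = k
  have h1 : e (Submodule.inclusion hKP k) = h • (∑ j, (w j).smulRight (p j)) k := by
    simp only [e, LinearMap.sum_apply, LinearMap.smulRight_apply, Finset.smul_sum, hw, smul_smul]
  rw [h1, sub_add_cancel]
  rfl

end Projective

/-! ### Line shellings of the boundary of a cone -/

namespace Fan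

variable {V : Type u} [AddCommGroup V] [Module ℝ V] {Δ : Fan V} [FiniteDimensional ℝ V]

/-- A proper face of `σ` other than the facet `ρ` lies in a facet other than `ρ`. -/
lemma exists_facet_ne {δ ρ σ : Δ.Cone} (hδ : δ < σ) (hr : IsFacet ρ σ) (hne : δ ≠ ρ) :
    ∃ τ : Δ.Cone, IsFacet τ σ ∧ δ ≤ τ ∧ τ ≠ ρ := by
  by_cases h : δ ≤ ρ
  · obtain ⟨x, hx, hx'⟩ := exists_interior ρ
    obtain ⟨τ, ht, hδτ, hxτ⟩ := exists_facet_notMem hδ.le (hr.1 hx) (hx' δ (lt_of_le_of_ne h hne))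
    exact ⟨τ, ht, hδτ, fun e => hxτ (e ▸ hx)⟩
  · obtain ⟨τ, ht, hδτ⟩ := exists_facet hδ
    exact ⟨τ, ht, hδτ, fun e => h (e ▸ hδτ)⟩

/-- The facets of `σ` visible from `q`. -/
def visible (σ : Δ.Cone) (q : Sp σ) : Set Δ.Cone := {τ | ∃ ht : IsFacet τ σ, ht.form q < 0}

/-- The facets of `σ` that precede the parameter `c` in the line shelling given by `q` and `v`. -/
def shellBelow (σ : Δ.Cone) (q v : Sp σ) (c : ℝ) : Set Δ.Cone :=
  {τ | ∃ ht : IsFacet τ σ, ht.form q / ht.form v < c}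

/-- The vectors `q` and `v` define a line shelling of the boundary of `σ`. -/
structure IsShelling (σ : Δ.Cone) (q v : Sp σ) : Prop where
  pos : ∀ (τ : Δ.Cone) (ht : IsFacet τ σ), 0 < ht.form v
  ne : ∀ (τ τ' : Δ.Cone) (ht : IsFacet τ σ) (ht' : IsFacet τ' σ), τ ≠ τ' →
    ht.form q / ht.form v ≠ ht'.form q / ht'.form v

lemma exists_isShelling (σ : Δ.Cone) (q : Sp σ)
    (hq : ∀ (τ : Δ.Cone) (ht : IsFacet τ σ), ht.form q ≠ 0) : ∃ v : Sp σ, IsShelling σ q v := by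
  obtain ⟨v, h1, h2⟩ := exists_generic_interior σ q hq
  exact ⟨v, h1, h2⟩

lemma IsShelling.shellBelow_zero {σ : Δ.Cone} {q v : Sp σ} (hs : IsShelling σ q v) :
    shellBelow σ q v 0 = visible σ q := by
  ext τ
  refine exists_congr fun ht => ?_
  rw [div_lt_iff₀ (hs.pos τ ht), zero_mul]

/-- The point at which the shelling line meets the hyperplane of a facet. -/
lemma IsShelling.exists_point {σ : Δ.Cone} {q v : Sp σ} (hs : IsShelling σ q v) {τ : Δ.Cone}
    (ht : IsFacet τ σ) : ∃ p : Sp τ,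
      (∀ (τ' : Δ.Cone) (ht' : IsFacet τ' σ), (ht'.form (incl ht.1 p) < 0 ↔
        ht'.form q / ht'.form v < ht.form q / ht.form v)) ∧
      (∀ (ρ τ' : Δ.Cone) (hr : IsFacet ρ τ) (ht' : IsFacet τ' σ), ρ ≤ τ' → τ ≠ τ' →
        (hr.form p < 0 ↔ ht'.form q / ht'.form v < ht.form q / ht.form v)) ∧
      ∀ (ρ : Δ.Cone) (hr : IsFacet ρ τ), hr.form p ≠ 0 := by
  -- The point is q - k v. The form of any facet there has the sign of its own parameter minus `k`.
  -- On a ridge of `τ` the sign is that of the adjacent facet, and it is nonzero because the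
  -- parameters are distinct.
  set k := ht.form q / ht.form v
  obtain ⟨p, hp⟩ := ht.exists_incl_eq (q := q - k • v) (by
    rw [map_sub, map_smul, smul_eq_mul, div_mul_cancel₀ _ (hs.pos τ ht).ne', sub_self])
  have hval : ∀ (τ' : Δ.Cone) (ht' : IsFacet τ' σ),
      ht'.form (incl ht.1 p) = ht'.form v * (ht'.form q / ht'.form v - k) := by
    intro τ' ht'
    rw [hp, map_sub, map_smul, smul_eq_mul, mul_sub, mul_div_cancel₀ _ (hs.pos τ' ht').ne']
    ring
  have hsign : ∀ (τ' : Δ.Cone) (ht' : IsFacet τ' σ), (ht'.form (incl ht.1 p) < 0 ↔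
        ht'.form q / ht'.form v < k) := by
    intro τ' ht'
    rw [hval, mul_neg_iff]
    have := hs.pos τ' ht'
    constructor
    · rintro (⟨_, h⟩ | ⟨h, _⟩) <;> linarith
    · intro h; exact Or.inl ⟨this, by linarith⟩
  have hrel : ∀ (ρ τ' : Δ.Cone) (hr : IsFacet ρ τ) (ht' : IsFacet τ' σ), ρ ≤ τ' → τ ≠ τ' →
      ∃ c : ℝ, 0 < c ∧ ht'.form (incl ht.1 p) = c * hr.form p := by
    intro ρ τ' hr ht' hρ hne
    obtain ⟨c, hc, hc'⟩ := exists_form_restrict hr ht ht' hne hρ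
    exact ⟨c, hc, LinearMap.congr_fun hc' p⟩
  refine ⟨p, hsign, ?_, ?_⟩
  · intro ρ τ' hr ht' hρ hne
    obtain ⟨c, hc, hc'⟩ := hrel ρ τ' hr ht' hρ hne
    rw [← hsign, hc']
    constructor
    · exact fun h => mul_neg_of_pos_of_neg hc h
    · intro h
      by_contra! h0
      linarith [mul_nonneg hc.le h0]
  · intro ρ hr h0
    obtain ⟨τ', ht', hr', hne⟩ := exists_other_facet hr ht
    obtain ⟨c, hc, hc'⟩ := hrel ρ τ' hr ht' hr'.1 hne
    rw [h0, mul_zero, hval, mul_eq_zero, sub_eq_zero] at hc'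
    rcases hc' with h | h
    · exact (hs.pos τ' ht').ne' h
    · exact hs.ne τ τ' ht ht' hne h.symm

/-- An induction principle along a line shelling. -/
lemma IsShelling.induction {σ : Δ.Cone} {q v : Sp σ} (hs : IsShelling σ q v) {P : ℝ → Prop}
    (empty : ∀ c, shellBelow σ q v c = ∅ → P c)
    (step : ∀ (c : ℝ) (τ : Δ.Cone) (ht : IsFacet τ σ), ht.form q / ht.form v < c →
      (∀ (τ' : Δ.Cone) (ht' : IsFacet τ' σ), ht'.form q / ht'.form v < c → τ' ≠ τ →
        ht'.form q / ht'.form v < ht.form q / ht.form v) →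
      P (ht.form q / ht.form v) → P c) (c : ℝ) : P c := by
  classical
  induction hn : (shellBelow σ q v c).ncard using Nat.strong_induction_on generalizing c with
  | _ n ih =>
  by_cases hc : shellBelow σ q v c = ∅
  · exact empty c hc
  let κ : {τ : Δ.Cone // IsFacet τ σ} → ℝ := fun τ => τ.2.form q / τ.2.form v
  obtain ⟨τ₀, ht₀, h₀⟩ := Set.nonempty_iff_ne_empty.mpr hc
  obtain ⟨τ, hτ, hmax⟩ := Set.exists_max_image {τ | κ τ < c} κ (Set.toFinite _) ⟨⟨τ₀, ht₀⟩, h₀⟩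
  refine step c τ.1 τ.2 hτ (fun τ' ht' h' hne => ?_) (ih _ ?_ _ rfl)
  · exact lt_of_le_of_ne (hmax ⟨τ', ht'⟩ h') (hs.ne τ' τ.1 ht' τ.2 hne)
  · rw [← hn]
    refine Set.ncard_lt_ncard ⟨?_, fun hsub => ?_⟩ (Set.toFinite _)
    · rintro τ' ⟨ht', h'⟩
      exact ⟨ht', h'.trans hτ⟩
    · obtain ⟨ht', h'⟩ := hsub (show τ.1 ∈ shellBelow σ q v c from ⟨τ.2, hτ⟩)
      exact lt_irrefl _ h'

end Fan

/-! ### Sections vanishing on the beginning of a shelling -/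

namespace ConeSystem

variable {V : Type u} [AddCommGroup V] [Module ℝ V] {Δ : Fan V} {F : ConeSystem Δ}

/-- The sections over `⟨γ⟩` that vanish on the faces of `γ` in `T`. -/
def RelTo (F : ConeSystem Δ) (γ : Δ.Cone) (T : Set Δ.Cone) : Submodule (A γ) (F.stalk γ) where
  carrier := {x | ∀ (τ : Δ.Cone) (h : τ ≤ γ), τ ∈ T → F.res h x = 0}
  add_mem' hx hy τ h hT := by rw [map_add, hx τ h hT, hy τ h hT, add_zero]
  zero_mem' τ h _ := map_zero _
  smul_mem' a x hx τ h hT := by rw [F.res_smul, hx τ h hT, smul_zero]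

lemma relTo_empty (F : ConeSystem Δ) (γ : Δ.Cone) : F.RelTo γ ∅ = ⊤ :=
  eq_top_iff.mpr fun _ _ _ _ h => h.elim

/-- A section over a face `τ` of `γ` that vanishes where the face meets cones in `T` extends to a
section over `γ` that vanishes on the cones in `T`. -/
lemma exists_extension (hS : F.IsGradedSheaf) (hF : F.IsFlabby) {τ γ : Δ.Cone} (h : τ ≤ γ)
    (T : Set Δ.Cone) (y : F.stalk τ)
    (hy : ∀ (δ : Δ.Cone) (hδ : δ ≤ τ) (τ' : Δ.Cone), τ' ∈ T → δ ≤ τ' → F.res hδ y = 0) :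
    ∃ x ∈ F.RelTo γ T, F.res h x = y := by
  classical
  let Λ : LowerSet Δ.Cone := ⟨{δ | δ ≤ τ ∨ ∃ τ' ∈ T, δ ≤ τ'}, by
    rintro δ δ' hle (h1 | ⟨τ', hT, h1⟩)
    · exact Or.inl (hle.trans h1)
    · exact Or.inr ⟨τ', hT, hle.trans h1⟩⟩
  let t : F.Sec Λ := ⟨fun δ => if hδ : δ.1 ≤ τ then F.res hδ y else 0, by
    intro δ δ' hle
    change F.res hle (if hδ : δ.1 ≤ τ then F.res hδ y else 0) =
      if hδ : δ'.1 ≤ τ then F.res hδ y else 0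
    by_cases h1 : δ.1 ≤ τ
    · rw [dif_pos h1, dif_pos (hle.trans h1), hS.res_trans]
    · rw [dif_neg h1, map_zero]
      by_cases h2 : δ'.1 ≤ τ
      · rw [dif_pos h2]
        obtain ⟨τ', hT, h3⟩ := δ.2.resolve_left h1
        exact (hy _ h2 τ' hT (hle.trans h3)).symm
      · rw [dif_neg h2]⟩
  obtain ⟨z, hz⟩ := hF Λ t
  refine ⟨z.1 ⟨γ, trivial⟩, fun τ' hle hT => ?_, ?_⟩
  · refine (z.2 ⟨γ, trivial⟩ ⟨τ', trivial⟩ hle).trans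
      ((hz ⟨τ', Or.inr ⟨τ', hT, le_rfl⟩⟩).trans ?_)
    change (if hδ : τ' ≤ τ then F.res hδ y else 0) = 0
    split_ifs with h1
    · exact hy τ' h1 τ' hT le_rfl
    · rfl
  · refine (z.2 ⟨γ, trivial⟩ ⟨τ, trivial⟩ h).trans ((hz ⟨τ, Or.inl le_rfl⟩).trans ?_)
    change (if hδ : τ ≤ τ then F.res hδ y else 0) = y
    rw [dif_pos le_rfl, hS.res_refl]

variable [FiniteDimensional ℝ V]

lemma rel_eq_relTo (hS : F.IsGradedSheaf) {γ : Δ.Cone} {T : Set Δ.Cone}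
    (hT : ∀ τ, IsFacet τ γ → τ ∈ T) (hT' : ∀ τ ∈ T, τ < γ) : F.RelTo γ T = F.Rel γ := by
  ext x
  refine ⟨fun hx δ hδ => ?_, fun hx τ hle hτ => hx τ (hT' τ hτ)⟩
  obtain ⟨τ, ht, hle⟩ := exists_facet hδ
  rw [← hS.res_trans hle ht.1, hx τ ht.1 (hT τ ht), map_zero]

/-- The situation of one step of a line shelling: restriction to the facet `τ` maps the sections
vanishing on the preceding facets onto the sections over `τ` vanishing on the facets of `τ` visible
from `p`. -/
lemma shelling_step (hF : F.IsPure) {γ : Δ.Cone} {q v : Sp γ} (hs : IsShelling γ q v) {τ : Δ.Cone}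
    (ht : IsFacet τ γ) {p : Sp τ}
    (hp : ∀ (τ' : Δ.Cone) (ht' : IsFacet τ' γ), (ht'.form (incl ht.1 p) < 0 ↔
        ht'.form q / ht'.form v < ht.form q / ht.form v))
    (hp' : ∀ (ρ τ' : Δ.Cone) (hr : IsFacet ρ τ) (ht' : IsFacet τ' γ), ρ ≤ τ' → τ ≠ τ' →
        (hr.form p < 0 ↔ ht'.form q / ht'.form v < ht.form q / ht.form v)) :
    (∀ x ∈ F.RelTo γ (shellBelow γ q v (ht.form q / ht.form v)),
      F.res ht.1 x ∈ F.RelTo τ (visible τ p)) ∧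
    ∀ y ∈ F.RelTo τ (visible τ p),
      ∃ x ∈ F.RelTo γ (shellBelow γ q v (ht.form q / ht.form v)), F.res ht.1 x = y := by
  have hS := hF.isGradedSheaf
  constructor
  · rintro x hx ρ hle ⟨hr, hrp⟩
    obtain ⟨τ', ht', hr', hne⟩ := exists_other_facet hr ht
    rw [hS.res_trans, ← hS.res_trans hr'.1 ht'.1,
      hx τ' ht'.1 ⟨ht', (hp' ρ τ' hr ht' hr'.1 hne).mp hrp⟩, map_zero]
  · intro y hy
    refine exists_extension hS hF.isFlabby ht.1 _ y ?_
    rintro δ hδ τ' ⟨ht', h'⟩ hle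
    have hneg := (hp τ' ht').mpr h'
    -- A face of `τ` in a preceding facet `τ'` lies in a visible facet of `τ`. Otherwise `p` is on
    -- the non-negative side of all facets of `τ` containing `δ`, hence also for the form of `τ'`,
    -- which is non-negative on `τ` and zero on `δ`.
    have hex : ∃ ρ, ∃ hr : IsFacet ρ τ, δ ≤ ρ ∧ hr.form p < 0 := by
      by_contra! hcon
      refine absurd (nonneg_of_facets hδ p hcon (ht'.form ∘ₗ incl ht.1)
        (fun z hz => ht'.form_nonneg z (ht.1 hz)) ?_) (not_le.mpr hneg)
      exact dual_ext fun z hz => (ht'.form_eq_zero_iff (ht.1 (hδ hz))).mpr (hle hz)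
    obtain ⟨ρ, hr, hle', hrp⟩ := hex
    rw [← hS.res_trans hle' hr.1, hy ρ hr.1 ⟨hr, hrp⟩, map_zero]

lemma finite_relTo (hF : F.IsPure) (γ : Δ.Cone) (T : Set Δ.Cone) : Module.Finite (A γ) (F.RelTo γ T) := by
  have := hF.finite γ
  infer_instance

lemma mem_relTo_step {γ : Δ.Cone} {q v : Sp γ} {c : ℝ} {τ : Δ.Cone} (ht : IsFacet τ γ)
    (hc : ht.form q / ht.form v < c)
    (hmax : ∀ (τ' : Δ.Cone) (ht' : IsFacet τ' γ), ht'.form q / ht'.form v < c → τ' ≠ τ →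
        ht'.form q / ht'.form v < ht.form q / ht.form v) (x : F.stalk γ) :
    x ∈ F.RelTo γ (shellBelow γ q v c) ↔
      x ∈ F.RelTo γ (shellBelow γ q v (ht.form q / ht.form v)) ∧ F.res ht.1 x = 0 := by
  constructor
  · refine fun hx => ⟨?_, hx τ ht.1 ⟨ht, hc⟩⟩
    rintro τ' hle ⟨ht', h'⟩
    exact hx τ' hle ⟨ht', h'.trans hc⟩
  · rintro ⟨hx, hx0⟩ τ' hle ⟨ht', hlt⟩
    by_cases e : τ' = τ
    · subst e; exact hx0
    · exact hx τ' hle ⟨ht', hmax τ' ht' hlt e⟩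

/-- The sections vanishing on an initial part of a line shelling form a projective module. -/
theorem projective_relTo (hF : F.IsPure) (γ : Δ.Cone) : ∀ {q v : Sp γ}, IsShelling γ q v → ∀ c : ℝ,
    Module.Projective (A γ) (F.RelTo γ (shellBelow γ q v c)) := by
  induction hn : dim γ using Nat.strong_induction_on generalizing γ with
  | _ n ih =>
  intro q v hs c
  induction c using hs.induction with
  | empty c hc =>
    rw [hc, relTo_empty]
    have := hF.free γ
    exact Module.Projective.of_equiv (Submodule.topEquiv (R := A γ) (M := F.stalk γ)).symm
  | step c τ ht hc hmax hP =>
    obtain ⟨p, hp, hp', hp0⟩ := hs.exists_point ht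
    obtain ⟨h1, h2⟩ := shelling_step hF hs ht hp hp'
    -- As `p` avoids the facet hyperplanes of `τ`, it defines a line shelling of `τ` whose part
    -- before parameter 0 is the visible one; the induction on the dimension applies there.
    have hQ : Module.Projective (A τ) (F.RelTo τ (visible τ p)) := by
      obtain ⟨w, hw⟩ := exists_isShelling τ p hp0
      rw [← hw.shellBelow_zero]
      exact ih (dim τ) (hn ▸ dim_lt ht.lt) τ rfl hw 0
    refine projective_of_ker (f := (resA ht.1 : A γ →+* A τ)) (resA_surjective ht.1)
      ht.lin_form_ne_zero (fun a ha => ht.dvd_of_resA_eq_zero ha) ht.resA_form (F.res ht.1)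
      (map_add _) (F.res_smul ht.1) hP hQ (finite_relTo hF τ _) h1 h2
      (mem_relTo_step ht hc hmax)

end ConeSystem
end

noncomputable section
open Fan

namespace Fan

variable {V : Type u} [AddCommGroup V] [Module ℝ V] {Δ : Fan V} [FiniteDimensional ℝ V]

/-! ### Transition coefficients of volume forms -/

lemma IsFacet.psi_apply {τ σ : Δ.Cone} (ht : IsFacet τ σ) (ω : Det σ) (w : Fin (dim τ) → Sp τ) :
    ht.psi ω w = ω fun i => Matrix.vecCons ht.vector (fun j => incl ht.1 (w j))
      (finCongr ht.2.symm i) := rfl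

/-- The vector with h(v) = 1 and a basis of V_τ form a basis of V_σ, on which `ω` takes the value of
`ht.psi ω` on the basis of V_τ. -/
lemma IsFacet.psi_ne_zero {τ σ : Δ.Cone} (ht : IsFacet τ σ) {ω : Det σ} (hω : ω ≠ 0) :
    ht.psi ω ≠ 0 := by
  intro h0
  apply hω
  let b : Module.Basis (Fin (dim τ)) ℝ (Sp τ) := Module.finBasis ℝ (Sp τ)
  let e := LinearEquiv.ofInjective (incl ht.1) (Submodule.inclusion_injective _)
  have hker : ∀ x, x ∈ LinearMap.range (incl ht.1) ↔ ht.form x = 0 := fun x => by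
    rw [← ht.ker_form]; rfl
  let E : Module.Basis (Fin (dim τ + 1)) ℝ (Sp σ) := Module.Basis.mkFinCons ht.vector (b.map e)
    (fun c x hx hcx => by
      have := congrArg ht.form hcx
      rw [map_add, map_smul, ht.form_vector, (hker x).mp hx] at this
      simpa using this)
    (fun z => ⟨-ht.form z, (hker _).mpr (by
      rw [map_add, map_smul, ht.form_vector]; simp)⟩)
  let ω' : Sp σ [⋀^Fin (dim τ + 1)]→ₗ[ℝ] ℝ := AlternatingMap.domDomCongr (finCongr ht.2.symm) ω
  have hE : ω' E = ht.psi ω b := by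
    rw [Module.Basis.coe_mkFinCons]
    rfl
  have hω' : ω' = 0 := by
    rw [ω'.eq_smul_basis_det E, hE, h0]
    simp
  ext w
  have := congrArg (fun f => f fun i => w ((finCongr ht.2.symm).symm i)) hω'
  exact this

lemma det_eq_smul {σ : Δ.Cone} {ω : Det σ} (hω : ω ≠ 0) (ω' : Det σ) : ∃ c : ℝ, ω' = c • ω := by
  let b : Module.Basis (Fin (dim σ)) ℝ (Sp σ) := Module.finBasis ℝ (Sp σ)
  have h0 : ω b ≠ 0 := fun h => hω (by rw [ω.eq_smul_basis_det b, h, zero_smul])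
  have h1 : b.det = (ω b)⁻¹ • ω := by
    rw [eq_inv_smul_iff₀ h0]
    exact (ω.eq_smul_basis_det b).symm
  exact ⟨ω' b * (ω b)⁻¹, by rw [mul_smul, ← h1]; exact ω'.eq_smul_basis_det b⟩

/-- The chosen positive volume form. -/
def vol (or : Orientations Δ) (σ : Δ.Cone) : Det σ := (or σ).someVector

lemma vol_ne_zero (or : Orientations Δ) (σ : Δ.Cone) : vol or σ ≠ 0 :=
  Module.Ray.someVector_ne_zero _

lemma IsFacet.sign_eq (or : Orientations Δ) {τ σ : Δ.Cone} (ht : IsFacet τ σ) :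
    ht.sign or = 1 ∨ ht.sign or = -1 := by
  unfold IsFacet.sign
  split_ifs
  · exact Or.inl rfl
  · exact Or.inr rfl

/-- The image of one volume form is a nonzero multiple of the other, and ε is the sign of that
multiple. -/
lemma IsFacet.exists_scale (or : Orientations Δ) {τ σ : Δ.Cone} (ht : IsFacet τ σ) :
    ∃ c : ℝ, 0 < c ∧ ht.sign or • ht.psi (vol or σ) = c • vol or τ := by
  obtain ⟨c, hc⟩ := det_eq_smul (vol_ne_zero or τ) (ht.psi (vol or σ))
  have hc0 : c ≠ 0 := by
    rintro rfl
    exact ht.psi_ne_zero (vol_ne_zero or σ) (by rw [hc, zero_smul])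
  by_cases h : ∃ c : ℝ, 0 < c ∧ ht.psi (or σ).someVector = c • (or τ).someVector
  · obtain ⟨d, hd, hd'⟩ := id h
    refine ⟨d, hd, ?_⟩
    rw [IsFacet.sign, if_pos h, one_smul]
    exact hd'
  · refine ⟨-c, ?_, ?_⟩
    · by_contra! hneg
      exact h ⟨c, lt_of_le_of_ne (by linarith) hc0.symm, hc⟩
    · rw [IsFacet.sign, if_neg h, hc, smul_smul, neg_one_mul]

/-- The positive factor by which the transition map changes the chosen volume forms. -/
def IsFacet.scale (or : Orientations Δ) {τ σ : Δ.Cone} (ht : IsFacet τ σ) : ℝ :=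
  (ht.exists_scale or).choose

lemma IsFacet.scale_pos (or : Orientations Δ) {τ σ : Δ.Cone} (ht : IsFacet τ σ) :
    0 < ht.scale or := (ht.exists_scale or).choose_spec.1

lemma IsFacet.sign_smul_psi (or : Orientations Δ) {τ σ : Δ.Cone} (ht : IsFacet τ σ) :
    ht.sign or • ht.psi (vol or σ) = ht.scale or • vol or τ := (ht.exists_scale or).choose_spec.2

lemma psi_psi_apply {ρ τ σ : Δ.Cone} (hr : IsFacet ρ τ) (ht : IsFacet τ σ)
    (hd : dim σ = dim ρ + 2) (ω : Det σ) (w : Fin (dim ρ) → Sp ρ) :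
    hr.psi (ht.psi ω) w = (AlternatingMap.domDomCongr (finCongr hd) ω)
      (Matrix.vecCons ht.vector (Matrix.vecCons (incl ht.1 hr.vector)
        fun j => incl (hr.1.trans ht.1) (w j))) := by
  rw [hr.psi_apply, ht.psi_apply, AlternatingMap.domDomCongr_apply]
  congr 1
  funext i
  obtain ⟨i, hi⟩ := i
  match i with
  | 0 => rfl
  | 1 => rfl
  | k + 2 => rfl

/-- Going down along the two flags between `ρ` and `σ` gives opposite signs. -/
lemma psi_psi_eq_neg {ρ τ₁ τ₂ σ : Δ.Cone} (hr₁ : IsFacet ρ τ₁) (ht₁ : IsFacet τ₁ σ)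
    (hr₂ : IsFacet ρ τ₂) (ht₂ : IsFacet τ₂ σ) {a b : ℝ} (ha : a ≠ 0) (hb : b ≠ 0)
    (ha' : ht₂.form ∘ₗ incl ht₁.1 = a • hr₁.form) (hb' : ht₁.form ∘ₗ incl ht₂.1 = b • hr₂.form)
    (ω : Det σ) : b • hr₁.psi (ht₁.psi ω) = -(a • hr₂.psi (ht₂.psi ω)) := by
  have hd : dim σ = dim ρ + 2 := by
    have := hr₁.2
    have := ht₁.2
    omega
  set Ω := AlternatingMap.domDomCongr (finCongr hd) ω
  ext w
  have hρ := hr₁.1.trans ht₁.1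
  let w' : Fin (dim ρ) → Sp σ := fun j => incl hρ (w j)
  -- With V_ρ filling the remaining arguments, `B` is an alternating form on the plane V_σ / V_ρ.
  -- The vectors `u₁`, `u₂` form a basis of this plane, and expanding the two transversal vectors in
  -- it reduces both sides to B(u₁, u₂) up to sign.
  let B : Sp σ → Sp σ → ℝ := fun x y => (Ω.curryLeft x).curryLeft y w'
  have hBadd : ∀ x y z, B (x + y) z = B x z + B y z := fun x y z => by
    simp only [B, map_add, AlternatingMap.curryLeft_add, LinearMap.add_apply,
      AlternatingMap.add_apply]
  have hBadd' : ∀ x y z, B x (y + z) = B x y + B x z := fun x y z => by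
    simp only [B, map_add, AlternatingMap.add_apply]
  have hBsmul : ∀ (c : ℝ) x y, B (c • x) y = c * B x y := fun c x y => by
    simp only [B, map_smul, AlternatingMap.curryLeft_smul, LinearMap.smul_apply,
      AlternatingMap.smul_apply, smul_eq_mul]
  have hBself : ∀ x, B x x = 0 := fun x => by
    simp only [B, AlternatingMap.curryLeft_same, AlternatingMap.zero_apply]
  have hBanti : ∀ x y, B x y = -B y x := fun x y => by
    have := hBself (x + y)
    rw [hBadd, hBadd', hBadd', hBself, hBself] at this
    linarith
  have hBρ : ∀ (z : Sp ρ) y, B (incl hρ z) y = 0 := by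
    intro z y
    rw [hBanti, neg_eq_zero]
    have h1 : B y (incl hρ z) = ((Ω.curryLeft y).compLinearMap (incl hρ)) (Matrix.vecCons z w) := by
      simp only [B, w', AlternatingMap.curryLeft_apply_apply, AlternatingMap.compLinearMap_apply]
      congr 2
      funext i
      refine Fin.cases rfl (fun j => rfl) i
    rw [h1]
    refine AlternatingMap.map_linearDependent _ _ fun hli => ?_
    have := hli.fintype_card_le_finrank
    simp at this
  have hker : ∀ x, ht₁.form x = 0 → ht₂.form x = 0 → ∃ z : Sp ρ, incl hρ z = x := by
    intro x h1 h2
    obtain ⟨y, rfl⟩ := ht₁.exists_incl_eq h1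
    have h3 := LinearMap.congr_fun ha' y
    rw [LinearMap.comp_apply, h2, LinearMap.smul_apply, smul_eq_mul, eq_comm, mul_eq_zero] at h3
    obtain ⟨z, rfl⟩ := hr₁.exists_incl_eq (h3.resolve_left ha)
    exact ⟨z, rfl⟩
  set u₁ := incl ht₁.1 hr₁.vector
  set u₂ := incl ht₂.1 hr₂.vector
  have e11 : ht₁.form u₁ = 0 := LinearMap.congr_fun ht₁.form_comp_incl _
  have e22 : ht₂.form u₂ = 0 := LinearMap.congr_fun ht₂.form_comp_incl _
  have e21 : ht₂.form u₁ = a := by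
    have := LinearMap.congr_fun ha' hr₁.vector
    rwa [LinearMap.comp_apply, LinearMap.smul_apply, hr₁.form_vector, smul_eq_mul, mul_one] at this
  have e12 : ht₁.form u₂ = b := by
    have := LinearMap.congr_fun hb' hr₂.vector
    rwa [LinearMap.comp_apply, LinearMap.smul_apply, hr₂.form_vector, smul_eq_mul, mul_one] at this
  have hexp : ∀ x y, B x y = ht₁.form x / b * B u₂ y + ht₂.form x / a * B u₁ y := by
    intro x y
    obtain ⟨z, hz⟩ := hker (x - ((ht₁.form x / b) • u₂ + (ht₂.form x / a) • u₁))
      (by rw [map_sub, map_add, map_smul, map_smul, e12, e11, smul_eq_mul, smul_eq_mul]; field_simp; ring)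
      (by rw [map_sub, map_add, map_smul, map_smul, e22, e21, smul_eq_mul, smul_eq_mul]; field_simp; ring)
    rw [eq_comm, sub_eq_iff_eq_add] at hz
    conv_lhs => rw [hz]
    rw [hBadd, hBadd, hBsmul, hBsmul, hBρ, zero_add]
  have h1 : hr₁.psi (ht₁.psi ω) w = B ht₁.vector u₁ := psi_psi_apply hr₁ ht₁ hd ω w
  have h2 : hr₂.psi (ht₂.psi ω) w = B ht₂.vector u₂ := psi_psi_apply hr₂ ht₂ hd ω w
  rw [AlternatingMap.smul_apply, AlternatingMap.neg_apply, AlternatingMap.smul_apply, h1, h2,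
    hexp ht₁.vector, hexp ht₂.vector, hBself, hBself, ht₁.form_vector, ht₂.form_vector,
    hBanti u₂ u₁, smul_eq_mul, smul_eq_mul]
  field_simp
  ring

/-- The two compositions of ψ are negatives of each other up to a / b. Since all scales are
positive, the two products of signs ε must also be opposite, and the absolute values agree. -/
lemma scale_mul_scale (or : Orientations Δ) {ρ τ₁ τ₂ σ : Δ.Cone} (hr₁ : IsFacet ρ τ₁)
    (ht₁ : IsFacet τ₁ σ) (hr₂ : IsFacet ρ τ₂) (ht₂ : IsFacet τ₂ σ) {a b : ℝ} (ha : 0 < a)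
    (hb : 0 < b) (ha' : ht₂.form ∘ₗ incl ht₁.1 = a • hr₁.form)
    (hb' : ht₁.form ∘ₗ incl ht₂.1 = b • hr₂.form) :
    b * (ht₁.scale or * hr₁.scale or) = a * (ht₂.scale or * hr₂.scale or) := by
  have key : ∀ {τ : Δ.Cone} (hr : IsFacet ρ τ) (ht : IsFacet τ σ),
      (ht.scale or * hr.scale or) • vol or ρ =
        (ht.sign or * hr.sign or) • hr.psi (ht.psi (vol or σ)) := by
    intro τ hr ht
    rw [mul_smul, ← hr.sign_smul_psi, smul_comm, ← map_smul, ← ht.sign_smul_psi, map_smul,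
      smul_smul, mul_comm]
  have h1 := key hr₁ ht₁
  have h2 := key hr₂ ht₂
  have h3 := psi_psi_eq_neg hr₁ ht₁ hr₂ ht₂ ha.ne' hb.ne' ha' hb' (vol or σ)
  have p1 := mul_pos hb (mul_pos (ht₁.scale_pos or) (hr₁.scale_pos or))
  have p2 := mul_pos ha (mul_pos (ht₂.scale_pos or) (hr₂.scale_pos or))
  set s₁ := ht₁.sign or * hr₁.sign or
  set s₂ := ht₂.sign or * hr₂.sign or
  have hs₁ : s₁ = 1 ∨ s₁ = -1 := by
    rcases ht₁.sign_eq or with h | h <;> rcases hr₁.sign_eq or with h' | h' <;> simp [s₁, h, h']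
  have hs₂ : s₂ = 1 ∨ s₂ = -1 := by
    rcases ht₂.sign_eq or with h | h <;> rcases hr₂.sign_eq or with h' | h' <;> simp [s₂, h, h']
  have h4 : (b * (ht₁.scale or * hr₁.scale or)) • vol or ρ =
      (-(s₁ * s₂) * (a * (ht₂.scale or * hr₂.scale or))) • vol or ρ := by
    clear_value s₁ s₂
    rw [mul_smul b, h1, smul_comm, h3, mul_smul (-(s₁ * s₂)), mul_smul a, h2]
    rcases hs₁ with h | h <;> rcases hs₂ with h' | h' <;> rw [h, h'] <;> ext w <;>
      simp [AlternatingMap.smul_apply, AlternatingMap.neg_apply]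
  have h5 := smul_left_injective ℝ (vol_ne_zero or ρ) h4
  rcases hs₁ with h | h <;> rcases hs₂ with h' | h' <;> rw [h, h'] at h5 <;> linarith

end Fan
end

noncomputable section
open Fan

namespace ConeSystem

variable {V : Type u} [AddCommGroup V] [Module ℝ V] {Δ : Fan V} [FiniteDimensional ℝ V]
  {F : ConeSystem Δ}

/-! ### The restriction maps `φ_h` -/

lemma phi_apply_eq (hF : F.IsPure) {τ σ : Δ.Cone} (ht : IsFacet τ σ) (f : F.HomRel σ)
    (s : F.Rel τ) {x : F.stalk σ} (h₁ : F.res ht.1 x = s.1)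
    (h₂ : ∀ (γ : Δ.Cone) (h : γ < σ), γ ≠ τ → F.res h.le x = 0) :
    phi hF ht f s = resA ht.1 (f ⟨lin σ ht.form • x, form_smul_mem ht h₂⟩) :=
  resA_formExt hF ht f s h₁ h₂

lemma exists_ext' (hF : F.IsPure) {τ σ : Δ.Cone} (ht : IsFacet τ σ) (s : F.Rel τ) :
    ∃ (x : F.stalk σ) (h₁ : F.res ht.1 x = s.1)
      (h₂ : ∀ (γ : Δ.Cone) (h : γ < σ), γ ≠ τ → F.res h.le x = 0),
      ∀ f : F.HomRel σ, phi hF ht f s = resA ht.1 (f ⟨lin σ ht.form • x, form_smul_mem ht h₂⟩) := by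
  obtain ⟨x, h₁, h₂⟩ := exists_ext hF ht s
  exact ⟨x, h₁, h₂, fun f => phi_apply_eq hF ht f s h₁ h₂⟩

lemma phi_smul (hF : F.IsPure) {τ σ : Δ.Cone} (ht : IsFacet τ σ) (a : A σ) (f : F.HomRel σ) :
    phi hF ht (a • f) = resA ht.1 a • phi hF ht f :=
  LinearMap.ext fun s => map_mul (resA ht.1) a (f (formExt hF ht s))

/-- The composition of two restriction maps in terms of an extension of the section from the ridge
to the whole cone. -/
lemma smul_phi_phi (hF : F.IsPure) {ρ τ₁ τ₂ σ : Δ.Cone} (hr₁ : IsFacet ρ τ₁) (ht₁ : IsFacet τ₁ σ)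
    (hr₂ : IsFacet ρ τ₂) (ht₂ : IsFacet τ₂ σ) (hne : τ₁ ≠ τ₂) {a : ℝ}
    (ha' : ht₂.form ∘ₗ incl ht₁.1 = a • hr₁.form) (f : F.HomRel σ) (s : F.Rel ρ)
    {x : F.stalk σ} (hx : F.res (hr₁.1.trans ht₁.1) x = s.1)
    (hx' : ∀ (γ : Δ.Cone) (h : γ ≤ σ), ¬ ρ ≤ γ → F.res h x = 0)
    (hmem : lin σ ht₁.form • lin σ ht₂.form • x ∈ F.Rel σ) :
    (a • phi hF hr₁ (phi hF ht₁ f)) s =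
      resA (hr₁.1.trans ht₁.1) (f ⟨lin σ ht₁.form • lin σ ht₂.form • x, hmem⟩) := by
  have hS := hF.isGradedSheaf
  have hv₁ : ∀ (γ : Δ.Cone) (h : γ < τ₁), γ ≠ ρ → F.res h.le (F.res ht₁.1 x) = 0 := by
    intro γ h hγ
    rw [hS.res_trans]
    exact hx' γ _ fun hle => hγ (hr₁.eq_of_le hle h)
  have hv₂ : ∀ (γ : Δ.Cone) (h : γ < σ), γ ≠ τ₁ → F.res h.le (lin σ ht₂.form • x) = 0 := by
    intro γ h hγ
    rw [F.res_smul]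
    by_cases hρ : ρ ≤ γ
    · have hγ₂ : γ ≤ τ₂ := by
        by_cases e : γ = ρ
        · rw [e]; exact hr₂.1
        have d1 := dim_lt (lt_of_le_of_ne hρ (Ne.symm e))
        have d2 := dim_lt h
        have d3 := hr₁.2
        have d4 := ht₁.2
        have hγσ : IsFacet γ σ := ⟨h.le, by omega⟩
        have hργ : IsFacet ρ γ := ⟨hρ, by omega⟩
        exact ((eq_or_eq_of_ridge ht₁ ht₂ hγσ hr₁ hr₂ hργ hne).resolve_left hγ).le
      have h0 : resA h.le (lin σ ht₂.form) = 0 := by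
        rw [← resA_trans hγ₂ ht₂.1, ht₂.resA_form, map_zero]
      rw [h0, zero_smul]
    · rw [hx' γ h.le hρ, smul_zero]
  have h1 := phi_apply_eq hF hr₁ (phi hF ht₁ f) s (x := F.res ht₁.1 x)
    (by rw [hS.res_trans]; exact hx) hv₁
  set y : F.Rel τ₁ := ⟨lin τ₁ hr₁.form • F.res ht₁.1 x, form_smul_mem hr₁ hv₁⟩
  -- The section h₂ x extends a g₁ x|τ₁, with g₁ the form of `ρ` in `τ₁`, and vanishes on the other
  -- proper faces; so it may serve to evaluate φ for `τ₁`.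
  have h2 : F.res ht₁.1 (lin σ ht₂.form • x) = (algebraMap ℝ (A τ₁) a • y : F.Rel τ₁).1 := by
    change _ = algebraMap ℝ (A τ₁) a • lin τ₁ hr₁.form • F.res ht₁.1 x
    rw [F.res_smul, resA_lin, ha', map_smul, smul_smul, ← Algebra.smul_def]
  have h3 := phi_apply_eq hF ht₁ f (algebraMap ℝ (A τ₁) a • y) h2 hv₂
  have h4 : f ⟨lin σ ht₁.form • lin σ ht₂.form • x, hmem⟩ =
      f ⟨lin σ ht₁.form • lin σ ht₂.form • x, form_smul_mem ht₁ hv₂⟩ := rfl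
  rw [LinearMap.smul_apply, h1, h4, ← resA_trans hr₁.1 ht₁.1]
  refine Eq.trans ?_ (congrArg (resA hr₁.1) h3)
  rw [map_smul, smul_eq_mul, map_mul, AlgHom.commutes, Algebra.smul_def]

/-- The maps `φ_h` along the two flags between a ridge and a cone agree up to the ratio of the
forms. -/
lemma smul_phi_phi_eq (hF : F.IsPure) {ρ τ₁ τ₂ σ : Δ.Cone} (hr₁ : IsFacet ρ τ₁)
    (ht₁ : IsFacet τ₁ σ) (hr₂ : IsFacet ρ τ₂) (ht₂ : IsFacet τ₂ σ) (hne : τ₁ ≠ τ₂) {a b : ℝ}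
    (ha' : ht₂.form ∘ₗ incl ht₁.1 = a • hr₁.form) (hb' : ht₁.form ∘ₗ incl ht₂.1 = b • hr₂.form)
    (f : F.HomRel σ) :
    a • phi hF hr₁ (phi hF ht₁ f) = b • phi hF hr₂ (phi hF ht₂ f) := by
  have hS := hF.isGradedSheaf
  refine LinearMap.ext fun s => ?_
  -- One extension `x` of the section over the ridge, zero on all faces not containing `ρ`, serves
  -- for both flags: the proper faces containing `ρ` lie in `τ₁` or `τ₂`, so h₁ h₂ x vanishes on ∂σ.
  obtain ⟨x, hxT, hx⟩ := exists_extension hS hF.isFlabby (hr₁.1.trans ht₁.1) {γ | ¬ ρ ≤ γ} s.1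
    (by
      intro δ hδ τ' hτ' hle
      exact s.2 δ (lt_of_le_of_ne hδ fun e => hτ' (e ▸ hle)))
  have hx' : ∀ (γ : Δ.Cone) (h : γ ≤ σ), ¬ ρ ≤ γ → F.res h x = 0 := fun γ h hγ => hxT γ h hγ
  have hmem : lin σ ht₁.form • lin σ ht₂.form • x ∈ F.Rel σ := by
    intro γ h
    rw [F.res_smul, F.res_smul]
    by_cases hρ : ρ ≤ γ
    · have hγ : γ ≤ τ₁ ∨ γ ≤ τ₂ := by
        by_cases e : γ = ρ
        · rw [e]; exact Or.inl hr₁.1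
        have d1 := dim_lt (lt_of_le_of_ne hρ (Ne.symm e))
        have d2 := dim_lt h
        have d3 := hr₁.2
        have d4 := ht₁.2
        exact (eq_or_eq_of_ridge ht₁ ht₂ ⟨h.le, by omega⟩ hr₁ hr₂ ⟨hρ, by omega⟩ hne).imp
          (fun e => e.le) (fun e => e.le)
      rcases hγ with hγ | hγ
      · rw [← resA_trans hγ ht₁.1, ht₁.resA_form, map_zero, zero_smul]
      · rw [← resA_trans hγ ht₂.1 (lin σ ht₂.form), ht₂.resA_form, map_zero, zero_smul, smul_zero]
    · rw [hx' γ h.le hρ, smul_zero, smul_zero]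
  have hmem' : lin σ ht₂.form • lin σ ht₁.form • x ∈ F.Rel σ := by rwa [smul_comm]
  rw [smul_phi_phi hF hr₁ ht₁ hr₂ ht₂ hne ha' f s hx hx' hmem,
    smul_phi_phi hF hr₂ ht₂ hr₁ ht₁ hne.symm hb' f s hx hx' hmem']
  congr 3
  rw [smul_comm]

/-! ### The dual sheaf after a choice of volume forms -/

/-- The facet restriction of the dual sheaf, after the choice of volume forms. -/
def homResFacet (or : Orientations Δ) (hF : F.IsPure) {τ σ : Δ.Cone} (ht : IsFacet τ σ) :
    F.HomRel σ →ₗ[ℝ] F.HomRel τ := ht.scale or • phi hF ht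

lemma homResFacet_smul (or : Orientations Δ) (hF : F.IsPure) {τ σ : Δ.Cone} (ht : IsFacet τ σ)
    (a : A σ) (f : F.HomRel σ) :
    homResFacet or hF ht (a • f) = resA ht.1 a • homResFacet or hF ht f := by
  rw [homResFacet, LinearMap.smul_apply, LinearMap.smul_apply, phi_smul, smul_comm]

/-- The ratio b / a between the compositions of φ cancels the ratio a / b between the products of
scales. -/
lemma homResFacet_ridge (or : Orientations Δ) (hF : F.IsPure) {ρ τ₁ τ₂ σ : Δ.Cone}
    (hr₁ : IsFacet ρ τ₁) (ht₁ : IsFacet τ₁ σ) (hr₂ : IsFacet ρ τ₂) (ht₂ : IsFacet τ₂ σ)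
    (f : F.HomRel σ) :
    homResFacet or hF hr₁ (homResFacet or hF ht₁ f) =
      homResFacet or hF hr₂ (homResFacet or hF ht₂ f) := by
  by_cases hne : τ₁ = τ₂
  · subst hne; rfl
  obtain ⟨a, ha, ha'⟩ := exists_form_restrict hr₁ ht₁ ht₂ hne hr₂.1
  obtain ⟨b, hb, hb'⟩ := exists_form_restrict hr₂ ht₂ ht₁ (Ne.symm hne) hr₁.1
  have h1 := smul_phi_phi_eq hF hr₁ ht₁ hr₂ ht₂ hne ha' hb' f
  have h2 := scale_mul_scale or hr₁ ht₁ hr₂ ht₂ ha hb ha' hb'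
  simp only [homResFacet, LinearMap.smul_apply, map_smul, smul_smul]
  rw [← (inv_smul_eq_iff₀ ha.ne').mpr h1.symm]
  rw [smul_smul, smul_smul]
  congr 1
  have := ha.ne'
  field_simp
  linarith

/-- The composition of the facet restrictions along a flag. -/
def homResFlag (or : Orientations Δ) (hF : F.IsPure) :
    ∀ {τ σ : Δ.Cone}, Flag τ σ → (F.HomRel σ →ₗ[ℝ] F.HomRel τ)
  | _, _, .refl => LinearMap.id
  | _, _, .cons ht p => homResFlag or hF p ∘ₗ homResFacet or hF ht

lemma homResFlag_smul (or : Orientations Δ) (hF : F.IsPure) {τ σ : Δ.Cone}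
    (p : Flag τ σ) (h : τ ≤ σ) (a : A σ) (f : F.HomRel σ) :
    homResFlag or hF p (a • f) = resA h a • homResFlag or hF p f := by
  induction p with
  | refl => rw [resA_refl, homResFlag]; rfl
  | cons ht p ih =>
    rw [homResFlag, LinearMap.comp_apply, LinearMap.comp_apply, homResFacet_smul, ih p.le,
      resA_trans]

lemma nonempty_flag {τ σ : Δ.Cone} (h : τ ≤ σ) : Nonempty (Flag τ σ) := by
  induction hn : dim σ using Nat.strong_induction_on generalizing σ with
  | _ n ih =>
  by_cases e : τ = σ
  · subst e; exact ⟨.refl⟩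
  · obtain ⟨ρ, hr, hle⟩ := exists_facet (lt_of_le_of_ne h e)
    obtain ⟨p⟩ := ih (dim ρ) (hn ▸ dim_lt hr.lt) hle rfl
    exact ⟨.cons hr p⟩

/-- The composition of facet restrictions does not depend on the flag. -/
lemma homResFlag_eq (or : Orientations Δ) (hF : F.IsPure) {τ σ : Δ.Cone} (p p' : Flag τ σ) :
    homResFlag or hF p = homResFlag or hF p' := by
  induction hn : dim σ using Nat.strong_induction_on generalizing σ with
  | _ n ih =>
  cases p with
  | refl =>
    cases p' with
    | refl => rfl
    | cons ht q => exact absurd ht.lt q.le.not_gt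
  | cons ht p =>
    cases p' with
    | refl => exact absurd ht.lt p.le.not_gt
    | cons ht' p' =>
      -- The last steps of the two flags are facets of `σ` containing `τ`. Passing from one facet to
      -- an adjacent one exchanges the two ways around a ridge, and below a facet the flag is
      -- arbitrary by induction.
      refine facets_connected (ρ := τ) (σ := σ)
        (fun δ => ∀ (hδ : IsFacet δ σ) (r : Flag τ δ), homResFlag or hF (.cons hδ r) =
          homResFlag or hF (.cons ht' p')) ?_ ht' p'.le ?_ ht p.le ht p
      · intro δ δ' κ hδ hδ' hκ hκ' hle hne hP hδ'' r
        obtain ⟨k⟩ := nonempty_flag hle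
        rw [← hP hδ' (.cons hκ' k)]
        have e := ih (dim δ) (hn ▸ dim_lt hδ.lt) r (.cons hκ k) rfl
        simp only [homResFlag] at e ⊢
        rw [e]
        refine LinearMap.ext fun f => ?_
        simp only [LinearMap.comp_apply]
        rw [homResFacet_ridge or hF hκ hδ hκ' hδ']
      · intro hδ r
        have e := ih (dim _) (hn ▸ dim_lt hδ.lt) r p' rfl
        simp only [homResFlag]
        rw [e]

/-- The composition of two flags. -/
def _root_.Fan.Flag.trans {γ τ : Δ.Cone} (p : Flag γ τ) : ∀ {σ : Δ.Cone}, Flag τ σ → Flag γ σ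
  | _, .refl => p
  | _, .cons ht q => .cons ht (p.trans q)

lemma homResFlag_trans (or : Orientations Δ) (hF : F.IsPure) {γ τ σ : Δ.Cone} (p : Flag γ τ)
    (q : Flag τ σ) (f : F.HomRel σ) :
    homResFlag or hF (p.trans q) f = homResFlag or hF p (homResFlag or hF q f) := by
  induction q with
  | refl => simp only [Flag.trans, homResFlag, LinearMap.id_apply]
  | cons ht q ih =>
    simp only [Flag.trans, homResFlag, LinearMap.comp_apply]
    rw [ih]

open Classical in
/-- The dual sheaf after the choice of a volume form for every cone. -/
def homDual (or : Orientations Δ) (F : ConeSystem Δ) (hF : F.IsPure) : ConeSystem Δ where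
  stalk σ := F.HomRel σ
  deg σ d := F.degHom σ (d - 2 * (dim σ : ℤ))
  res {τ σ} h := if hp : Nonempty (Flag τ σ) then homResFlag or hF hp.some else 0
  res_smul h a x := by
    split_ifs with hp
    · exact homResFlag_smul or hF hp.some h a x
    · simp only [LinearMap.zero_apply, smul_zero]

lemma homDual_res (or : Orientations Δ) (hF : F.IsPure) {τ σ : Δ.Cone} (h : τ ≤ σ)
    (p : Flag τ σ) : (homDual or F hF).res h = homResFlag or hF p := by
  have hp : Nonempty (Flag τ σ) := ⟨p⟩
  exact (dif_pos hp).trans (homResFlag_eq or hF _ _)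

lemma homDual_res_facet (or : Orientations Δ) (hF : F.IsPure) {τ σ : Δ.Cone} (ht : IsFacet τ σ)
    (f : F.HomRel σ) : (homDual or F hF).res ht.1 f = homResFacet or hF ht f := by
  rw [homDual_res or hF ht.1 (.cons ht .refl)]
  simp only [homResFlag]
  rfl

lemma homDual_res_refl (or : Orientations Δ) (hF : F.IsPure) (σ : Δ.Cone) (f : F.HomRel σ) :
    (homDual or F hF).res (le_refl σ) f = f := by
  rw [homDual_res or hF (le_refl σ) .refl]
  simp only [homResFlag]
  rfl

lemma homDual_res_trans (or : Orientations Δ) (hF : F.IsPure) {γ τ σ : Δ.Cone} (h : γ ≤ τ)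
    (h' : τ ≤ σ) (f : F.HomRel σ) : (homDual or F hF).res h ((homDual or F hF).res h' f) =
      (homDual or F hF).res (h.trans h') f := by
  obtain ⟨p⟩ := nonempty_flag h
  obtain ⟨q⟩ := nonempty_flag h'
  rw [homDual_res or hF h p, homDual_res or hF h' q, homDual_res or hF _ (p.trans q)]
  exact (homResFlag_trans or hF p q f).symm

/-! ### Sections of the dual sheaf over the boundary of a cone -/

open Classical in
/-- A form on the sections vanishing on the boundary whose restrictions to the facets outside of
`T` vanish extends to the sections vanishing on the cones in `T`. -/
lemma exists_extend_form (hF : F.IsPure) {σ : Δ.Cone} (T : Set Δ.Cone) (f : F.HomRel σ)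
    (hf : ∀ (ρ : Δ.Cone) (hr : IsFacet ρ σ), ρ ∉ T → phi hF hr f = 0) :
    ∃ g : F.RelTo σ T →ₗ[A σ] A σ, ∀ (x : F.Rel σ) (hx : x.1 ∈ F.RelTo σ T), g ⟨x.1, hx⟩ = f x := by
  have hS := hF.isGradedSheaf
  have : Fintype Δ.Cone := Fintype.ofFinite _
  let I := {ρ : Δ.Cone // IsFacet ρ σ ∧ ρ ∉ T}
  let h : I → A σ := fun ρ => lin σ ρ.2.1.form
  have hvan : ∀ (s : Finset I) (x : F.stalk σ), x ∈ F.RelTo σ T → ∀ (δ : Δ.Cone) (hδ : δ < σ)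
      (τ : Δ.Cone), IsFacet τ σ → δ ≤ τ → (∀ hτ : IsFacet τ σ ∧ τ ∉ T, ⟨τ, hτ⟩ ∈ s) →
      F.res hδ.le ((∏ i ∈ s, h i) • x) = 0 := by
    intro s x hx δ hδ τ ht hle hs
    by_cases hT : τ ∈ T
    · rw [F.res_smul, ← hS.res_trans hle ht.1, hx τ ht.1 hT, map_zero, smul_zero]
    · have hmem := hs ⟨ht, hT⟩
      rw [F.res_smul, map_prod, Finset.prod_eq_zero hmem, zero_smul]
      simp only [h]
      rw [← resA_trans hle ht.1, ht.resA_form, map_zero]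
  -- Multiplication with the product of the forms of the facets outside `T` moves a section
  -- vanishing on `T` into F_(σ,∂σ). The extension is g(x) = f(P x) / P, once divisibility is known.
  let P := ∏ i : I, h i
  have hP0 : P ≠ 0 := Finset.prod_ne_zero_iff.mpr fun i _ => i.2.1.lin_form_ne_zero
  have hPmem : ∀ x ∈ F.RelTo σ T, P • x ∈ F.Rel σ := by
    intro x hx δ hδ
    obtain ⟨τ, ht, hle⟩ := exists_facet hδ
    exact hvan Finset.univ x hx δ hδ τ ht hle fun _ => Finset.mem_univ _
  let u : F.RelTo σ T →ₗ[A σ] A σ := f ∘ₗ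
    ((LinearMap.lsmul (A σ) (F.stalk σ) P).restrict hPmem)
  have hu : ∀ x : F.RelTo σ T, u x = f ⟨P • x.1, hPmem x.1 x.2⟩ := fun x => rfl
  -- The product of the other forms times `x` vanishes on all proper faces except the facet `i`, so
  -- f(P x) restricted to that facet is a value of φ(f), which is zero by assumption.
  have hdvd : ∀ (x : F.RelTo σ T) (i : I), h i ∣ u x := by
    intro x i
    rw [hu]
    refine i.2.1.dvd_of_resA_eq_zero ?_
    have hv : ∀ (δ : Δ.Cone) (hδ : δ < σ), δ ≠ i.1 →
        F.res hδ.le ((∏ j ∈ Finset.univ.erase i, h j) • x.1) = 0 := by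
      intro δ hδ hne
      obtain ⟨τ, ht, hle, hτ⟩ := exists_facet_ne hδ i.2.1 hne
      refine hvan _ x.1 x.2 δ hδ τ ht hle fun hτ' => Finset.mem_erase.mpr ⟨fun e => ?_, Finset.mem_univ _⟩
      exact hτ (congrArg Subtype.val e)
    have hrel : F.res i.2.1.1 ((∏ j ∈ Finset.univ.erase i, h j) • x.1) ∈ F.Rel i.1 := by
      intro δ hδ
      rw [hS.res_trans]
      exact hv δ (hδ.trans i.2.1.lt) hδ.ne
    have h1 := phi_apply_eq hF i.2.1 f ⟨_, hrel⟩ rfl hv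
    rw [hf i.1 i.2.1 i.2.2, LinearMap.zero_apply] at h1
    rw [h1]
    congr 3
    rw [smul_smul]
    congr 1
    exact (Finset.mul_prod_erase Finset.univ h (Finset.mem_univ i)).symm
  -- The factors are primes none of which divides another, so divisibility by each gives
  -- divisibility by the product.
  have hPdvd : ∀ x, P ∣ u x := by
    intro x
    have : ∀ s : Finset I, ∏ i ∈ s, h i ∣ u x := by
      intro s
      induction s using Finset.induction_on with
      | empty => simp
      | insert i s hi ih =>
        rw [Finset.prod_insert hi]
        obtain ⟨b, hb⟩ := ih
        have h1 := hdvd x i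
        rw [hb] at h1
        have hp : Prime (h i) := i.2.1.prime_form
        rcases hp.dvd_or_dvd h1 with h2 | ⟨c, hc⟩
        · obtain ⟨j, hj, hij⟩ := (hp.dvd_finsetProd_iff h).mp h2
          exact absurd hij (i.2.1.not_dvd j.2.1 fun e => hi (by rwa [show i = j from Subtype.ext e]))
        · rw [hb, hc]
          exact ⟨c, by ring⟩
    exact this Finset.univ
  obtain ⟨g, hg⟩ := exists_div_form hP0 u hPdvd
  refine ⟨g, fun x hx => mul_left_cancel₀ hP0 ?_⟩
  rw [← hg, hu, ← smul_eq_mul, ← map_smul]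
  rfl

/-- Forms with vanishing restriction to the boundary extend to all sections. -/
lemma exists_extend_form_top (hF : F.IsPure) {σ : Δ.Cone} (f : F.HomRel σ)
    (hf : ∀ (ρ : Δ.Cone) (hr : IsFacet ρ σ), phi hF hr f = 0) :
    ∃ g : F.stalk σ →ₗ[A σ] A σ, ∀ x : F.Rel σ, g x.1 = f x := by
  obtain ⟨g, hg⟩ := exists_extend_form hF ∅ f fun ρ hr _ => hf ρ hr
  refine ⟨g ∘ₗ LinearMap.codRestrict _ LinearMap.id fun x => ?_, fun x => hg x _⟩
  rw [relTo_empty]; trivial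

/-- A compatible family of forms on the facets comes from a form on the cone. -/
theorem exists_form_of_facets (or : Orientations Δ) (hF : F.IsPure) {γ : Δ.Cone}
    (f : ∀ τ : Δ.Cone, F.HomRel τ)
    (hf : ∀ (τ τ' ρ : Δ.Cone), IsFacet τ γ → IsFacet τ' γ → ∀ (hr : IsFacet ρ τ) (hr' : IsFacet ρ τ'),
      homResFacet or hF hr (f τ) = homResFacet or hF hr' (f τ')) :
    ∃ g : F.HomRel γ, ∀ (τ : Δ.Cone) (ht : IsFacet τ γ), homResFacet or hF ht g = f τ := by
  have hS := hF.isGradedSheaf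
  obtain ⟨q, hq, hq'⟩ := exists_interior γ
  obtain ⟨v, hs⟩ := exists_isShelling γ (pt hq) fun τ ht => (ht.form_pos hq (hq' τ ht.lt)).ne'
  -- Induction along the line shelling, for families that vanish on all facets from parameter `c`
  -- on; a `c` beyond all parameters gives the general case.
  suffices key : ∀ c : ℝ, ∀ f : ∀ τ : Δ.Cone, F.HomRel τ,
      (∀ (τ τ' ρ : Δ.Cone), IsFacet τ γ → IsFacet τ' γ → ∀ (hr : IsFacet ρ τ) (hr' : IsFacet ρ τ'),
        homResFacet or hF hr (f τ) = homResFacet or hF hr' (f τ')) →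
      (∀ (τ : Δ.Cone) (ht : IsFacet τ γ), c ≤ ht.form (pt hq) / ht.form v → f τ = 0) →
      ∃ g : F.HomRel γ, ∀ (τ : Δ.Cone) (ht : IsFacet τ γ), homResFacet or hF ht g = f τ by
    let κ : {τ : Δ.Cone // IsFacet τ γ} → ℝ := fun τ => τ.2.form (pt hq) / τ.2.form v
    obtain ⟨c, hc⟩ := (Set.finite_range κ).bddAbove
    refine key (c + 1) f hf fun τ ht h => ?_
    have := hc ⟨⟨τ, ht⟩, rfl⟩
    simp only [κ] at this
    linarith
  intro c
  induction c using hs.induction with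
  | empty c hc =>
    intro f hf h0
    refine ⟨0, fun τ ht => ?_⟩
    rw [map_zero, h0 τ ht]
    by_contra! hlt
    have : τ ∈ shellBelow γ (pt hq) v c := ⟨ht, hlt⟩
    rw [hc] at this
    exact this
  | step c τ ht hc hmax ih =>
    intro f hf h0
    obtain ⟨p, hp, hp', hp0⟩ := hs.exists_point ht
    obtain ⟨h1, h2⟩ := shelling_step hF hs ht hp hp'
    set k := ht.form (pt hq) / ht.form v
    -- Across a ridge of `τ` not visible from `p` lies a facet with parameter at least `c`, where
    -- the family is zero. By compatibility f τ restricts to zero on that ridge, so it extends.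
    obtain ⟨g, hg⟩ := exists_extend_form hF (visible τ p) (f τ) (by
      intro ρ hr hρ
      obtain ⟨τ', ht', hr', hne⟩ := exists_other_facet hr ht
      have h3 : f τ' = 0 := by
        refine h0 τ' ht' ?_
        by_contra! hlt
        exact hρ ⟨hr, (hp' ρ τ' hr ht' hr'.1 hne).mpr (hmax τ' ht' hlt hne.symm)⟩
      have h4 := hf τ τ' ρ ht ht' hr hr'
      rw [h3, map_zero, homResFacet, LinearMap.smul_apply] at h4
      exact (smul_eq_zero.mp h4).resolve_left (hr.scale_pos or).ne')
    have hproj := projective_relTo hF γ hs k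
    let u : F.RelTo γ (shellBelow γ (pt hq) v k) → A τ := fun x => g ⟨F.res ht.1 x.1, h1 x.1 x.2⟩
    -- Projectivity of the sections vanishing on the facets before `τ` lifts `g ∘ res` from `A τ` to
    -- `A γ`.
    obtain ⟨w, hw⟩ := exists_lift_of_projective (f := (resA ht.1 : A γ →+* A τ))
      (resA_surjective ht.1) u
      (fun x y => by
        simp only [u]
        rw [← map_add]
        congr 1
        exact Subtype.ext (map_add (F.res ht.1) x.1 y.1))
      (fun a x => by
        simp only [u]
        change _ = resA ht.1 a * _
        rw [← smul_eq_mul, ← map_smul]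
        congr 1
        exact Subtype.ext (F.res_smul ht.1 a x.1))
    have hle : F.RelTo γ (shellBelow γ (pt hq) v c) ≤ F.RelTo γ (shellBelow γ (pt hq) v k) :=
      fun x hx => ((mem_relTo_step ht hc hmax x).mp hx).1
    -- On sections that also vanish on `τ` the values of `w` restrict to zero on `τ`, hence are
    -- divisible by h. The quotient satisfies z(h x) = w(x), so φ sends it to f τ.
    obtain ⟨z, hz⟩ := exists_div_form ht.lin_form_ne_zero (w ∘ₗ Submodule.inclusion hle) (by
      intro x
      refine ht.dvd_of_resA_eq_zero ((hw _).trans ?_)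
      simp only [u]
      have h5 : (⟨F.res ht.1 (Submodule.inclusion hle x).1, h1 _ (Submodule.inclusion hle x).2⟩ :
          F.RelTo τ (visible τ p)) = 0 := Subtype.ext ((mem_relTo_step ht hc hmax x.1).mp x.2).2
      rw [h5, map_zero])
    have hrel : F.Rel γ ≤ F.RelTo γ (shellBelow γ (pt hq) v c) := by
      rintro x hx τ' hle' ⟨ht', _⟩
      exact hx τ' ht'.lt
    let z' : F.HomRel γ := z ∘ₗ Submodule.inclusion hrel
    have hzτ : phi hF ht z' = f τ := by
      refine LinearMap.ext fun s => ?_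
      obtain ⟨x, e₁, e₂, hx⟩ := exists_ext' hF ht s
      rw [hx]
      have hxk : x ∈ F.RelTo γ (shellBelow γ (pt hq) v k) := by
        rintro τ' hle' ⟨ht', h'⟩
        refine e₂ τ' ht'.lt fun e => ?_
        subst e
        exact lt_irrefl _ h'
      have h6 : z' ⟨lin γ ht.form • x, form_smul_mem ht e₂⟩ = w ⟨x, hxk⟩ := by
        apply mul_left_cancel₀ ht.lin_form_ne_zero
        have h7 := hz ⟨lin γ ht.form • x, hrel (form_smul_mem ht e₂)⟩
        refine h7.symm.trans ?_
        rw [← smul_eq_mul, ← map_smul]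
        rfl
      rw [h6]
      refine (hw _).trans ?_
      have h8 : F.res ht.1 x ∈ F.RelTo τ (visible τ p) := h1 x hxk
      have h9 := hg s (by rwa [← e₁])
      rw [← h9]
      simp only [u]
      congr 1
      exact Subtype.ext e₁
    -- For a facet not before `c`, the extension `x` itself lies in the domain of `z`. So z(h' x) =
    -- h' z(x), which vanishes on `τ'`.
    have hz0 : ∀ (τ' : Δ.Cone) (ht' : IsFacet τ' γ),
        c ≤ ht'.form (pt hq) / ht'.form v → phi hF ht' z' = 0 := by
      intro τ' ht' hge
      refine LinearMap.ext fun s => ?_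
      obtain ⟨x, e₁, e₂, hx⟩ := exists_ext' hF ht' s
      rw [hx]
      have hxc : x ∈ F.RelTo γ (shellBelow γ (pt hq) v c) := by
        rintro δ hle' ⟨hδ, h'⟩
        refine e₂ δ hδ.lt fun e => ?_
        subst e
        exact absurd h' (not_lt.mpr hge)
      have h6 : z' ⟨lin γ ht'.form • x, form_smul_mem ht' e₂⟩ = lin γ ht'.form * z ⟨x, hxc⟩ := by
        rw [← smul_eq_mul, ← map_smul]
        rfl
      rw [h6, map_mul, ht'.resA_form, zero_mul, LinearMap.zero_apply]
    let y : F.HomRel γ := (ht.scale or)⁻¹ • z'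
    have hyτ : homResFacet or hF ht y = f τ := by
      rw [homResFacet, LinearMap.smul_apply, map_smul, smul_smul,
        mul_inv_cancel₀ (ht.scale_pos or).ne', one_smul, hzτ]
    have hy0 : ∀ (τ' : Δ.Cone) (ht' : IsFacet τ' γ),
        c ≤ ht'.form (pt hq) / ht'.form v → homResFacet or hF ht' y = 0 := by
      intro τ' ht' hge
      rw [homResFacet, LinearMap.smul_apply, map_smul, hz0 τ' ht' hge, smul_zero, smul_zero]
    classical
    -- After subtracting the restrictions of `y` the family vanishes at `τ` and still on all later
    -- facets, so the induction hypothesis at the parameter of `τ` applies.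
    let f' : ∀ τ : Δ.Cone, F.HomRel τ := fun τ =>
      if ht : IsFacet τ γ then f τ - homResFacet or hF ht y else 0
    have hf' : ∀ (τ : Δ.Cone) (ht : IsFacet τ γ), f' τ = f τ - homResFacet or hF ht y :=
      fun τ ht => dif_pos ht
    obtain ⟨g', hg'⟩ := ih f' (by
      intro τ₁ τ₂ ρ ht₁ ht₂ hr₁ hr₂
      rw [hf' τ₁ ht₁, hf' τ₂ ht₂, map_sub, map_sub, hf τ₁ τ₂ ρ ht₁ ht₂ hr₁ hr₂,
        homResFacet_ridge or hF hr₁ ht₁ hr₂ ht₂]) (by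
      intro τ' ht' hge
      rw [hf' τ' ht']
      by_cases e : τ' = τ
      · subst e
        rw [hyτ, sub_self]
      · have hge' : c ≤ ht'.form (pt hq) / ht'.form v := by
          by_contra! hlt
          exact absurd (hmax τ' ht' hlt e) (not_lt.mpr hge)
        rw [hy0 τ' ht' hge', h0 τ' ht' hge', sub_zero])
    refine ⟨g' + y, fun τ' ht' => ?_⟩
    rw [map_add, hg' τ' ht', hf' τ' ht', sub_add_cancel]

end ConeSystem
end

noncomputable section
open Fan

/-! ### Linear maps of degree zero -/

section Gradings

variable {M N : Type*} [AddCommGroup M] [Module ℝ M] [AddCommGroup N] [Module ℝ N]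
  {G : ℤ → Submodule ℝ M} {H : ℤ → Submodule ℝ N}

lemma gproj_comm_zero (hG : DirectSum.IsInternal G) (hH : DirectSum.IsInternal H) (f : M →ₗ[ℝ] N)
    (hf : ∀ d, ∀ x ∈ G d, f x ∈ H d) (d : ℤ) (x : M) :
    gproj hH d (f x) = f (gproj hG d x) := by
  have := gproj_comm hG hH f 0 (fun d x hx => by simpa using hf d x hx) d x
  simpa using this

/-- A surjective map of degree zero has a section of degree zero. -/
lemma exists_graded_section (hG : DirectSum.IsInternal G) (hH : DirectSum.IsInternal H)
    (f : M →ₗ[ℝ] N) (hf : ∀ d, ∀ x ∈ G d, f x ∈ H d) (hsurj : Function.Surjective f) :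
    ∃ s : N →ₗ[ℝ] M, (∀ y, f (s y) = y) ∧ ∀ d, ∀ y ∈ H d, s y ∈ G d := by
  obtain ⟨s, hs⟩ := f.exists_rightInverse_of_surjective (LinearMap.range_eq_top.mpr hsurj)
  refine ⟨gcomp hH hG s 0, fun y => ?_, fun d y hy => by simpa using gcomp_mem hH hG s 0 hy⟩
  induction y using IsInternal.induction hH with
  | zero => simp
  | add x y hx hy => simp [hx, hy]
  | mem d y hy =>
    rw [gcomp_of_mem hH hG s 0 hy, add_zero, ← gproj_comm_zero hG hH f hf]
    have : f (s y) = y := LinearMap.congr_fun hs y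
    rw [this, gproj_of_mem hH hy]

/-- A bijective map of degree zero identifies the gradings. -/
lemma mem_iff_of_injective (hG : DirectSum.IsInternal G) (hH : DirectSum.IsInternal H)
    (f : M →ₗ[ℝ] N) (hf : ∀ d, ∀ x ∈ G d, f x ∈ H d) (hinj : Function.Injective f) (d : ℤ) (x : M) :
    f x ∈ H d ↔ x ∈ G d := by
  refine ⟨fun h => mem_of_gproj_eq_zero hG fun e he => hinj ?_, hf d x⟩
  rw [← gproj_comm_zero hG hH f hf, gproj_of_mem_ne hH h he.symm, map_zero]

end Gradings

/-! ### Gradings of tensor products -/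

section TensorGrading

variable {M N : Type u} [AddCommGroup M] [Module ℝ M] [AddCommGroup N] [Module ℝ N]
  {G : ℤ → Submodule ℝ M} {H : ℤ → Submodule ℝ N}

lemma tmul_mem_tensorDeg {i j d : ℤ} (h : i + j = d) {x : M} {y : N} (hx : x ∈ G i) (hy : y ∈ H j) :
    x ⊗ₜ[ℝ] y ∈ tensorDeg G H d := by
  unfold tensorDeg
  refine Submodule.mem_iSup_of_mem i (Submodule.mem_iSup_of_mem j (Submodule.mem_iSup_of_mem h ?_))
  exact Submodule.apply_mem_map₂ (TensorProduct.mk ℝ M N) hx hy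

lemma tensorDeg_le {d : ℤ} {S : Submodule ℝ (M ⊗[ℝ] N)}
    (h : ∀ i j, i + j = d → ∀ x ∈ G i, ∀ y ∈ H j, x ⊗ₜ[ℝ] y ∈ S) : tensorDeg G H d ≤ S := by
  unfold tensorDeg
  refine iSup_le fun i => iSup_le fun j => iSup_le fun hij => ?_
  exact Submodule.map₂_le.mpr fun x hx y hy => h i j hij x hx y hy

lemma isInternal_tensorDeg (hG : DirectSum.IsInternal G) (hH : DirectSum.IsInternal H) :
    DirectSum.IsInternal (tensorDeg G H) := by
  -- The projection to degree `d` sends x ⊗ y, with `x` of degree `i`, to `x` tensored with the part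
  -- of `y` of degree `d - i`.
  let β : ℤ → M →ₗ[ℝ] N →ₗ[ℝ] M ⊗[ℝ] N := fun d =>
    DirectSum.toModule ℝ ℤ _ (fun i => LinearMap.lcomp ℝ _ (gproj hH (d - i)) ∘ₗ
      TensorProduct.mk ℝ M N ∘ₗ (G i).subtype) ∘ₗ (gdecomp hG).toLinearMap
  have hβ : ∀ d i, ∀ x ∈ G i, ∀ y, β d x y = x ⊗ₜ gproj hH (d - i) y := by
    intro d i x hx y
    simp only [β, LinearMap.comp_apply, LinearEquiv.coe_coe, gdecomp_of_mem hG hx]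
    simp [DirectSum.toModule_lof]
  have hπ : ∀ d i j, ∀ x ∈ G i, ∀ y ∈ H j, TensorProduct.lift (β d) (x ⊗ₜ y) =
      if i + j = d then x ⊗ₜ y else 0 := by
    intro d i j x hx y hy
    rw [TensorProduct.lift.tmul, hβ d i x hx, gproj_of_mem_ite hH hy]
    by_cases h : i + j = d
    · rw [if_pos (by linarith), if_pos h]
    · rw [if_neg (fun h' => h (by linarith)), if_neg h, TensorProduct.tmul_zero]
  refine isInternal_of_proj (fun d => TensorProduct.lift (β d)) ?_ ?_ ?_
  · intro d x hx
    have : tensorDeg G H d ≤ LinearMap.ker (TensorProduct.lift (β d) - LinearMap.id) := by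
      refine tensorDeg_le fun i j hij x hx y hy => ?_
      rw [LinearMap.mem_ker, LinearMap.sub_apply, hπ d i j x hx y hy, if_pos hij, LinearMap.id_apply,
        sub_self]
    exact sub_eq_zero.mp (this hx)
  · intro d e x hx hne
    have : tensorDeg G H e ≤ LinearMap.ker (TensorProduct.lift (β d)) := by
      refine tensorDeg_le fun i j hij x hx y hy => ?_
      rw [LinearMap.mem_ker, hπ d i j x hx y hy, if_neg (hij ▸ hne)]
    exact this hx
  · intro z
    induction z using TensorProduct.induction_on with
    | zero => simp
    | add x y hx hy => exact add_mem hx hy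
    | tmul x y =>
      induction x using IsInternal.induction hG with
      | zero => simp
      | add x x' hx hx' => rw [TensorProduct.add_tmul]; exact add_mem hx hx'
      | mem i x hx =>
        induction y using IsInternal.induction hH with
        | zero => simp
        | add y y' hy hy' => rw [TensorProduct.tmul_add]; exact add_mem hy hy'
        | mem j y hy => exact Submodule.mem_iSup_of_mem (i + j) (tmul_mem_tensorDeg rfl hx hy)

/-- The tensor product of a graded ring with a graded vector space is a graded module. -/
lemma smulGraded_tensorDeg {R : Type u} [CommRing R] [Algebra ℝ R] {𝒜 : ℤ → Submodule ℝ R}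
    (h𝒜 : SMulGraded 𝒜 𝒜) : SMulGraded 𝒜 (tensorDeg 𝒜 H) := by
  intro i j a x ha hx
  have : tensorDeg 𝒜 H j ≤ (tensorDeg 𝒜 H (i + j)).comap
      ((LinearMap.lsmul R (R ⊗[ℝ] N) a).restrictScalars ℝ) := by
    refine tensorDeg_le fun k l hkl x hx y hy => ?_
    change a • (x ⊗ₜ[ℝ] y) ∈ tensorDeg 𝒜 H (i + j)
    rw [TensorProduct.smul_tmul', smul_eq_mul]
    exact tmul_mem_tensorDeg (by linarith) (h𝒜 i k a x ha hx) hy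
  exact this hx

end TensorGrading

namespace ConeSystem

variable {V : Type u} [AddCommGroup V] [Module ℝ V] {Δ : Fan V} {F : ConeSystem Δ}

/-! ### Sections over the boundary of a cone -/

lemma IsGradedSheaf.smulGraded (hS : F.IsGradedSheaf) (γ : Δ.Cone) :
    SMulGraded (degA γ) (F.deg γ) := hS.smul_mem γ

lemma smulGraded_degBd (hS : F.IsGradedSheaf) (γ : Δ.Cone) :
    SMulGraded (degA γ) (F.degBd γ) := by
  intro i j a x ha hx τ
  exact hS.smul_mem τ.1 i j _ _ (resA_mem_degA _ ha) (hx τ)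

lemma resBd_mem (hS : F.IsGradedSheaf) {γ : Δ.Cone} {d : ℤ} {x : F.stalk γ} (hx : x ∈ F.deg γ d) :
    F.resBd hS γ x ∈ F.degBd γ d := fun τ => hS.res_mem _ d x hx

lemma resBd_eq_zero_iff (hS : F.IsGradedSheaf) {γ : Δ.Cone} {x : F.stalk γ} :
    F.resBd hS γ x = 0 ↔ x ∈ F.Rel γ := by
  constructor
  · intro h τ hτ
    exact congrFun (congrArg Subtype.val h) ⟨τ, hτ⟩
  · intro h
    exact Subtype.ext (funext fun τ => h τ.1 τ.2)

variable [FiniteDimensional ℝ V]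

lemma isInternal_degBd (hS : F.IsGradedSheaf) (γ : Δ.Cone) :
    DirectSum.IsInternal (F.degBd γ) := by
  classical
  let π : ℤ → F.Bd γ →ₗ[ℝ] F.Bd γ := fun d =>
    { toFun := fun x => ⟨fun τ => gproj (hS.isInternal τ.1) d (x.1 τ), fun τ τ' h => by
        rw [← gproj_comm_zero (hS.isInternal τ.1) (hS.isInternal τ'.1) _ (hS.res_mem h), x.2 τ τ' h]⟩
      map_add' := fun x y => Subtype.ext (funext fun τ => map_add _ _ _)
      map_smul' := fun c x => Subtype.ext (funext fun τ => map_smul _ _ _) }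
  have hπ : ∀ d x τ, (π d x).1 τ = gproj (hS.isInternal τ.1) d (x.1 τ) := fun d x τ => rfl
  refine isInternal_of_proj π ?_ ?_ ?_
  · intro d x hx
    exact Subtype.ext (funext fun τ => gproj_of_mem _ (hx τ))
  · intro d e x hx hne
    exact Subtype.ext (funext fun τ => gproj_of_mem_ne _ (hx τ) hne)
  · intro x
    have : Fintype (LowerSet.Iio γ) := Fintype.ofFinite _
    choose s hs using fun τ : LowerSet.Iio γ => exists_sum_gproj (hS.isInternal τ.1) (x.1 τ)
    have hx : x = ∑ d ∈ Finset.univ.biUnion s, π d x := by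
      refine Subtype.ext (funext fun τ => ?_)
      rw [AddSubmonoidClass.coe_finsetSum, Finset.sum_apply]
      exact (hs τ _ (Finset.subset_biUnion_of_mem s (Finset.mem_univ τ))).symm
    rw [hx]
    exact sum_mem fun d _ => Submodule.mem_iSup_of_mem d fun τ => gproj_mem _ _ _

/-- Boundary sections form a submodule of a finite product of stalks. These are finite over the
Noetherian ring `A γ` because `A γ` maps onto each `A τ`. -/
lemma finite_bd (γ : Δ.Cone) (hfin : ∀ τ < γ, Module.Finite (A τ) (F.stalk τ)) :
    Module.Finite (A γ) (F.Bd γ) := by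
  have : Fintype (LowerSet.Iio γ) := Fintype.ofFinite _
  let alg : ∀ τ : LowerSet.Iio γ, Algebra (A γ) (A τ.1) := fun τ => (resA (Bd.le τ)).toRingHom.toAlgebra
  let mod : ∀ τ : LowerSet.Iio γ, Module (A γ) (F.stalk τ.1) := fun τ =>
    Module.compHom _ (resA (Bd.le τ)).toRingHom
  have tow : ∀ τ : LowerSet.Iio γ, IsScalarTower (A γ) (A τ.1) (F.stalk τ.1) := fun τ =>
    ⟨fun a b x => by
      change (resA (Bd.le τ) a * b) • x = resA (Bd.le τ) a • (b • x)
      rw [mul_smul]⟩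
  have fin : ∀ τ : LowerSet.Iio γ, Module.Finite (A γ) (F.stalk τ.1) := fun τ => by
    have h1 := hfin τ.1 τ.2
    have h2 : Module.Finite (A γ) (A τ.1) :=
      Module.Finite.of_surjective (Algebra.linearMap (A γ) (A τ.1)) (resA_surjective (Bd.le τ))
    exact Module.Finite.trans (A τ.1) (F.stalk τ.1)
  let i : F.Bd γ →ₗ[A γ] (∀ τ : LowerSet.Iio γ, F.stalk τ.1) :=
    { toFun := fun x => x.1
      map_add' := fun x y => rfl
      map_smul' := fun a x => rfl }
  exact Module.Finite.of_injective i Subtype.val_injective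

/-! ### Reduction modulo the maximal ideal -/

lemma _root_.Fan.smul_sub_evalZero_smul_mem {γ : Δ.Cone} {X : Type*} [AddCommGroup X] [Module ℝ X]
    [Module (A γ) X] [IsScalarTower ℝ (A γ) X] (a : A γ) (x : X) :
    a • x - evalZero γ a • x ∈ (maxIdeal γ • ⊤ : Submodule (A γ) X) := by
  have : evalZero γ a • x = algebraMap ℝ (A γ) (evalZero γ a) • x := by
    rw [algebraMap_smul]
  rw [this, ← sub_smul]
  exact Submodule.smul_mem_smul (sub_evalZero_mem γ a) trivial

lemma _root_.Fan.finite_reduction {γ : Δ.Cone} {X : Type*} [AddCommGroup X] [Module ℝ X]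
    [Module (A γ) X] [IsScalarTower ℝ (A γ) X] [Module.Finite (A γ) X] :
    Module.Finite ℝ (X ⧸ (maxIdeal γ • ⊤ : Submodule (A γ) X)) := by
  classical
  obtain ⟨s, hs⟩ := Module.Finite.fg_top (R := A γ) (M := X)
  let q := Submodule.mkQ (maxIdeal γ • ⊤ : Submodule (A γ) X)
  refine ⟨⟨s.image q, eq_top_iff.mpr fun y _ => ?_⟩⟩
  obtain ⟨x, rfl⟩ := Submodule.mkQ_surjective _ y
  have hx : x ∈ Submodule.span (A γ) (s : Set X) := by rw [hs]; trivial
  change q x ∈ _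
  induction hx using Submodule.span_induction with
  | mem x hx => exact Submodule.subset_span (Finset.mem_coe.mpr (Finset.mem_image_of_mem q hx))
  | zero => rw [map_zero]; exact zero_mem _
  | add x y _ _ hx hy => rw [map_add]; exact add_mem (hx trivial) (hy trivial)
  | smul a x _ hx =>
    have h1 : q (a • x) = evalZero γ a • q x := by
      have h2 := smul_sub_evalZero_smul_mem a x
      rw [← Submodule.Quotient.mk_eq_zero, Submodule.Quotient.mk_sub, sub_eq_zero] at h2
      exact h2
    rw [h1]
    exact Submodule.smul_mem _ _ (hx trivial)

/-- The evaluation at the origin of the coefficients of an element of `A_γ ⊗ W`. -/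
def _root_.Fan.evalZeroTensor (γ : Δ.Cone) (W : Type*) [AddCommGroup W] [Module ℝ W] :
    A γ ⊗[ℝ] W →ₗ[ℝ] W :=
  TensorProduct.lift ((LinearMap.lsmul ℝ W) ∘ₗ (evalZero γ).toLinearMap)

lemma _root_.Fan.evalZeroTensor_tmul (γ : Δ.Cone) {W : Type*} [AddCommGroup W] [Module ℝ W]
    (a : A γ) (y : W) : evalZeroTensor γ W (a ⊗ₜ y) = evalZero γ a • y := rfl

lemma _root_.Fan.mem_of_evalZeroTensor_eq_zero {γ : Δ.Cone} {W : Type*} [AddCommGroup W]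
    [Module ℝ W] {t : A γ ⊗[ℝ] W} (ht : evalZeroTensor γ W t = 0) :
    t ∈ (maxIdeal γ • ⊤ : Submodule (A γ) (A γ ⊗[ℝ] W)) := by
  have h : ∀ t : A γ ⊗[ℝ] W, t - (1 : A γ) ⊗ₜ evalZeroTensor γ W t ∈
      (maxIdeal γ • ⊤ : Submodule (A γ) (A γ ⊗[ℝ] W)) := by
    intro t
    induction t using TensorProduct.induction_on with
    | zero => simp
    | add x y hx hy =>
      rw [map_add, TensorProduct.tmul_add]
      convert add_mem hx hy using 1
      abel
    | tmul a y =>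
      have h3 := smul_sub_evalZero_smul_mem (γ := γ) a ((1 : A γ) ⊗ₜ[ℝ] y)
      rw [TensorProduct.smul_tmul', smul_eq_mul, mul_one, ← TensorProduct.tmul_smul] at h3
      exact h3
  have := h t
  rwa [ht, TensorProduct.tmul_zero, sub_zero] at this

lemma redBd_smul (γ : Δ.Cone) (a : A γ) (x : F.Bd γ) :
    F.redBd γ (a • x) = evalZero γ a • F.redBd γ x := by
  have h2 := smul_sub_evalZero_smul_mem a x
  rw [← Submodule.Quotient.mk_eq_zero, Submodule.Quotient.mk_sub, sub_eq_zero] at h2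
  exact h2

lemma redBd_surjective (γ : Δ.Cone) : Function.Surjective (F.redBd γ) := by
  intro y
  obtain ⟨x, hx⟩ := Submodule.Quotient.mk_surjective _ y
  exact ⟨x, hx⟩

lemma redBd_eq_zero_iff {γ : Δ.Cone} {x : F.Bd γ} :
    F.redBd γ x = 0 ↔ x ∈ (maxIdeal γ • ⊤ : Submodule (A γ) (F.Bd γ)) :=
  Submodule.Quotient.mk_eq_zero _

lemma gproj_mem_maxIdeal_smul {γ : Δ.Cone} {X : Type*} [AddCommGroup X] [Module ℝ X]
    [Module (A γ) X] [IsScalarTower ℝ (A γ) X] {G : ℤ → Submodule ℝ X}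
    (hG : DirectSum.IsInternal G) (hs : SMulGraded (degA γ) G) (d : ℤ) {x : X}
    (hx : x ∈ (maxIdeal γ • ⊤ : Submodule (A γ) X)) :
    gproj hG d x ∈ (maxIdeal γ • ⊤ : Submodule (A γ) X) := by
  induction hx using Submodule.smul_induction_on' with
  | smul r hr n _ =>
    unfold maxIdeal at hr
    induction hr using Submodule.span_induction generalizing n with
    | mem s hs' =>
      obtain ⟨x, rfl⟩ := hs'
      rw [gproj_smul hG hs (lin_mem_degA γ x)]
      exact Submodule.smul_mem_smul (Ideal.subset_span ⟨x, rfl⟩) trivial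
    | zero => simp
    | add r r' _ _ h h' =>
      rw [add_smul, map_add]
      exact add_mem (h n trivial) (h' n trivial)
    | smul a r _ h =>
      rw [smul_eq_mul, mul_comm, mul_smul]
      exact h (a • n) trivial
  | add z _ z' _ h h' => rw [map_add]; exact add_mem h h'

lemma isInternal_degRedBd (hS : F.IsGradedSheaf) (γ : Δ.Cone) :
    DirectSum.IsInternal (F.degRedBd γ) := by
  refine IsInternal.map_of_ker (isInternal_degBd hS γ) (F.redBd γ) (redBd_surjective γ) ?_
  intro d x hx
  rw [redBd_eq_zero_iff] at hx ⊢
  exact gproj_mem_maxIdeal_smul _ (smulGraded_degBd hS γ) d hx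

/-! ### Simple sheaves are pure -/

/-- A minimal cone outside `Λ` has its whole boundary in `Λ`, so a section extends one cone at a
time. -/
lemma isFlabby_of_surjective (hS : F.IsGradedSheaf)
    (hsurj : ∀ γ, Function.Surjective (F.resBd hS γ)) : F.IsFlabby := by
  classical
  intro Λ
  induction hn : (Λ : Set Δ.Cone)ᶜ.ncard using Nat.strong_induction_on generalizing Λ with
  | _ n ih =>
  intro x
  by_cases hΛ : ∀ γ, γ ∈ Λ
  · exact ⟨⟨fun γ => x.1 ⟨γ.1, hΛ γ.1⟩, fun γ τ h => x.2 ⟨γ.1, hΛ γ.1⟩ ⟨τ.1, hΛ τ.1⟩ h⟩, fun γ => rfl⟩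
  push Not at hΛ
  obtain ⟨γ, hγ, hmin⟩ := Set.Finite.exists_minimal (Set.toFinite {γ : Δ.Cone | γ ∉ Λ}) hΛ
  have hlow : ∀ τ < γ, τ ∈ Λ := by
    intro τ hτ
    by_contra h
    exact hτ.not_ge (hmin h hτ.le)
  obtain ⟨y, hy⟩ := hsurj γ ⟨fun τ => x.1 ⟨τ.1, hlow τ.1 τ.2⟩,
    fun τ τ' h => x.2 ⟨τ.1, hlow τ.1 τ.2⟩ ⟨τ'.1, hlow τ'.1 τ'.2⟩ h⟩
  have hy' : ∀ (τ : Δ.Cone) (h : τ < γ), F.res h.le y = x.1 ⟨τ, hlow τ h⟩ := fun τ h =>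
    congrFun (congrArg Subtype.val hy) ⟨τ, h⟩
  let Λ' : LowerSet Δ.Cone := ⟨{δ | δ ∈ Λ ∨ δ = γ}, by
    rintro δ δ' hle (h | rfl)
    · exact Or.inl (Λ.lower hle h)
    · rcases hle.lt_or_eq with h | h
      · exact Or.inl (hlow δ' h)
      · exact Or.inr h⟩
  -- Outside `Λ` only the value `y` at γ matters; the zeros at other cones lie outside the enlarged
  -- subfan.
  let g : ∀ δ : Δ.Cone, F.stalk δ := fun δ => if h : δ ∈ Λ then x.1 ⟨δ, h⟩ else Pi.single γ y δ
  have hg : ∀ δ (h : δ ∈ Λ), g δ = x.1 ⟨δ, h⟩ := fun δ h => dif_pos h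
  have hgγ : g γ = y := by
    simp only [g]
    rw [dif_neg hγ, Pi.single_eq_same]
  let x' : F.Sec Λ' := ⟨fun δ => g δ.1, by
    rintro ⟨δ, hδ⟩ ⟨δ', hδ'⟩ hle
    change F.res hle (g δ) = g δ'
    change δ ∈ Λ ∨ δ = γ at hδ
    change δ ≥ δ' at hle
    rcases hδ with h | rfl
    · rw [hg δ h, hg δ' (Λ.lower hle h)]
      exact x.2 ⟨δ, h⟩ ⟨δ', Λ.lower hle h⟩ hle
    · rw [hgγ]
      rcases hle.lt_or_eq with h | rfl
      · rw [hg δ' (hlow δ' h)]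
        exact hy' δ' h
      · rw [hgγ, hS.res_refl]⟩
  obtain ⟨z, hz⟩ := ih (Λ' : Set Δ.Cone)ᶜ.ncard (by
    rw [← hn]
    refine Set.ncard_lt_ncard ⟨?_, fun h => ?_⟩ (Set.toFinite _)
    · exact Set.compl_subset_compl.mpr fun δ hδ => Or.inl hδ
    · exact h (show γ ∈ (Λ : Set Δ.Cone)ᶜ from hγ) (show γ ∈ Λ' from Or.inr rfl)) Λ' rfl x'
  exact ⟨z, fun δ => (hz ⟨δ.1, Or.inl δ.2⟩).trans (hg δ.1 δ.2)⟩

variable {L : ConeSystem Δ} {σ : Δ.Cone}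

lemma IsSimple.subsingleton_bd (hL : L.IsSimple σ) {γ : Δ.Cone} (h : ¬ σ < γ) :
    Subsingleton (L.Bd γ) := by
  refine ⟨fun x y => Subtype.ext (funext fun τ => ?_)⟩
  have := hL.outside τ.1 fun hle => h (lt_of_le_of_lt hle τ.2)
  exact Subsingleton.elim _ _

/-- Polynomial functions have no negative degrees, and by induction neither do boundary sections and
their reduction. This is the lower bound required by graded Nakayama. -/
lemma IsSimple.deg_of_neg (hL : L.IsSimple σ) (γ : Δ.Cone) (d : ℤ) (hd : d < 0) :
    L.deg γ d = ⊥ := by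
  induction hn : dim γ using Nat.strong_induction_on generalizing γ d with
  | _ n ih =>
  rw [eq_bot_iff]
  intro x hx
  rw [Submodule.mem_bot]
  by_cases h : σ ≤ γ
  · rcases h.eq_or_lt with rfl | h
    · obtain ⟨e, he⟩ := hL.center
      have h1 := (he d x).mpr hx
      rw [degA_of_neg _ d hd, Submodule.mem_bot] at h1
      exact e.map_eq_zero_iff.mp h1
    · obtain ⟨s, e, -, he, -⟩ := hL.extension γ h
      have h1 := (he d x).mpr hx
      have h2 : tensorDeg (degA γ) (L.degRedBd γ) d ≤ ⊥ := by
        refine tensorDeg_le fun i j hij a ha y hy => ?_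
        rw [Submodule.mem_bot]
        by_cases hi : i < 0
        · rw [degA_of_neg _ i hi, Submodule.mem_bot] at ha
          rw [ha, TensorProduct.zero_tmul]
        · obtain ⟨z, hz, rfl⟩ := hy
          have : z = 0 := Subtype.ext (funext fun τ => by
            have h3 := hz τ
            rw [ih (dim τ.1) (hn ▸ dim_lt τ.2) τ.1 j (by omega) rfl] at h3
            exact h3)
          rw [this, map_zero, TensorProduct.tmul_zero]
      exact e.map_eq_zero_iff.mp (h2 h1)
  · have := hL.outside γ h
    exact Subsingleton.elim _ _

lemma IsSimple.finite_stalk (hL : L.IsSimple σ) (γ : Δ.Cone) : Module.Finite (A γ) (L.stalk γ) := by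
  induction hn : dim γ using Nat.strong_induction_on generalizing γ with
  | _ n ih =>
  by_cases h : σ ≤ γ
  · rcases h.eq_or_lt with rfl | h
    · obtain ⟨e, he⟩ := hL.center
      exact Module.Finite.equiv e.symm
    · obtain ⟨s, e, -, he, -⟩ := hL.extension γ h
      have := finite_bd (F := L) γ fun τ hτ => ih (dim τ) (hn ▸ dim_lt hτ) τ rfl
      have : Module.Finite ℝ (L.RedBd γ) := finite_reduction
      exact Module.Finite.equiv e.symm
  · have := hL.outside γ h
    infer_instance

lemma IsSimple.free_stalk (hL : L.IsSimple σ) (γ : Δ.Cone) : Module.Free (A γ) (L.stalk γ) := by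
  by_cases h : σ ≤ γ
  · rcases h.eq_or_lt with rfl | h
    · obtain ⟨e, he⟩ := hL.center
      exact Module.Free.of_equiv e.symm
    · obtain ⟨s, e, -, he, -⟩ := hL.extension γ h
      exact Module.Free.of_equiv e.symm
  · have := hL.outside γ h
    exact Module.Free.of_subsingleton _ _

/-- The values of the section s lie in the image and represent every class modulo 𝔪, so graded
Nakayama applies. -/
lemma IsSimple.resBd_surjective (hL : L.IsSimple σ) (γ : Δ.Cone) :
    Function.Surjective (L.resBd hL.isGradedSheaf γ) := by
  by_cases h : σ < γ
  · have hS := hL.isGradedSheaf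
    obtain ⟨s, e, hs, he, hres⟩ := hL.extension γ h
    rw [← LinearMap.range_eq_top]
    refine eq_top_of_sup_smul_eq_top (isInternal_degBd hS γ) (smulGraded_degBd hS γ) (b := 0) ?_
      (maxIdeal_generators γ) ?_ ?_
    · intro d hd
      rw [eq_bot_iff]
      intro x hx
      rw [Submodule.mem_bot]
      refine Subtype.ext (funext fun τ => ?_)
      have h1 := hx τ
      rw [hL.deg_of_neg _ d hd] at h1
      exact h1
    · rintro d _ ⟨x, rfl⟩
      refine ⟨gproj (hS.isInternal γ) d x, ?_⟩
      exact (gproj_comm_zero (hS.isInternal γ) (isInternal_degBd hS γ)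
        ((L.resBd hS γ).restrictScalars ℝ) (fun d x hx => resBd_mem hS hx) d x).symm
    · rw [eq_top_iff]
      intro x _
      have h1 : x - s (L.redBd γ x) ∈ (maxIdeal γ • ⊤ : Submodule (A γ) (L.Bd γ)) := by
        rw [← redBd_eq_zero_iff, map_sub, hs, sub_self]
      refine Submodule.mem_sup.mpr ⟨s (L.redBd γ x), ⟨e.symm (1 ⊗ₜ L.redBd γ x), ?_⟩, _, h1, by abel⟩
      rw [hres, one_smul]
  · have := hL.subsingleton_bd h
    exact fun x => ⟨0, Subsingleton.elim _ _⟩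

/-- Sections vanishing on the boundary lie in `𝔪 L_γ`. -/
lemma IsSimple.rel_le (hL : L.IsSimple σ) {γ : Δ.Cone} (h : σ < γ) :
    L.Rel γ ≤ maxIdeal γ • ⊤ := by
  have hS := hL.isGradedSheaf
  obtain ⟨s, e, hs, he, hres⟩ := hL.extension γ h
  -- Restriction to the boundary followed by reduction is evaluation of the coefficients at the
  -- origin, whose kernel on A_γ ⊗ W is 𝔪 (A_γ ⊗ W).
  have h1 : ∀ t, L.redBd γ (L.resBd hS γ (e.symm t)) = evalZeroTensor γ _ t := by
    intro t
    induction t using TensorProduct.induction_on with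
    | zero => simp only [map_zero]
    | add x y hx hy => simp only [map_add, hx, hy]
    | tmul a y => rw [hres, redBd_smul, hs, evalZeroTensor_tmul]
  intro x hx
  have h4 : e x ∈ (maxIdeal γ • ⊤ : Submodule (A γ) (A γ ⊗[ℝ] L.RedBd γ)) := by
    refine mem_of_evalZeroTensor_eq_zero ?_
    rw [← h1, e.symm_apply_apply, (resBd_eq_zero_iff hS).mpr hx, map_zero]
  have h5 := Submodule.mem_map_of_mem (f := e.symm.toLinearMap) h4
  rw [Submodule.map_smul''] at h5
  have h6 : e.symm.toLinearMap (e x) = x := e.symm_apply_apply x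
  rw [h6] at h5
  exact Submodule.smul_mono le_rfl le_top h5

theorem IsSimple.isPure (hL : L.IsSimple σ) : L.IsPure where
  isGradedSheaf := hL.isGradedSheaf
  isFlabby := isFlabby_of_surjective hL.isGradedSheaf hL.resBd_surjective
  finite := hL.finite_stalk
  free := hL.free_stalk

end ConeSystem
end

/-! ### Gradings of function spaces and direct sums -/

noncomputable section
open Fan

/-- A grading of `M` induces a grading of the functions on a type with at most one element. -/
def funDeg (ι : Type*) {M : Type*} [AddCommGroup M] [Module ℝ M] (G : ℤ → Submodule ℝ M) (d : ℤ) :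
    Submodule ℝ (ι → M) := Submodule.pi Set.univ fun _ => G d

lemma mem_funDeg {ι M : Type*} [AddCommGroup M] [Module ℝ M] {G : ℤ → Submodule ℝ M} {d : ℤ}
    {f : ι → M} : f ∈ funDeg ι G d ↔ ∀ i, f i ∈ G d := by
  simp [funDeg]

lemma isInternal_funDeg {ι M : Type*} [Subsingleton ι] [AddCommGroup M] [Module ℝ M]
    {G : ℤ → Submodule ℝ M} (hG : DirectSum.IsInternal G) : DirectSum.IsInternal (funDeg ι G) := by
  refine isInternal_of_proj (fun d => (gproj hG d).compLeft ι) ?_ ?_ ?_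
  · intro d f hf
    exact funext fun i => gproj_of_mem hG (mem_funDeg.mp hf i)
  · intro d e f hf hne
    exact funext fun i => gproj_of_mem_ne hG (mem_funDeg.mp hf i) hne
  · intro f
    rcases isEmpty_or_nonempty ι with h | ⟨⟨i⟩⟩
    · rw [Subsingleton.elim f 0]; exact zero_mem _
    · obtain ⟨s, hs⟩ := exists_sum_gproj hG (f i)
      have hf : f = ∑ d ∈ s, (gproj hG d).compLeft ι f := by
        funext j
        rw [Finset.sum_apply, Subsingleton.elim j i]
        exact (hs s subset_rfl).symm
      rw [hf]
      exact sum_mem fun d _ => Submodule.mem_iSup_of_mem d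
        (mem_funDeg.mpr fun j => gproj_mem hG d _)

lemma isInternal_prod {M N : Type*} [AddCommGroup M] [Module ℝ M] [AddCommGroup N] [Module ℝ N]
    {G : ℤ → Submodule ℝ M} {H : ℤ → Submodule ℝ N} (hG : DirectSum.IsInternal G)
    (hH : DirectSum.IsInternal H) : DirectSum.IsInternal fun d => (G d).prod (H d) := by
  refine isInternal_of_proj (fun d => (gproj hG d).prodMap (gproj hH d)) ?_ ?_ ?_
  · rintro d ⟨x, y⟩ ⟨hx, hy⟩
    exact Prod.ext (gproj_of_mem hG hx) (gproj_of_mem hH hy)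
  · rintro d e ⟨x, y⟩ ⟨hx, hy⟩ hne
    exact Prod.ext (gproj_of_mem_ne hG hx hne) (gproj_of_mem_ne hH hy hne)
  · rintro ⟨x, y⟩
    have h : (x, y) = (x, 0) + ((0, y) : M × N) := by simp
    rw [h]
    refine add_mem ?_ ?_
    · induction x using IsInternal.induction hG with
      | zero => exact zero_mem _
      | add x x' hx hx' =>
        have := add_mem (hx (by simp)) (hx' (by simp))
        simpa using this
      | mem d x hx => exact Submodule.mem_iSup_of_mem d ⟨hx, zero_mem _⟩
    · induction y using IsInternal.induction hH with
      | zero => exact zero_mem _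
      | add x x' hx hx' =>
        have := add_mem (hx (by simp)) (hx' (by simp))
        simpa using this
      | mem d x hx => exact Submodule.mem_iSup_of_mem d ⟨zero_mem _, hx⟩

namespace ConeSystem

variable {V : Type u} [AddCommGroup V] [Module ℝ V] {Δ : Fan V}

/-! ### Attaching stalks along maps to the sections over the boundary -/

section Attach

variable (L : ConeSystem Δ) (W : Δ.Cone → Type u) [∀ δ, AddCommGroup (W δ)] [∀ δ, Module ℝ (W δ)]
  [∀ δ, Module (A δ) (W δ)] [∀ δ, IsScalarTower ℝ (A δ) (W δ)]
  (G : ∀ δ, ℤ → Submodule ℝ (W δ)) (b : ∀ δ, W δ →ₗ[A δ] L.Bd δ)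

open Classical in
/-- The value at a proper face of a section over the boundary. -/
def bdAt (τ δ : Δ.Cone) : L.Bd δ →ₗ[ℝ] L.stalk τ :=
  if h : τ < δ then LinearMap.proj (⟨τ, h⟩ : LowerSet.Iio δ) ∘ₗ (L.Sec (LowerSet.Iio δ)).subtype else 0

variable {L} in
lemma bdAt_of_lt {τ δ : Δ.Cone} (h : τ < δ) (x : L.Bd δ) : L.bdAt τ δ x = x.1 ⟨τ, h⟩ := by
  unfold bdAt
  rw [dif_pos h]; rfl

variable {L} in
lemma bdAt_of_not_lt {τ δ : Δ.Cone} (h : ¬ τ < δ) (x : L.Bd δ) : L.bdAt τ δ x = 0 := by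
  unfold bdAt
  rw [dif_neg h]; rfl

open Classical in
/-- The system with stalks `L_δ ⊕ W_δ`, where the restriction of `W_δ` to the proper faces of `δ`
is given by a map from `W_δ` to the sections of `L` over the boundary of `δ`. -/
def attach : ConeSystem Δ where
  stalk δ := L.stalk δ × W δ
  deg δ d := (L.deg δ d).prod (G δ d)
  res {τ δ} h := LinearMap.prod
    (L.res h ∘ₗ LinearMap.fst ℝ _ _ + L.bdAt τ δ ∘ₗ (b δ).restrictScalars ℝ ∘ₗ LinearMap.snd ℝ _ _)
    -- On the summand `W` this component is the identity for τ = δ and zero for a proper face;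
    -- conversely `bdAt` vanishes for τ = δ.
    (LinearMap.proj τ ∘ₗ LinearMap.single ℝ W δ ∘ₗ LinearMap.snd ℝ _ _)
  res_smul {τ δ} h a x := by
    refine Prod.ext ?_ ?_
    · change L.res h (a • x.1) + L.bdAt τ δ (b δ (a • x.2)) =
        resA h a • (L.res h x.1 + L.bdAt τ δ (b δ x.2))
      rw [L.res_smul, map_smul, smul_add]
      by_cases hlt : τ < δ
      · rw [bdAt_of_lt hlt, bdAt_of_lt hlt, Bd.smul_apply]
      · rw [bdAt_of_not_lt hlt, bdAt_of_not_lt hlt, smul_zero]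
    · change (Pi.single δ (a • x.2) : ∀ τ, W τ) τ = resA h a • (Pi.single δ x.2 : ∀ τ, W τ) τ
      by_cases e : τ = δ
      · subst e
        rw [Pi.single_eq_same, Pi.single_eq_same, resA_refl]
      · rw [Pi.single_eq_of_ne e, Pi.single_eq_of_ne e, smul_zero]

variable {L W G b}

open Classical in
lemma attach_res_self {δ : Δ.Cone} (h : δ ≤ δ) (x : (L.attach W G b).stalk δ) :
    (L.attach W G b).res h x = (L.res h x.1, x.2) := by
  refine Prod.ext ?_ ?_
  · change L.res h x.1 + L.bdAt δ δ (b δ x.2) = L.res h x.1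
    rw [bdAt_of_not_lt (lt_irrefl δ), add_zero]
  · change (Pi.single δ x.2 : ∀ τ, W τ) δ = x.2
    rw [Pi.single_eq_same]

open Classical in
lemma attach_res_lt {τ δ : Δ.Cone} (h : τ < δ) (x : (L.attach W G b).stalk δ) :
    (L.attach W G b).res h.le x = (L.res h.le x.1 + (b δ x.2).1 ⟨τ, h⟩, 0) := by
  refine Prod.ext ?_ ?_
  · change L.res h.le x.1 + L.bdAt τ δ (b δ x.2) = _
    rw [bdAt_of_lt h]
  · change (Pi.single δ x.2 : ∀ τ, W τ) τ = 0
    rw [Pi.single_eq_of_ne h.ne]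

/-- An attached element passes to a compatible family of sections of `L` on the proper faces and has
no attached component there, so nothing new happens on further restriction. -/
lemma attach_isGradedSheaf (hL : L.IsGradedSheaf) (hG : ∀ δ, DirectSum.IsInternal (G δ))
    (hsm : ∀ δ, SMulGraded (degA δ) (G δ)) (hb : ∀ δ d, ∀ w ∈ G δ d, b δ w ∈ L.degBd δ d) :
    (L.attach W G b).IsGradedSheaf where
  isInternal δ := isInternal_prod (hL.isInternal δ) (hG δ)
  smul_mem δ i j a x ha hx := ⟨hL.smul_mem δ i j a x.1 ha hx.1, hsm δ i j a x.2 ha hx.2⟩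
  res_mem {τ δ} h d x hx := by
    rcases h.eq_or_lt with rfl | h
    · rw [attach_res_self]
      exact ⟨hL.res_mem h d x.1 hx.1, hx.2⟩
    · rw [attach_res_lt h]
      exact ⟨add_mem (hL.res_mem h.le d x.1 hx.1) (hb δ d x.2 hx.2 ⟨τ, h⟩), zero_mem _⟩
  res_refl δ x := by
    rw [attach_res_self]
    exact Prod.ext (hL.res_refl δ x.1) rfl
  res_trans {γ τ δ} h h' x := by
    rcases h.eq_or_lt with rfl | h
    · rw [attach_res_self h]
      exact Prod.ext (hL.res_refl _ _) rfl
    rcases h'.eq_or_lt with rfl | h'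
    · rw [attach_res_self h']
      exact congrArg ((L.attach W G b).res h.le) (Prod.ext (hL.res_refl _ x.1) rfl)
    rw [attach_res_lt h', attach_res_lt (h.trans h')]
    refine (attach_res_lt h _).trans (Prod.ext ?_ rfl)
    change L.res h.le (L.res h'.le x.1 + (b δ x.2).1 ⟨τ, h'⟩) + (b τ 0).1 ⟨γ, h⟩ = _
    rw [map_zero, map_add, hL.res_trans, (b δ x.2).2 ⟨τ, h'⟩ ⟨γ, h.trans h'⟩ h.le]
    exact add_zero _

/-- Where nothing is attached, the stalk does not change. -/
def attachFst (W : Δ.Cone → Type u) [∀ δ, AddCommGroup (W δ)] [∀ δ, Module ℝ (W δ)]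
    [∀ δ, Module (A δ) (W δ)] [∀ δ, IsScalarTower ℝ (A δ) (W δ)]
    (G : ∀ δ, ℤ → Submodule ℝ (W δ)) (b : ∀ δ, W δ →ₗ[A δ] L.Bd δ) (δ : Δ.Cone)
    (h : Subsingleton (W δ)) : (L.attach W G b).stalk δ ≃ₗ[A δ] L.stalk δ where
  toFun x := x.1
  map_add' x y := rfl
  map_smul' a x := rfl
  invFun x := (x, 0)
  left_inv x := Prod.ext rfl (Subsingleton.elim _ _)
  right_inv x := rfl

lemma attachFst_mem (δ : Δ.Cone) (h : Subsingleton (W δ)) (d : ℤ) (x : (L.attach W G b).stalk δ) :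
    attachFst W G b δ h x ∈ L.deg δ d ↔ x ∈ (L.attach W G b).deg δ d := by
  refine ⟨fun hx => ⟨hx, ?_⟩, fun hx => hx.1⟩
  rw [Subsingleton.elim x.2 0]
  exact zero_mem (G δ d)

lemma attachFst_res (hL : L.IsGradedSheaf) {τ δ : Δ.Cone} (h : τ ≤ δ) (hτ : Subsingleton (W τ))
    (hδ : Subsingleton (W δ)) (x : (L.attach W G b).stalk δ) :
    attachFst W G b τ hτ ((L.attach W G b).res h x) = L.res h (attachFst W G b δ hδ x) := by
  rcases h.eq_or_lt with rfl | h
  · rw [attach_res_self]; rfl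
  · rw [attach_res_lt h]
    change L.res h.le x.1 + (b δ x.2).1 ⟨τ, h⟩ = L.res h.le x.1
    rw [show x.2 = 0 from Subsingleton.elim _ _, map_zero]
    exact add_zero _

end Attach

/-! ### Minimal extensions -/

/-- The condition on `L_γ` and its restriction to the boundary in the construction of simple
sheaves. -/
def HasExtension (L : ConeSystem Δ) (hS : L.IsGradedSheaf) (γ : Δ.Cone) : Prop :=
  ∃ (s : L.RedBd γ →ₗ[ℝ] L.Bd γ) (e : L.stalk γ ≃ₗ[A γ] A γ ⊗[ℝ] L.RedBd γ),
    (∀ y, L.redBd γ (s y) = y) ∧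
    (∀ (d : ℤ) (x : L.stalk γ), e x ∈ tensorDeg (degA γ) (L.degRedBd γ) d ↔ x ∈ L.deg γ d) ∧
    ∀ (a : A γ) (y : L.RedBd γ), L.resBd hS γ (e.symm (a ⊗ₜ y)) = a • s y

lemma exists_baseChange_equiv {γ : Δ.Cone} {N N' : Type u} [AddCommGroup N] [Module ℝ N]
    [AddCommGroup N'] [Module ℝ N'] (r : N ≃ₗ[ℝ] N') :
    ∃ q : A γ ⊗[ℝ] N ≃ₗ[A γ] A γ ⊗[ℝ] N',
      (∀ t, q t = TensorProduct.congr (LinearEquiv.refl ℝ (A γ)) r t) ∧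
      ∀ a y, q.symm (a ⊗ₜ y) = a ⊗ₜ r.symm y := by
  have hq : ∀ t, r.baseChange ℝ (A γ) _ _ t =
      TensorProduct.congr (LinearEquiv.refl ℝ (A γ)) r t := by
    intro t
    induction t using TensorProduct.induction_on with
    | zero => simp only [map_zero]
    | add x y hx hy => simp only [map_add, hx, hy]
    | tmul a y => rfl
  refine ⟨r.baseChange ℝ (A γ) _ _, hq, fun a y => ?_⟩
  rw [LinearEquiv.symm_apply_eq, hq, TensorProduct.congr_tmul, LinearEquiv.apply_symm_apply]
  rfl

lemma tensorDeg_map_mem_iff {M N N' : Type u} [AddCommGroup M] [Module ℝ M] [AddCommGroup N]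
    [Module ℝ N] [AddCommGroup N'] [Module ℝ N'] {G : ℤ → Submodule ℝ M} {H : ℤ → Submodule ℝ N}
    {H' : ℤ → Submodule ℝ N'} (r : N ≃ₗ[ℝ] N') (hr : ∀ d y, r y ∈ H' d ↔ y ∈ H d) (d : ℤ)
    (x : M ⊗[ℝ] N) :
    TensorProduct.congr (LinearEquiv.refl ℝ M) r x ∈ tensorDeg G H' d ↔ x ∈ tensorDeg G H d := by
  constructor
  · intro h
    have : tensorDeg G H' d ≤ (tensorDeg G H d).comap
        (TensorProduct.congr (LinearEquiv.refl ℝ M) r).symm.toLinearMap := by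
      refine tensorDeg_le fun i j hij x hx y hy => ?_
      rw [Submodule.mem_comap, LinearEquiv.coe_coe, TensorProduct.congr_symm_tmul]
      refine tmul_mem_tensorDeg hij hx ((hr j _).mp ?_)
      rwa [r.apply_symm_apply]
    have h1 := this h
    rwa [Submodule.mem_comap, LinearEquiv.coe_coe, LinearEquiv.symm_apply_apply] at h1
  · intro h
    have : tensorDeg G H d ≤ (tensorDeg G H' d).comap
        (TensorProduct.congr (LinearEquiv.refl ℝ M) r).toLinearMap := by
      refine tensorDeg_le fun i j hij x hx y hy => ?_
      rw [Submodule.mem_comap, LinearEquiv.coe_coe, TensorProduct.congr_tmul]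
      exact tmul_mem_tensorDeg hij hx ((hr j _).mpr hy)
    exact this h

section Transport

variable {L L' : ConeSystem Δ} {γ : Δ.Cone} (ε : ∀ τ, τ < γ → (L'.stalk τ ≃ₗ[A τ] L.stalk τ))
  (hnat : ∀ (τ' τ : Δ.Cone) (h : τ' ≤ τ) (hτ : τ < γ) (x : L'.stalk τ),
    ε τ' (h.trans_lt hτ) (L'.res h x) = L.res h (ε τ hτ x))

/-- Isomorphisms of the stalks at the proper faces of a cone induce an isomorphism of the sections
over the boundary. -/
def bdEquiv : L'.Bd γ ≃ₗ[A γ] L.Bd γ where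
  toFun x := ⟨fun τ => ε τ.1 τ.2 (x.1 τ), fun τ τ' h => by
    rw [← hnat τ'.1 τ.1 h τ.2, x.2 τ τ' h]⟩
  map_add' x y := Subtype.ext (funext fun τ => map_add _ _ _)
  map_smul' a x := Subtype.ext (funext fun τ => map_smul (ε τ.1 τ.2) _ _)
  invFun x := ⟨fun τ => (ε τ.1 τ.2).symm (x.1 τ), fun τ τ' h => by
    apply (ε τ'.1 τ'.2).injective
    rw [hnat τ'.1 τ.1 h τ.2, LinearEquiv.apply_symm_apply, LinearEquiv.apply_symm_apply, x.2 τ τ' h]⟩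
  left_inv x := Subtype.ext (funext fun τ => LinearEquiv.symm_apply_apply _ _)
  right_inv x := Subtype.ext (funext fun τ => LinearEquiv.apply_symm_apply _ _)

/-- The induced isomorphism of the reductions. -/
def redBdEquiv : L'.RedBd γ ≃ₗ[ℝ] L.RedBd γ :=
  (Submodule.Quotient.equiv _ _ (bdEquiv ε hnat) (by
    rw [Submodule.map_smul'', Submodule.map_top, LinearEquiv.range])).restrictScalars ℝ

lemma redBdEquiv_redBd (x : L'.Bd γ) :
    redBdEquiv ε hnat (L'.redBd γ x) = L.redBd γ (bdEquiv ε hnat x) := rfl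

/-- Apart from the stalk at γ, the condition involves the sheaf only over ∂γ. It can therefore be
checked with the old sheaf `L` when `L'` differs from it only at γ and beyond. -/
lemma hasExtension_of_equiv (hS' : L'.IsGradedSheaf)
    (hnat : ∀ (τ' τ : Δ.Cone) (h : τ' ≤ τ) (hτ : τ < γ) (x : L'.stalk τ),
      ε τ' (h.trans_lt hτ) (L'.res h x) = L.res h (ε τ hτ x))
    (hdeg : ∀ τ hτ d x, ε τ hτ x ∈ L.deg τ d ↔ x ∈ L'.deg τ d)
    (s : L.RedBd γ →ₗ[ℝ] L.Bd γ) (hs : ∀ y, L.redBd γ (s y) = y)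
    (e : L'.stalk γ ≃ₗ[A γ] A γ ⊗[ℝ] L.RedBd γ)
    (he : ∀ (d : ℤ) (x : L'.stalk γ), e x ∈ tensorDeg (degA γ) (L.degRedBd γ) d ↔ x ∈ L'.deg γ d)
    (hres : ∀ (a : A γ) (y : L.RedBd γ) (τ : Δ.Cone) (h : τ < γ),
      ε τ h (L'.res h.le (e.symm (a ⊗ₜ y))) = (a • s y).1 ⟨τ, h⟩) :
    L'.HasExtension hS' γ := by
  let B := bdEquiv ε hnat
  let r := redBdEquiv ε hnat
  have hr : ∀ x, r (L'.redBd γ x) = L.redBd γ (B x) := redBdEquiv_redBd ε hnat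
  have hB : ∀ d x, B x ∈ L.degBd γ d ↔ x ∈ L'.degBd γ d := fun d x =>
    forall_congr' fun τ => hdeg τ.1 τ.2 d (x.1 τ)
  have hrd : ∀ d y, r.symm y ∈ L'.degRedBd γ d ↔ y ∈ L.degRedBd γ d := by
    intro d y
    constructor
    · rintro ⟨x, hx, hxy⟩
      refine ⟨B x, (hB d x).mpr hx, ?_⟩
      rw [← hr, hxy, LinearEquiv.apply_symm_apply]
    · rintro ⟨x, hx, rfl⟩
      refine ⟨B.symm x, (hB d _).mp (by rwa [LinearEquiv.apply_symm_apply]), ?_⟩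
      rw [LinearEquiv.eq_symm_apply, hr, LinearEquiv.apply_symm_apply]
  obtain ⟨q, hq, hqs⟩ := exists_baseChange_equiv (γ := γ) r.symm
  refine ⟨(B.symm.restrictScalars ℝ).toLinearMap ∘ₗ s ∘ₗ r.toLinearMap, e.trans q, ?_, ?_, ?_⟩
  · intro y
    apply r.injective
    rw [hr]
    change L.redBd γ (B (B.symm (s (r y)))) = r y
    rw [LinearEquiv.apply_symm_apply, hs]
  · intro d x
    refine Iff.trans ?_ (he d x)
    rw [LinearEquiv.trans_apply, hq (e x)]
    exact tensorDeg_map_mem_iff r.symm hrd d (e x)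
  · intro a y
    apply B.injective
    rw [map_smul]
    change B (L'.resBd hS' γ (e.symm (q.symm (a ⊗ₜ y)))) = a • B (B.symm (s (r y)))
    refine Eq.trans ?_ (congrArg (a • ·) (B.apply_symm_apply (s (r y)))).symm
    have h1 : q.symm (a ⊗ₜ y) = a ⊗ₜ r y := hqs a y
    rw [h1]
    exact Subtype.ext (funext fun τ => hres a (r y) τ.1 τ.2)

end Transport

end ConeSystem
end

noncomputable section
open Fan

lemma smulGraded_funDeg {R ι M : Type*} [CommRing R] [Algebra ℝ R] {𝒜 : ℤ → Submodule ℝ R}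
    [AddCommGroup M] [Module ℝ M] [Module R M] {G : ℤ → Submodule ℝ M} (h : SMulGraded 𝒜 G) :
    SMulGraded 𝒜 (funDeg ι G) := fun i j a f ha hf =>
  mem_funDeg.mpr fun k => h i j a (f k) ha (mem_funDeg.mp hf k)

namespace ConeSystem

variable {V : Type u} [AddCommGroup V] [Module ℝ V] {Δ : Fan V}

/-! ### Existence of simple sheaves -/

variable (Δ) in
/-- The zero sheaf. -/
def zeroSystem : ConeSystem Δ where
  stalk _ := PUnit
  deg _ _ := ⊤
  res _ := 0
  res_smul _ _ _ := rfl

lemma zeroSystem_isGradedSheaf : (zeroSystem Δ).IsGradedSheaf where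
  isInternal σ := isInternal_of_proj (M := PUnit) (G := fun _ => ⊤) (fun _ => 0) (fun _ _ _ => rfl)
    (fun _ _ _ _ _ => rfl) (fun x => by rw [Subsingleton.elim x 0]; exact zero_mem _)
  smul_mem _ _ _ _ _ _ _ := trivial
  res_mem _ _ _ _ := trivial
  res_refl _ _ := rfl
  res_trans _ _ _ := rfl

variable [FiniteDimensional ℝ V]

/-- The restriction of the simple sheaf of `σ` to the cones of dimension at most `n`, extended by
zero. -/
structure IsSimpleUpTo (σ : Δ.Cone) (n : ℕ) (L : ConeSystem Δ) : Prop where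
  isGradedSheaf : L.IsGradedSheaf
  outside : ∀ γ : Δ.Cone, ¬ σ ≤ γ → Subsingleton (L.stalk γ)
  center : ∃ e : L.stalk σ ≃ₗ[A σ] A σ, ∀ (d : ℤ) (x : L.stalk σ), e x ∈ degA σ d ↔ x ∈ L.deg σ d
  extension : ∀ γ : Δ.Cone, σ < γ → dim γ ≤ n → L.HasExtension isGradedSheaf γ
  above : ∀ γ : Δ.Cone, n < dim γ → Subsingleton (L.stalk γ)

/-- `A σ` is attached to the zero sheaf at σ alone: functions on proofs of δ = σ form `A δ` at σ and
zero elsewhere. The extension condition is void in dimensions up to that of σ. -/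
lemma exists_isSimpleUpTo_dim (σ : Δ.Cone) : ∃ L : ConeSystem Δ, IsSimpleUpTo σ (dim σ) L := by
  let W : Δ.Cone → Type u := fun δ => PLift (δ = σ) → A δ
  let G : ∀ δ, ℤ → Submodule ℝ (W δ) := fun δ => funDeg _ (degA δ)
  have hW : ∀ δ, δ ≠ σ → Subsingleton (W δ) := fun δ h =>
    ⟨fun f g => funext fun p => (h p.down).elim⟩
  have hZ : ∀ δ, Subsingleton ((zeroSystem Δ).stalk δ) := fun δ =>
    inferInstanceAs (Subsingleton PUnit)
  have hsub : ∀ γ, γ ≠ σ → Subsingleton (((zeroSystem Δ).attach W G fun _ => 0).stalk γ) := by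
    intro γ h
    have := hW γ h
    have := hZ γ
    exact inferInstanceAs (Subsingleton ((zeroSystem Δ).stalk γ × W γ))
  refine ⟨(zeroSystem Δ).attach W G fun _ => 0, ?_, ?_, ?_, ?_, ?_⟩
  · refine attach_isGradedSheaf zeroSystem_isGradedSheaf (fun δ => isInternal_funDeg (isInternal_degA δ))
      (fun δ => smulGraded_funDeg (smulGraded_degA δ)) fun δ d w _ τ => trivial
  · exact fun γ h => hsub γ fun e => h e.ge
  · refine ⟨
      { toFun := fun x => x.2 ⟨rfl⟩
        map_add' := fun x y => rfl
        map_smul' := fun a x => rfl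
        invFun := fun a => (PUnit.unit, fun _ => a)
        left_inv := fun x => rfl
        right_inv := fun a => rfl }, fun d x => ?_⟩
    refine ⟨fun h => ⟨trivial, mem_funDeg.mpr fun p => h⟩, fun h => mem_funDeg.mp h.2 ⟨rfl⟩⟩
  · intro γ h hd
    exact absurd (dim_lt h) (not_lt.mpr hd)
  · exact fun γ h => hsub γ fun e => by rw [e] at h; exact lt_irrefl _ h

/-- All cones of dimension n + 1 can be treated at once, since the boundary of each of them only
involves old stalks. -/
lemma IsSimpleUpTo.attach {σ : Δ.Cone} {n : ℕ} (hn : dim σ ≤ n) {L : ConeSystem Δ}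
    (hL : IsSimpleUpTo σ n L) {W : Δ.Cone → Type u} [∀ δ, AddCommGroup (W δ)]
    [∀ δ, Module ℝ (W δ)] [∀ δ, Module (A δ) (W δ)] [∀ δ, IsScalarTower ℝ (A δ) (W δ)]
    {G : ∀ δ, ℤ → Submodule ℝ (W δ)} {b : ∀ δ, W δ →ₗ[A δ] L.Bd δ}
    (hS' : (L.attach W G b).IsGradedSheaf) {P : Δ.Cone → Prop}
    (hP : ∀ δ, P δ ↔ dim δ = n + 1 ∧ σ < δ) (hW : ∀ δ, ¬ P δ → Subsingleton (W δ))
    {s : ∀ δ, L.RedBd δ →ₗ[ℝ] L.Bd δ} (hs : ∀ δ y, L.redBd δ (s δ y) = y)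
    (e : ∀ δ, P δ → W δ ≃ₗ[A δ] A δ ⊗[ℝ] L.RedBd δ)
    (he : ∀ δ h d w, e δ h w ∈ tensorDeg (degA δ) (L.degRedBd δ) d ↔ w ∈ G δ d)
    (hb : ∀ δ h a y, b δ ((e δ h).symm (a ⊗ₜ y)) = a • s δ y) :
    IsSimpleUpTo σ (n + 1) (L.attach W G b) := by
  have hS := hL.isGradedSheaf
  have hsub : ∀ γ, Subsingleton (L.stalk γ) → ¬ P γ → Subsingleton ((L.attach W G b).stalk γ) := by
    intro γ h h'
    have := hW γ h'
    exact inferInstanceAs (Subsingleton (L.stalk γ × W γ))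
  have hlow : ∀ γ, dim γ ≤ n → ¬ P γ := fun γ h h' => by have := ((hP γ).mp h').1; omega
  refine ⟨hS', ?_, ?_, ?_, ?_⟩
  · exact fun γ h => hsub γ (hL.outside γ h) fun h' => h ((hP γ).mp h').2.le
  · obtain ⟨e, he⟩ := hL.center
    have hσ := hW σ (hlow σ hn)
    refine ⟨(attachFst W G b σ hσ).trans e, fun d x => ?_⟩
    rw [LinearEquiv.trans_apply, he, attachFst_mem]
  · intro γ hγ hd
    have hlt : ∀ τ, τ < γ → Subsingleton (W τ) := fun τ hτ => hW τ (hlow τ (by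
      have := dim_lt hτ
      omega))
    -- In dimension n + 1 the old stalk is zero, so the new one is `W γ`; in lower dimensions
    -- nothing was attached and the old extension data are transported.
    rcases Nat.lt_or_ge n (dim γ) with hd' | hd'
    · have hPγ : P γ := (hP γ).mpr ⟨by omega, hγ⟩
      have hsing := hL.above γ hd'
      let q : (L.attach W G b).stalk γ ≃ₗ[A γ] W γ :=
        { toFun := fun x => x.2
          map_add' := fun x y => rfl
          map_smul' := fun a x => rfl
          invFun := fun t => (0, t)
          left_inv := fun x => Prod.ext (Subsingleton.elim _ _) rfl
          right_inv := fun a => rfl }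
      have hqd : ∀ d x, q x ∈ G γ d ↔ x ∈ (L.attach W G b).deg γ d := by
        refine fun d x => ⟨fun h => ⟨?_, h⟩, fun h => h.2⟩
        rw [Subsingleton.elim x.1 0]
        exact zero_mem (L.deg γ d)
      have hqr : ∀ (τ : Δ.Cone) (h : τ < γ) (w : W γ), attachFst W G b τ (hlt τ h)
          ((L.attach W G b).res h.le (q.symm w)) = (b γ w).1 ⟨τ, h⟩ := by
        intro τ h w
        rw [attach_res_lt h]
        change L.res h.le 0 + (b γ w).1 ⟨τ, h⟩ = _
        rw [map_zero, zero_add]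
      refine hasExtension_of_equiv (fun τ hτ => attachFst W G b τ (hlt τ hτ)) hS'
        (fun τ' τ h hτ x => attachFst_res hS h _ _ x) (fun τ hτ d x => attachFst_mem τ _ d x)
        (s γ) (hs γ) (q.trans (e γ hPγ)) (fun d x => ?_) (fun a y τ h => ?_)
      · rw [LinearEquiv.trans_apply, he, hqd]
      · rw [LinearEquiv.symm_trans_apply, hqr, hb]
    · obtain ⟨s', e', hs', he', hres⟩ := hL.extension γ hγ hd'
      have hWγ := hW γ (hlow γ hd')
      refine hasExtension_of_equiv (fun τ hτ => attachFst W G b τ (hlt τ hτ)) hS'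
        (fun τ' τ h hτ x => attachFst_res hS h _ _ x) (fun τ hτ d x => attachFst_mem τ _ d x)
        s' hs' ((attachFst W G b γ hWγ).trans e') (fun d x => ?_) (fun a y τ h => ?_)
      · rw [LinearEquiv.trans_apply, he', attachFst_mem]
      · rw [attachFst_res hS h.le _ hWγ, LinearEquiv.symm_trans_apply,
          LinearEquiv.apply_symm_apply, ← hres]
        rfl
  · refine fun γ h => hsub γ (hL.above γ (by omega)) fun h' => ?_
    have := ((hP γ).mp h').1
    omega

/-- Functions on the proofs of a true proposition are elements. -/
def pliftFunEquiv (R : Type*) [CommRing R] {p : Prop} (h : p) (M : Type*) [AddCommGroup M]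
    [Module R M] : (PLift p → M) ≃ₗ[R] M where
  toFun f := f ⟨h⟩
  map_add' _ _ := rfl
  map_smul' _ _ := rfl
  invFun x _ := x
  left_inv _ := rfl
  right_inv _ := rfl

-- The reduction map has a section of degree zero because both gradings are internal. Its A-linear
-- extension a ⊗ y ↦ a s(y) is the attaching map.
open Classical in
lemma IsSimpleUpTo.succ {σ : Δ.Cone} {n : ℕ} (hn : dim σ ≤ n) {L : ConeSystem Δ}
    (hL : IsSimpleUpTo σ n L) : ∃ L' : ConeSystem Δ, IsSimpleUpTo σ (n + 1) L' := by
  have hS := hL.isGradedSheaf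
  choose s hs hsd using fun γ => exists_graded_section (isInternal_degBd hS γ)
    (isInternal_degRedBd hS γ) (L.redBd γ) (fun d x hx => ⟨x, hx, rfl⟩) (redBd_surjective γ)
  have hlift : ∀ δ d, ∀ t ∈ tensorDeg (degA δ) (L.degRedBd δ) d,
      (s δ).liftBaseChange (A δ) t ∈ L.degBd δ d := by
    intro δ d t ht
    have h2 : tensorDeg (degA δ) (L.degRedBd δ) d ≤ (L.degBd δ d).comap
        (((s δ).liftBaseChange (A δ)).restrictScalars ℝ) := by
      refine tensorDeg_le fun i j hij a ha y hy => ?_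
      rw [Submodule.mem_comap, LinearMap.restrictScalars_apply, LinearMap.liftBaseChange_tmul, ← hij]
      exact smulGraded_degBd hS δ i j a _ ha (hsd δ j y hy)
    exact h2 ht
  let P : Δ.Cone → Prop := fun δ => dim δ = n + 1 ∧ σ < δ
  let b : ∀ δ, (PLift (P δ) → A δ ⊗[ℝ] L.RedBd δ) →ₗ[A δ] L.Bd δ := fun δ =>
    if h : P δ then (s δ).liftBaseChange (A δ) ∘ₗ (pliftFunEquiv (A δ) h _).toLinearMap else 0
  have hb : ∀ δ (h : P δ) w, b δ w = (s δ).liftBaseChange (A δ) (w ⟨h⟩) := by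
    intro δ h w
    simp only [b]
    rw [dif_pos h]
    rfl
  have hb0 : ∀ δ, ¬ P δ → b δ = 0 := fun δ h => dif_neg h
  refine ⟨_, hL.attach hn (W := fun δ => PLift (P δ) → A δ ⊗[ℝ] L.RedBd δ)
    (G := fun δ => funDeg _ (tensorDeg (degA δ) (L.degRedBd δ))) (b := b) (P := P) (s := s) ?_
    (fun δ => Iff.rfl) (fun δ h => ⟨fun f g => funext fun p => (h p.down).elim⟩) hs
    (fun δ h => pliftFunEquiv (A δ) h _) ?_ ?_⟩
  · refine attach_isGradedSheaf hS
      (fun δ => isInternal_funDeg (isInternal_tensorDeg (isInternal_degA δ) (isInternal_degRedBd hS δ)))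
      (fun δ => smulGraded_funDeg (smulGraded_tensorDeg (smulGraded_degA δ))) ?_
    intro δ d w hw
    by_cases h : P δ
    · rw [hb δ h]
      exact hlift δ d _ (mem_funDeg.mp hw ⟨h⟩)
    · rw [hb0 δ h]
      exact zero_mem (L.degBd δ d)
  · exact fun δ h d w => ⟨fun hw => mem_funDeg.mpr fun p => hw, fun hw => mem_funDeg.mp hw ⟨h⟩⟩
  · intro δ h a y
    rw [hb δ h]
    exact LinearMap.liftBaseChange_tmul _ _ _ _

theorem exists_isSimple (σ : Δ.Cone) : ∃ L : ConeSystem Δ, L.IsSimple σ := by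
  have key : ∀ k : ℕ, ∃ L : ConeSystem Δ, IsSimpleUpTo σ (dim σ + k) L := by
    intro k
    induction k with
    | zero => exact exists_isSimpleUpTo_dim σ
    | succ k ih =>
      obtain ⟨L, hL⟩ := ih
      exact hL.succ (Nat.le_add_right _ _)
  obtain ⟨L, hL⟩ := key (Module.finrank ℝ V)
  refine ⟨L, hL.isGradedSheaf, hL.outside, hL.center, fun γ hγ => hL.extension γ hγ ?_⟩
  exact (Submodule.finrank_le _).trans (Nat.le_add_left _ _)

end ConeSystem
end

noncomputable section
open Fan

/-! ### Gradings of spaces of forms -/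

section GradedForms

variable {R : Type*} [CommRing R] [Algebra ℝ R] {𝒜 : ℤ → Submodule ℝ R}
  {X : Type*} [AddCommGroup X] [Module ℝ X] [Module R X] [IsScalarTower ℝ R X]
  {G : ℤ → Submodule ℝ X}

lemma exists_homogeneous_generators (hG : DirectSum.IsInternal G) [Module.Finite R X] :
    ∃ s : Finset X, (∀ x ∈ s, ∃ d, x ∈ G d) ∧ Submodule.span R (s : Set X) = ⊤ := by
  classical
  obtain ⟨s, hs⟩ := Module.Finite.fg_top (R := R) (M := X)
  choose t ht using exists_sum_gproj hG
  refine ⟨s.biUnion fun x => (t x).image fun d => gproj hG d x, ?_, ?_⟩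
  · intro y hy
    obtain ⟨x, hx, hy⟩ := Finset.mem_biUnion.mp hy
    obtain ⟨d, hd, rfl⟩ := Finset.mem_image.mp hy
    exact ⟨d, gproj_mem hG d x⟩
  · rw [eq_top_iff, ← hs, Submodule.span_le]
    intro x hx
    rw [← ht x (t x) subset_rfl]
    refine sum_mem fun d hd => Submodule.subset_span ?_
    exact Finset.mem_coe.mpr (Finset.mem_biUnion.mpr ⟨x, hx, Finset.mem_image_of_mem _ hd⟩)

variable (𝒜 G) in
/-- The forms of degree `k` on a graded module. -/
def homDeg (k : ℤ) : Submodule ℝ (X →ₗ[R] R) where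
  carrier := {f | ∀ (j : ℤ) (x : X), x ∈ G j → f x ∈ 𝒜 (j + k)}
  add_mem' hf hg j x hx := add_mem (hf j x hx) (hg j x hx)
  zero_mem' j x hx := zero_mem _
  smul_mem' c f hf j x hx := Submodule.smul_mem _ c (hf j x hx)

lemma gcompLin_apply (hA : DirectSum.IsInternal 𝒜) (hsA : SMulGraded 𝒜 𝒜)
    (hG : DirectSum.IsInternal G) (hsG : SMulGraded 𝒜 G) (f : X →ₗ[R] R) (k : ℤ) {j : ℤ} {x : X}
    (hx : x ∈ G j) : gcompLin hA hG hsG hA hsA f k x = gproj hA (j + k) (f x) :=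
  gcomp_of_mem hG hA (f.restrictScalars ℝ) k hx

/-- A form is determined by its values on finitely many homogeneous generators, so it is a finite
sum of its homogeneous parts; this is where finite generation enters. -/
lemma isInternal_homDeg (hA : DirectSum.IsInternal 𝒜) (hsA : SMulGraded 𝒜 𝒜)
    (hG : DirectSum.IsInternal G) (hsG : SMulGraded 𝒜 G) [Module.Finite R X] :
    DirectSum.IsInternal (homDeg 𝒜 G) := by
  classical
  have hval := fun (f : X →ₗ[R] R) (k : ℤ) {j : ℤ} {x : X} (hx : x ∈ G j) =>
    gcompLin_apply hA hsA hG hsG f k hx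
  have hext : ∀ f g : X →ₗ[R] R, (∀ j, ∀ x ∈ G j, f x = g x) → f = g := by
    intro f g h
    refine LinearMap.ext fun x => ?_
    induction x using IsInternal.induction hG with
    | zero => simp
    | add x y hx hy => rw [map_add, map_add, hx, hy]
    | mem d x hx => exact h d x hx
  let π : ℤ → (X →ₗ[R] R) →ₗ[ℝ] (X →ₗ[R] R) := fun k =>
    { toFun := fun f => gcompLin hA hG hsG hA hsA f k
      map_add' := fun f g => hext _ _ fun j x hx => by
        rw [LinearMap.add_apply, hval _ _ hx, hval _ _ hx, hval _ _ hx, LinearMap.add_apply, map_add]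
      map_smul' := fun c f => hext _ _ fun j x hx => by
        rw [RingHom.id_apply, LinearMap.smul_apply, hval _ _ hx, hval _ _ hx, LinearMap.smul_apply,
          map_smul] }
  have hπ : ∀ k f, π k f = gcompLin hA hG hsG hA hsA f k := fun k f => rfl
  refine isInternal_of_proj π ?_ ?_ ?_
  · intro k f hf
    refine hext _ _ fun j x hx => ?_
    rw [hπ, hval f k hx, gproj_of_mem hA (hf j x hx)]
  · intro k l f hf hne
    refine hext _ _ fun j x hx => ?_
    rw [hπ, hval f k hx, gproj_of_mem_ne hA (hf j x hx) fun h => hne (by linarith),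
      LinearMap.zero_apply]
  · intro f
    obtain ⟨s, hs, hspan⟩ := exists_homogeneous_generators (R := R) hG
    choose d hd using hs
    choose t ht using fun x => exists_sum_gproj hA (f x)
    -- The degrees of `f` that can occur: e - d(x) for a generator `x` of degree d(x) and a degree e
    -- occurring in f(x).
    let K : Finset ℤ := s.attach.biUnion fun x => (t x.1).image fun e => e - d x.1 x.2
    have hf : f = ∑ k ∈ K, π k f := by
      refine LinearMap.ext_on hspan fun x hx => ?_
      have hx' : x ∈ s := hx
      rw [LinearMap.sum_apply]
      have h1 : ∑ k ∈ K, π k f x = ∑ k ∈ K, gproj hA (d x hx' + k) (f x) :=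
        Finset.sum_congr rfl fun k _ => hval f k (hd x hx')
      have h2 : ∑ k ∈ K, gproj hA (d x hx' + k) (f x) =
          ∑ e ∈ K.image fun k => d x hx' + k, gproj hA e (f x) := by
        rw [Finset.sum_image]
        intro a _ b _ h
        simpa using h
      rw [h1, h2, ht x]
      intro e he
      refine Finset.mem_image.mpr ⟨e - d x hx', ?_, by ring⟩
      exact Finset.mem_biUnion.mpr ⟨⟨x, hx'⟩, Finset.mem_attach _ _, Finset.mem_image_of_mem _ he⟩
    rw [hf]
    refine sum_mem fun k _ => Submodule.mem_iSup_of_mem k fun j x hx => ?_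
    rw [hπ, hval f k hx]
    exact gproj_mem hA _ _

lemma smulGraded_homDeg (hsA : SMulGraded 𝒜 𝒜) : SMulGraded 𝒜 (homDeg 𝒜 G) := by
  intro i j a f ha hf k x hx
  have := hsA i (k + j) a (f x) ha (hf k x hx)
  rw [show k + (i + j) = i + (k + j) by ring]
  exact this

end GradedForms

/-! ### Tensor products with a line -/

section Line

variable {R : Type*} [CommRing R] [Algebra ℝ R] {X : Type u} [AddCommGroup X] [Module ℝ X]
  [Module R X] [IsScalarTower ℝ R X] {N : Type u} [AddCommGroup N] [Module ℝ N]

lemma exists_tmul_equiv {ω : N} (h0 : ω ≠ 0) (hspan : ∀ y, ∃ c : ℝ, y = c • ω) :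
    ∃ e : X ≃ₗ[R] X ⊗[ℝ] N, ∀ x, e x = x ⊗ₜ ω := by
  let c : ℝ ≃ₗ[ℝ] N := LinearEquiv.ofBijective (LinearMap.toSpanSingleton ℝ N ω)
    ⟨(injective_iff_map_eq_zero _).mpr fun r hr => (smul_eq_zero.mp hr).resolve_right h0, fun y => by
      obtain ⟨r, hr⟩ := hspan y
      exact ⟨r, hr.symm⟩⟩
  refine ⟨(TensorProduct.AlgebraTensorModule.rid ℝ R X).symm.trans
    (TensorProduct.AlgebraTensorModule.congr (LinearEquiv.refl R X) c), fun x => ?_⟩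
  rw [LinearEquiv.trans_apply, TensorProduct.AlgebraTensorModule.rid_symm_apply,
    TensorProduct.AlgebraTensorModule.congr_tmul]
  change x ⊗ₜ[ℝ] ((1 : ℝ) • ω) = _
  rw [one_smul]

lemma tmul_mem_tensorDeg_iff {ω : N} (h0 : ω ≠ 0) (hspan : ∀ y, ∃ c : ℝ, y = c • ω)
    {G : ℤ → Submodule ℝ X} {k d : ℤ} {x : X} :
    x ⊗ₜ[ℝ] ω ∈ tensorDeg G (concentrated N k) d ↔ x ∈ G (d - k) := by
  obtain ⟨e, he⟩ := exists_tmul_equiv (R := ℝ) (X := X) h0 hspan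
  have h1 : tensorDeg G (concentrated N k) d ≤ (G (d - k)).map e.toLinearMap := by
    refine tensorDeg_le fun i j hij x hx y hy => ?_
    unfold concentrated at hy
    split_ifs at hy with hj
    · obtain ⟨c, rfl⟩ := hspan y
      refine ⟨c • x, Submodule.smul_mem _ c ?_, ?_⟩
      · rwa [show d - k = i by linarith]
      · rw [LinearEquiv.coe_coe, he, TensorProduct.smul_tmul]
    · rw [Submodule.mem_bot] at hy
      rw [hy, TensorProduct.tmul_zero]
      exact zero_mem _
  constructor
  · intro h
    obtain ⟨y, hy, hyx⟩ := h1 h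
    rw [LinearEquiv.coe_coe, he, ← he x, ← he y] at hyx
    rwa [← e.injective hyx]
  · intro h
    refine tmul_mem_tensorDeg (sub_add_cancel d k) h ?_
    simp [concentrated]

end Line

namespace ConeSystem

variable {V : Type u} [AddCommGroup V] [Module ℝ V] {Δ : Fan V} {F G H : ConeSystem Δ}

/-! ### Isomorphisms of sheaves -/

/-- The inverse of an isomorphism. -/
def Iso.symm (φ : Iso F G) : Iso G F where
  equiv σ := (φ.equiv σ).symm
  mem_iff σ d x := by rw [← φ.mem_iff, LinearEquiv.apply_symm_apply]
  naturality {τ σ} h x := by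
    rw [LinearEquiv.symm_apply_eq, φ.naturality, LinearEquiv.apply_symm_apply]

/-- The composition of isomorphisms. -/
def Iso.trans (φ : Iso F G) (ψ : Iso G H) : Iso F H where
  equiv σ := (φ.equiv σ).trans (ψ.equiv σ)
  mem_iff σ d x := by rw [LinearEquiv.trans_apply, ψ.mem_iff, φ.mem_iff]
  naturality {τ σ} h x := by
    rw [LinearEquiv.trans_apply, LinearEquiv.trans_apply, φ.naturality, ψ.naturality]

lemma Iso.isGradedSheaf (φ : Iso F G) (hF : F.IsGradedSheaf) : G.IsGradedSheaf where
  isInternal σ := by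
    have := IsInternal.of_equiv (hF.isInternal σ) ((φ.equiv σ).restrictScalars ℝ) (φ.mem_iff σ)
    exact this
  smul_mem σ i j a x ha hx := by
    rw [← φ.symm.mem_iff] at hx ⊢
    rw [map_smul]
    exact hF.smul_mem σ i j a _ ha hx
  res_mem {τ σ} h d x hx := by
    rw [← φ.symm.mem_iff] at hx ⊢
    rw [φ.symm.naturality]
    exact hF.res_mem h d _ hx
  res_refl σ x := by
    apply (φ.symm.equiv σ).injective
    rw [φ.symm.naturality, hF.res_refl]
  res_trans {γ τ σ} h h' x := by
    apply (φ.symm.equiv γ).injective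
    rw [φ.symm.naturality, φ.symm.naturality, φ.symm.naturality, hF.res_trans]

variable (F) in
/-- The sheaf `F` with the degrees raised by `k`. -/
def shift (k : ℤ) : ConeSystem Δ where
  stalk := F.stalk
  deg σ d := F.deg σ (d - k)
  res := F.res
  res_smul := F.res_smul

variable (F) in
/-- The tensor product with a line in degree `k` is a shift. -/
lemma nonempty_shift_iso_tensor {N : Type u} [AddCommGroup N] [Module ℝ N] {ω : N} (h0 : ω ≠ 0)
    (hspan : ∀ y, ∃ c : ℝ, y = c • ω) (k : ℤ) :
    Nonempty (Iso (F.shift k) (F.tensor N (concentrated N k))) := by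
  choose e he using fun σ : Δ.Cone => exists_tmul_equiv (R := A σ) (X := F.stalk σ) h0 hspan
  refine ⟨⟨e, fun σ d x => ?_, fun {τ σ} h x => ?_⟩⟩
  · have key : ∀ x : F.stalk σ, e σ x ∈ tensorDeg (F.deg σ) (concentrated N k) d ↔
        x ∈ F.deg σ (d - k) := fun x => by
      rw [he σ x]
      exact tmul_mem_tensorDeg_iff h0 hspan
    exact key x
  · refine (he τ (F.res h x)).trans (Eq.trans ?_ (congrArg _ (he σ x)).symm)
    rfl

variable [FiniteDimensional ℝ V]

/-! ### The dual sheaf is a sheaf of graded modules -/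

lemma gproj_mem_rel (hS : F.IsGradedSheaf) (γ : Δ.Cone) (d : ℤ) {x : F.stalk γ} (hx : x ∈ F.Rel γ) :
    gproj (hS.isInternal γ) d x ∈ F.Rel γ := by
  intro τ h
  rw [← gproj_comm_zero (hS.isInternal γ) (hS.isInternal τ) _ (hS.res_mem h.le), hx τ h, map_zero]

/-- The grading of the sections vanishing on the boundary. -/
def degRel (F : ConeSystem Δ) (γ : Δ.Cone) (d : ℤ) : Submodule ℝ (F.Rel γ) :=
  (F.deg γ d).comap ((F.Rel γ).subtype.restrictScalars ℝ)

lemma isInternal_degRel (hS : F.IsGradedSheaf) (γ : Δ.Cone) : DirectSum.IsInternal (F.degRel γ) :=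
  IsInternal.comap_of_range (hS.isInternal γ) ((F.Rel γ).subtype.restrictScalars ℝ)
    Subtype.val_injective fun d y => ⟨⟨_, gproj_mem_rel hS γ d y.2⟩, rfl⟩

lemma smulGraded_degRel (hS : F.IsGradedSheaf) (γ : Δ.Cone) :
    SMulGraded (degA γ) (F.degRel γ) := fun i j a x ha hx => hS.smul_mem γ i j a x.1 ha hx

lemma degHom_eq (F : ConeSystem Δ) (γ : Δ.Cone) : F.degHom γ = homDeg (degA γ) (F.degRel γ) := rfl

lemma isInternal_degHom (hF : F.IsPure) (γ : Δ.Cone) : DirectSum.IsInternal (F.degHom γ) := by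
  have := hF.finite γ
  have hS := hF.isGradedSheaf
  rw [degHom_eq]
  exact isInternal_homDeg (isInternal_degA γ) (smulGraded_degA γ) (isInternal_degRel hS γ)
    (smulGraded_degRel hS γ)

lemma smulGraded_degHom (F : ConeSystem Δ) (γ : Δ.Cone) : SMulGraded (degA γ) (F.degHom γ) := by
  rw [degHom_eq]
  exact smulGraded_homDeg (smulGraded_degA γ)

/-- The component of an extension in the degree of `s` is again an extension. Multiplication with
the facet form then adds 2, which the shift by twice the dimension compensates. -/
lemma phi_mem (hF : F.IsPure) {τ σ : Δ.Cone} (ht : IsFacet τ σ) {k : ℤ} {f : F.HomRel σ}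
    (hf : f ∈ F.degHom σ k) : phi hF ht f ∈ F.degHom τ (k + 2) := by
  have hS := hF.isGradedSheaf
  intro j s hs
  obtain ⟨x, h₁, h₂⟩ := exists_ext hF ht s
  have hc := fun (γ : Δ.Cone) (h : γ ≤ σ) =>
    gproj_comm_zero (hS.isInternal σ) (hS.isInternal γ) _ (hS.res_mem h) j x
  have h₁' : F.res ht.1 (gproj (hS.isInternal σ) j x) = s.1 := by
    rw [← hc τ ht.1, h₁, gproj_of_mem _ hs]
  have h₂' : ∀ (γ : Δ.Cone) (h : γ < σ), γ ≠ τ → F.res h.le (gproj (hS.isInternal σ) j x) = 0 := by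
    intro γ h hne
    rw [← hc γ h.le, h₂ γ h hne, map_zero]
  rw [phi_apply_eq hF ht f s h₁' h₂']
  refine resA_mem_degA _ ?_
  have h3 := hf (2 + j) ⟨_, form_smul_mem ht h₂'⟩
    (hS.smul_mem σ 2 j _ _ (lin_mem_degA σ ht.form) (gproj_mem _ j x))
  rwa [show j + (k + 2) = 2 + j + k by ring]

lemma homResFlag_mem (or : Orientations Δ) (hF : F.IsPure) {τ σ : Δ.Cone} (p : Flag τ σ) (d : ℤ)
    {f : F.HomRel σ} (hf : f ∈ F.degHom σ (d - 2 * (dim σ : ℤ))) :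
    homResFlag or hF p f ∈ F.degHom τ (d - 2 * (dim τ : ℤ)) := by
  induction p with
  | refl => rw [homResFlag]; exact hf
  | cons ht p ih =>
    rw [homResFlag, LinearMap.comp_apply]
    refine ih ?_
    have h1 := Submodule.smul_mem _ (ht.scale or) (phi_mem hF ht hf)
    have h2 := ht.2
    rwa [← h2, show d - 2 * ((dim _ + 1 : ℕ) : ℤ) + 2 = d - 2 * (dim _ : ℤ) by push_cast; ring] at h1

lemma homDual_isGradedSheaf (or : Orientations Δ) (hF : F.IsPure) :
    (homDual or F hF).IsGradedSheaf where
  isInternal σ := IsInternal.shift (isInternal_degHom hF σ) _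
  smul_mem σ i j a x ha hx := by
    have := smulGraded_degHom F σ i (j - 2 * (dim σ : ℤ)) a x ha hx
    rwa [show i + (j - 2 * (dim σ : ℤ)) = i + j - 2 * (dim σ : ℤ) by ring] at this
  res_mem {τ σ} h d x hx := by
    obtain ⟨p⟩ := nonempty_flag h
    rw [homDual_res or hF h p]
    exact homResFlag_mem or hF p d hx
  res_refl := homDual_res_refl or hF
  res_trans := homDual_res_trans or hF

/-- Facet by facet, ε ψ changes the volume form by the scale, which moves to the first tensor
factor. -/
lemma dualResFlag_tmul (or : Orientations Δ) (hF : F.IsPure) {τ σ : Δ.Cone} (p : Flag τ σ)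
    (f : F.HomRel σ) : dualResFlag or hF p (f ⊗ₜ vol or σ) = homResFlag or hF p f ⊗ₜ vol or τ := by
  induction p with
  | refl => rw [dualResFlag, homResFlag]; rfl
  | cons ht p ih =>
    rw [dualResFlag, homResFlag, LinearMap.comp_apply, LinearMap.comp_apply, ← ih]
    congr 1
    rw [dualResFacet, LinearMap.smul_apply, TensorProduct.map_tmul, homResFacet, LinearMap.smul_apply,
      TensorProduct.smul_tmul, ← ht.sign_smul_psi, TensorProduct.tmul_smul]

lemma nonempty_homDual_iso_dual (or : Orientations Δ) (hF : F.IsPure) :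
    Nonempty (Iso (homDual or F hF) (dual or F hF)) := by
  choose e he using fun σ : Δ.Cone => exists_tmul_equiv (R := A σ) (X := F.HomRel σ)
    (vol_ne_zero or σ) (det_eq_smul (vol_ne_zero or σ))
  refine ⟨⟨e, fun σ d f => ?_, fun {τ σ} h f => ?_⟩⟩
  · have key : ∀ f : F.HomRel σ,
        e σ f ∈ tensorDeg (F.degHom σ) (concentrated (Det σ) (2 * (dim σ : ℤ))) d ↔
          f ∈ F.degHom σ (d - 2 * (dim σ : ℤ)) := fun f => by
      rw [he σ f]
      exact tmul_mem_tensorDeg_iff (vol_ne_zero or σ) (det_eq_smul (vol_ne_zero or σ))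
    exact key f
  · have hp := nonempty_flag h
    refine (he τ _).trans (Eq.trans ?_ (congrArg _ (he σ f)).symm)
    change _ = dualRes or hF τ σ (f ⊗ₜ vol or σ)
    unfold dualRes
    rw [dif_pos hp, homDual_res or hF h hp.some]
    exact (dualResFlag_tmul or hF hp.some f).symm

end ConeSystem
end

noncomputable section
open Fan

/-- A surjection from a torsion-free module to a module of at least the same rank is injective. -/
lemma injective_of_surjective_of_finrank_le {R X Y : Type*} [CommRing R] [IsDomain R]
    [AddCommGroup X] [Module R X] [Module.Finite R X] [Module.IsTorsionFree R X]
    [IsNoetherianRing R] [AddCommGroup Y] [Module R Y]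
    (f : X →ₗ[R] Y) (hf : Function.Surjective f) (h : Module.finrank R X ≤ Module.finrank R Y) :
    Function.Injective f := by
  rw [← LinearMap.ker_eq_bot]
  have h1 := Submodule.finrank_quotient_add_finrank (LinearMap.ker f)
  have h2 := (f.quotKerEquivOfSurjective hf).finrank_eq
  have h3 : Module.finrank R (LinearMap.ker f) = 0 := by omega
  exact Submodule.finrank_eq_zero.mp h3

namespace ConeSystem

variable {V : Type u} [AddCommGroup V] [Module ℝ V] {Δ : Fan V} {L D : ConeSystem Δ}

/-! ### Construction of isomorphisms by induction on the dimension -/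

/-- The maps `β` form an isomorphism of degree `k` over the affine fan `⟨γ⟩`, as far as the stalk at
`γ` and its restrictions are concerned. -/
structure IsIsoAt (β : ∀ γ, L.stalk γ →ₗ[A γ] D.stalk γ) (k : ℤ) (γ : Δ.Cone) : Prop where
  bijective : Function.Bijective (β γ)
  mem : ∀ (d : ℤ) (x : L.stalk γ), x ∈ L.deg γ d → β γ x ∈ D.deg γ (d + k)
  natural : ∀ (τ : Δ.Cone) (h : τ ≤ γ) (x : L.stalk γ), β τ (L.res h x) = D.res h (β γ x)

variable [FiniteDimensional ℝ V]

-- Cones of equal dimension are never proper faces of each other, so the isomorphisms at all cones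
-- of dimension `n` can be chosen independently. The maps are carried as a total family, of which
-- only the values on lower dimensions are meaningful.
open Classical in
lemma nonempty_iso_of_step (hL : L.IsGradedSheaf) (hD : D.IsGradedSheaf) (k : ℤ)
    (step : ∀ (γ : Δ.Cone) (β : ∀ γ, L.stalk γ →ₗ[A γ] D.stalk γ), (∀ τ < γ, IsIsoAt β k τ) →
      ∃ b : L.stalk γ →ₗ[A γ] D.stalk γ, Function.Bijective b ∧
        (∀ (d : ℤ) (x : L.stalk γ), x ∈ L.deg γ d → b x ∈ D.deg γ (d + k)) ∧
        ∀ (τ : Δ.Cone) (h : τ < γ) (x : L.stalk γ), β τ (L.res h.le x) = D.res h.le (b x)) :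
    Nonempty (Iso (L.shift k) D) := by
  have key : ∀ n : ℕ, ∃ β : ∀ γ, L.stalk γ →ₗ[A γ] D.stalk γ, ∀ γ, dim γ < n → IsIsoAt β k γ := by
    intro n
    induction n with
    | zero => exact ⟨fun _ => 0, fun γ h => absurd h (Nat.not_lt_zero _)⟩
    | succ n ih =>
      obtain ⟨β, hβ⟩ := ih
      have hex : ∀ γ : Δ.Cone, ∃ b : L.stalk γ →ₗ[A γ] D.stalk γ, dim γ = n →
          Function.Bijective b ∧
          (∀ (d : ℤ) (x : L.stalk γ), x ∈ L.deg γ d → b x ∈ D.deg γ (d + k)) ∧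
          ∀ (τ : Δ.Cone) (h : τ < γ) (x : L.stalk γ), β τ (L.res h.le x) = D.res h.le (b x) := by
        intro γ
        by_cases h : dim γ = n
        · obtain ⟨b, hb⟩ := step γ β fun τ hτ => hβ τ (h ▸ dim_lt hτ)
          exact ⟨b, fun _ => hb⟩
        · exact ⟨0, fun h' => absurd h' h⟩
      choose b hb using hex
      let β' : ∀ γ, L.stalk γ →ₗ[A γ] D.stalk γ := fun γ => if dim γ = n then b γ else β γ
      have h1 : ∀ γ, dim γ = n → β' γ = b γ := fun γ h => if_pos h
      have h2 : ∀ γ, dim γ < n → β' γ = β γ := fun γ h => if_neg h.ne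
      refine ⟨β', fun γ hγ => ?_⟩
      rcases Nat.lt_succ_iff_lt_or_eq.mp hγ with hd | hd
      · obtain ⟨p, q, r⟩ := hβ γ hd
        refine ⟨?_, ?_, fun τ h x => ?_⟩
        · rw [h2 γ hd]; exact p
        · rw [h2 γ hd]; exact q
        · rw [h2 γ hd, h2 τ (lt_of_le_of_lt ?_ hd), r]
          rcases h.eq_or_lt with rfl | h
          · exact le_rfl
          · exact (dim_lt h).le
      · obtain ⟨p, q, r⟩ := hb γ hd
        refine ⟨?_, ?_, fun τ h x => ?_⟩
        · rw [h1 γ hd]; exact p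
        · rw [h1 γ hd]; exact q
        · rcases h.eq_or_lt with rfl | h
          · rw [hL.res_refl, hD.res_refl]
          · rw [h1 γ hd, h2 τ (hd ▸ dim_lt h), r τ h x]
  obtain ⟨β, hβ⟩ := key (Module.finrank ℝ V + 1)
  have hβ' : ∀ γ, IsIsoAt β k γ := fun γ => hβ γ (Nat.lt_succ_of_le (Submodule.finrank_le _))
  have hmem : ∀ γ d (x : L.stalk γ), β γ x ∈ D.deg γ d ↔ x ∈ L.deg γ (d - k) := fun γ d x =>
    mem_iff_of_injective (IsInternal.shift (hL.isInternal γ) k) (hD.isInternal γ)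
      ((β γ).restrictScalars ℝ) (fun d x hx => by
        have := (hβ' γ).mem (d - k) x hx
        rwa [sub_add_cancel] at this) (hβ' γ).bijective.1 d x
  exact ⟨⟨fun γ => LinearEquiv.ofBijective (β γ) (hβ' γ).bijective, hmem,
    fun {τ γ} h x => (hβ' γ).natural τ h x⟩⟩

/-- The step at a cone where both sheaves are minimal extensions from the boundary. -/
lemma exists_iso_step (hL : L.IsGradedSheaf) (hD : D.IsGradedSheaf) (k : ℤ) {γ : Δ.Cone}
    {β : ∀ γ, L.stalk γ →ₗ[A γ] D.stalk γ} (hβ : ∀ τ < γ, IsIsoAt β k τ)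
    [Module.Finite (A γ) (L.stalk γ)] [Module.Free (A γ) (L.stalk γ)]
    (hsL : Function.Surjective (L.resBd hL γ)) (hsD : Function.Surjective (D.resBd hD γ))
    (hker : ∀ f, D.resBd hD γ f = 0 → f ∈ (maxIdeal γ • ⊤ : Submodule (A γ) (D.stalk γ)))
    {c : ℤ} (hc : ∀ d < c, D.deg γ d = ⊥)
    (hrank : Module.Finite (A γ) (D.stalk γ) →
      Module.finrank (A γ) (L.stalk γ) ≤ Module.finrank (A γ) (D.stalk γ)) :
    ∃ b : L.stalk γ →ₗ[A γ] D.stalk γ, Function.Bijective b ∧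
      (∀ (d : ℤ) (x : L.stalk γ), x ∈ L.deg γ d → b x ∈ D.deg γ (d + k)) ∧
      ∀ (τ : Δ.Cone) (h : τ < γ) (x : L.stalk γ), β τ (L.res h.le x) = D.res h.le (b x) := by
  let B : L.Bd γ ≃ₗ[A γ] D.Bd γ :=
    bdEquiv (fun τ hτ => LinearEquiv.ofBijective (β τ) (hβ τ hτ).bijective)
      fun τ' τ h hτ x => (hβ τ hτ).natural τ' h x
  have hB : ∀ x τ, (B x).1 τ = β τ.1 (x.1 τ) := fun x τ => rfl
  let u : L.stalk γ →ₗ[A γ] D.Bd γ := B.toLinearMap ∘ₗ L.resBd hL γ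
  have hu : ∀ d, ∀ x ∈ L.deg γ d, u x ∈ D.degBd γ (d + k) := fun d x hx τ =>
    (hβ τ.1 τ.2).mem d _ (hL.res_mem _ d x hx)
  have husurj : Function.Surjective u := B.surjective.comp hsL
  -- The lift `b₀` need not be homogeneous. Its part `b` of degree `k` is still a lift, because `u`
  -- has degree `k` and restriction has degree zero.
  obtain ⟨b₀, hb₀⟩ := Module.projective_lifting_property (D.resBd hD γ) u hsD
  let b := gcompLin (isInternal_degA γ) (hL.isInternal γ) (hL.smulGraded γ) (hD.isInternal γ)
    (hD.smulGraded γ) b₀ k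
  have hb : ∀ d, ∀ x ∈ L.deg γ d, b x = gproj (hD.isInternal γ) (d + k) (b₀ x) := fun d x hx =>
    gcomp_of_mem (hL.isInternal γ) (hD.isInternal γ) (b₀.restrictScalars ℝ) k hx
  have hbdeg : ∀ d, ∀ x ∈ L.deg γ d, b x ∈ D.deg γ (d + k) := fun d x hx => by
    rw [hb d x hx]
    exact gproj_mem _ _ _
  have hres : ∀ x, D.resBd hD γ (b x) = u x := by
    intro x
    induction x using IsInternal.induction (hL.isInternal γ) with
    | zero => simp only [map_zero]
    | add x y hx hy => simp only [map_add, hx, hy]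
    | mem d x hx =>
      rw [hb d x hx]
      have h1 := gproj_comm_zero (hD.isInternal γ) (isInternal_degBd hD γ)
        ((D.resBd hD γ).restrictScalars ℝ) (fun d x hx => resBd_mem hD hx) (d + k) (b₀ x)
      refine h1.symm.trans ?_
      have h2 : D.resBd hD γ (b₀ x) = u x := LinearMap.congr_fun hb₀ x
      change gproj _ _ (D.resBd hD γ (b₀ x)) = _
      rw [h2, gproj_of_mem _ (hu d x hx)]
  -- Every `f` agrees on the boundary with some `b x`, and their difference lies in 𝔪 times the
  -- stalk by `hker`; graded Nakayama finishes.
  have hsurj : Function.Surjective b := by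
    rw [← LinearMap.range_eq_top]
    refine eq_top_of_sup_smul_eq_top (hD.isInternal γ) (hD.smulGraded γ) hc
      (maxIdeal_generators γ) ?_ ?_
    · rintro d _ ⟨x, rfl⟩
      refine ⟨gproj (hL.isInternal γ) (d - k) x, ?_⟩
      have h1 := gproj_comm (hL.isInternal γ) (hD.isInternal γ) (b.restrictScalars ℝ) k hbdeg (d - k) x
      rw [sub_add_cancel] at h1
      exact h1.symm
    · rw [eq_top_iff]
      intro f _
      obtain ⟨x, hx⟩ := husurj (D.resBd hD γ f)
      refine Submodule.mem_sup.mpr ⟨b x, ⟨x, rfl⟩, f - b x, hker _ ?_, by abel⟩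
      rw [map_sub, hres, hx, sub_self]
  have hfin : Module.Finite (A γ) (D.stalk γ) := Module.Finite.of_surjective b hsurj
  refine ⟨b, ⟨injective_of_surjective_of_finrank_le b hsurj (hrank hfin), hsurj⟩, hbdeg, ?_⟩
  intro τ h x
  exact (congrFun (congrArg Subtype.val (hres x)) ⟨τ, h⟩).symm

end ConeSystem
end

noncomputable section
open Fan

/-- On a finitely generated graded module there are no forms of very negative degree. -/
lemma exists_homDeg_eq_bot {R X : Type*} [CommRing R] [Algebra ℝ R] {𝒜 : ℤ → Submodule ℝ R}
    [AddCommGroup X] [Module ℝ X] [Module R X] [IsScalarTower ℝ R X] {G : ℤ → Submodule ℝ X}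
    (h𝒜 : ∀ d < 0, 𝒜 d = ⊥) (hG : DirectSum.IsInternal G) [Module.Finite R X] :
    ∃ c : ℤ, ∀ k < c, homDeg 𝒜 G k = ⊥ := by
  classical
  obtain ⟨s, hs, hspan⟩ := exists_homogeneous_generators (R := R) hG
  choose d hd using hs
  obtain ⟨N, hN⟩ : ∃ N : ℤ, ∀ (x : X) (hx : x ∈ s), d x hx ≤ N := by
    obtain ⟨N, hN⟩ := (s.attach.image fun x : {x // x ∈ s} => d x.1 x.2).bddAbove
    exact ⟨N, fun x hx => hN (Finset.mem_coe.mpr (Finset.mem_image_of_mem _ (Finset.mem_attach s ⟨x, hx⟩)))⟩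
  refine ⟨-N, fun k hk => ?_⟩
  rw [eq_bot_iff]
  intro f hf
  rw [Submodule.mem_bot]
  refine LinearMap.ext_on hspan fun x hx => ?_
  have h1 := hf (d x hx) x (hd x hx)
  have h2 := hN x hx
  rwa [h𝒜 _ (by linarith), Submodule.mem_bot] at h1

/-- A form that extends to a module of which the image lies in `I` times the module is in `I` times
the dual. -/
lemma mem_smul_dual_of_extends {R X : Type*} [CommRing R] [AddCommGroup X] [Module R X]
    {I : Ideal R} {M : Submodule R X} [Module.Finite R M] [Module.Projective R M]
    (hM : M ≤ I • ⊤) (g : X →ₗ[R] R) {f : M →ₗ[R] R} (hgf : ∀ x : M, g x.1 = f x) :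
    f ∈ (I • ⊤ : Submodule R (M →ₗ[R] R)) := by
  obtain ⟨n, p, s, -, -, hps⟩ := Module.Finite.exists_comp_eq_id_of_projective R M
  have hg : ∀ x ∈ (I • ⊤ : Submodule R X), g x ∈ I := by
    intro x hx
    have h1 := Submodule.mem_map_of_mem (f := g) hx
    rw [Submodule.map_smul''] at h1
    exact Ideal.mul_le_right (I := Submodule.map g ⊤) (by rw [mul_comm]; exact h1)
  -- Expansion in a dual basis of `M`. The coefficients are values of `g` on elements of `M` ⊆ I X,
  -- so they lie in `I`.
  have hf : f = ∑ j, f (p (Pi.single j 1)) • (LinearMap.proj j ∘ₗ s) := by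
    refine LinearMap.ext fun x => ?_
    have h1 : p (s x) = x := LinearMap.congr_fun hps x
    conv_lhs => rw [← h1, LinearMap.pi_apply_eq_sum_univ p (s x)]
    have h4 : ∀ j : Fin n, (fun k => if j = k then (1 : R) else 0) = Pi.single j 1 := fun j => by
      funext k
      simp only [Pi.single_apply, eq_comm]
    simp only [map_sum, map_smul, LinearMap.sum_apply, LinearMap.smul_apply, h4, smul_eq_mul]
    exact Finset.sum_congr rfl fun j _ => mul_comm _ _
  rw [hf]
  refine sum_mem fun j _ => Submodule.smul_mem_smul ?_ trivial
  rw [← hgf]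
  exact hg _ (hM (p (Pi.single j 1)).2)

namespace ConeSystem

variable {V : Type u} [AddCommGroup V] [Module ℝ V] {Δ : Fan V} [FiniteDimensional ℝ V]
  {F : ConeSystem Δ}

/-- A parameter beyond all facets turns the beginning of the shelling into the whole boundary. -/
lemma projective_rel (hF : F.IsPure) (γ : Δ.Cone) : Module.Projective (A γ) (F.Rel γ) := by
  obtain ⟨q, hq, hq'⟩ := exists_interior γ
  obtain ⟨v, hs⟩ := exists_isShelling γ (pt hq) fun τ ht => (ht.form_pos hq (hq' τ ht.lt)).ne'
  let κ : {τ : Δ.Cone // IsFacet τ γ} → ℝ := fun τ => τ.2.form (pt hq) / τ.2.form v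
  obtain ⟨c, hc⟩ := (Set.finite_range κ).bddAbove
  have h := projective_relTo hF γ hs (c + 1)
  rw [rel_eq_relTo hF.isGradedSheaf] at h
  · exact h
  · intro τ ht
    have h1 : κ ⟨τ, ht⟩ ≤ c := hc ⟨⟨τ, ht⟩, rfl⟩
    exact ⟨ht, lt_of_le_of_lt h1 (lt_add_one c)⟩
  · rintro τ ⟨ht, -⟩
    exact ht.lt

/-- A section over the boundary is determined by its values on the facets, which agree on common
ridges; so the gluing of forms on facets suffices. -/
lemma homDual_resBd_surjective (or : Orientations Δ) (hF : F.IsPure) (γ : Δ.Cone) :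
    Function.Surjective ((homDual or F hF).resBd (homDual_isGradedSheaf or hF) γ) := by
  classical
  have hD := homDual_isGradedSheaf or hF
  intro y
  let f : ∀ τ : Δ.Cone, F.HomRel τ := fun τ => if h : τ < γ then y.1 ⟨τ, h⟩ else 0
  have hf : ∀ (τ : Δ.Cone) (h : τ < γ), f τ = y.1 ⟨τ, h⟩ := fun τ h => dif_pos h
  have hf' : ∀ (τ ρ : Δ.Cone) (h : τ < γ) (hr : IsFacet ρ τ),
      homResFacet or hF hr (f τ) = y.1 ⟨ρ, hr.lt.trans h⟩ := by
    intro τ ρ h hr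
    rw [hf τ h]
    refine (homDual_res_facet or hF hr (y.1 ⟨τ, h⟩)).symm.trans ?_
    exact y.2 ⟨τ, h⟩ ⟨ρ, hr.lt.trans h⟩ hr.1
  obtain ⟨g, hg⟩ := exists_form_of_facets or hF (γ := γ) f fun τ τ' ρ ht ht' hr hr' =>
    (hf' τ ρ ht.lt hr).trans (hf' τ' ρ ht'.lt hr').symm
  refine ⟨g, Subtype.ext (funext fun δ => ?_)⟩
  obtain ⟨τ, ht, hle⟩ := exists_facet (show δ.1 < γ from δ.2)
  change (homDual or F hF).res (Bd.le δ) g = y.1 δ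
  have h1 : (homDual or F hF).res ht.1 g = y.1 ⟨τ, ht.lt⟩ :=
    (homDual_res_facet or hF ht g).trans ((hg τ ht).trans (hf τ ht.lt))
  refine (hD.res_trans hle ht.1 g).symm.trans ?_
  rw [h1]
  exact y.2 ⟨τ, ht.lt⟩ δ hle

/-- Minimality of the dual: such a form extends to the whole stalk, and its original domain lies in
𝔪 times that stalk. -/
lemma mem_maxIdeal_smul_of_resBd_eq_zero (or : Orientations Δ) (hF : F.IsPure) {γ : Δ.Cone}
    (hrel : F.Rel γ ≤ maxIdeal γ • ⊤) (f : F.HomRel γ)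
    (hf : (homDual or F hF).resBd (homDual_isGradedSheaf or hF) γ f = 0) :
    f ∈ (maxIdeal γ • ⊤ : Submodule (A γ) (F.HomRel γ)) := by
  obtain ⟨g, hg⟩ := exists_extend_form_top hF f (by
    intro ρ hr
    have h1 : homResFacet or hF hr f = 0 := by
      rw [← homDual_res_facet]
      exact congrFun (congrArg Subtype.val hf) ⟨ρ, hr.lt⟩
    exact (smul_eq_zero.mp h1).resolve_left (hr.scale_pos or).ne')
  have := projective_rel hF γ
  have := hF.finite γ
  exact mem_smul_dual_of_extends hrel g hg

/-- The product of all facet forms works, as every proper face lies in a facet. -/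
lemma exists_smul_mem_rel (hS : F.IsGradedSheaf) (γ : Δ.Cone) :
    ∃ P : A γ, P ≠ 0 ∧ ∀ x : F.stalk γ, P • x ∈ F.Rel γ := by
  classical
  have : Fintype {τ : Δ.Cone // IsFacet τ γ} := Fintype.ofFinite _
  refine ⟨∏ τ : {τ : Δ.Cone // IsFacet τ γ}, lin γ τ.2.form,
    Finset.prod_ne_zero_iff.mpr fun i _ => i.2.lin_form_ne_zero, fun x δ hδ => ?_⟩
  obtain ⟨τ, ht, hle⟩ := exists_facet hδ
  rw [F.res_smul, map_prod, Finset.prod_eq_zero (Finset.mem_univ ⟨τ, ht⟩), zero_smul]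
  rw [← resA_trans hle ht.1, ht.resA_form, map_zero]

/-- The stalk is free and has the rank of its dual. Restricting forms to F_(γ,∂γ) is injective,
since a nonzero multiple of every section lies there. -/
lemma finrank_le_finrank_homRel (hF : F.IsPure) (γ : Δ.Cone) [Module.Finite (A γ) (F.HomRel γ)] :
    Module.finrank (A γ) (F.stalk γ) ≤ Module.finrank (A γ) (F.HomRel γ) := by
  have := hF.finite γ
  have := hF.free γ
  obtain ⟨P, hP, hmem⟩ := exists_smul_mem_rel hF.isGradedSheaf γ
  rw [(Module.Free.chooseBasis (A γ) (F.stalk γ)).toDualEquiv.finrank_eq]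
  refine LinearMap.finrank_le_finrank_of_injective
    (f := LinearMap.lcomp (A γ) (A γ) (F.Rel γ).subtype) ?_
  rw [injective_iff_map_eq_zero]
  intro g hg
  refine LinearMap.ext fun x => ?_
  have h1 : g (P • x) = 0 := LinearMap.congr_fun hg ⟨P • x, hmem x⟩
  rw [map_smul, smul_eq_mul] at h1
  exact (mul_eq_zero.mp h1).resolve_left hP

/-! ### Self-duality of simple sheaves -/

variable {L : ConeSystem Δ} {σ : Δ.Cone}

lemma IsSimple.subsingleton_homRel (hL : L.IsSimple σ) {γ : Δ.Cone} (h : ¬ σ ≤ γ) :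
    Subsingleton (L.HomRel γ) := by
  have := hL.outside γ h
  have : Subsingleton (L.Rel γ) := Subtype.val_injective.subsingleton
  exact ⟨fun f g => LinearMap.ext fun x => by rw [Subsingleton.elim x 0, map_zero, map_zero]⟩

/-- The pairing at the center of a simple sheaf. -/
lemma IsSimple.exists_center_iso (hL : L.IsSimple σ) :
    ∃ b : L.stalk σ →ₗ[A σ] L.HomRel σ, Function.Bijective b ∧
      ∀ (d : ℤ) (x : L.stalk σ), x ∈ L.deg σ d → b x ∈ L.degHom σ d := by
  obtain ⟨e, he⟩ := hL.center
  -- The proper faces of σ carry zero stalks, so every section over σ vanishes on the boundary and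
  -- the pairing is the multiplication of `A σ`.
  have hrel : ∀ x, x ∈ L.Rel σ := by
    intro x τ h
    have := hL.outside τ h.not_ge
    exact Subsingleton.elim _ _
  let b : L.stalk σ →ₗ[A σ] L.HomRel σ :=
    LinearMap.lcomp (A σ) (A σ) (e.toLinearMap ∘ₗ (L.Rel σ).subtype) ∘ₗ
      LinearMap.mul (A σ) (A σ) ∘ₗ e.toLinearMap
  have hb : ∀ x m, b x m = e x * e m.1 := fun x m => rfl
  let m₁ : L.Rel σ := ⟨e.symm 1, hrel _⟩
  refine ⟨b, ⟨?_, ?_⟩, ?_⟩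
  · rw [injective_iff_map_eq_zero]
    intro x hx
    have h1 : b x m₁ = 0 := by rw [hx, LinearMap.zero_apply]
    rw [hb, LinearEquiv.apply_symm_apply, mul_one] at h1
    exact e.map_eq_zero_iff.mp h1
  · intro f
    refine ⟨e.symm (f m₁), LinearMap.ext fun m => ?_⟩
    rw [hb, LinearEquiv.apply_symm_apply, mul_comm, ← smul_eq_mul, ← map_smul]
    congr 1
    refine Subtype.ext (e.injective ?_)
    change e (e m.1 • e.symm 1) = e m.1
    rw [map_smul, LinearEquiv.apply_symm_apply, smul_eq_mul, mul_one]
  · intro d x hx j m hm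
    rw [hb, add_comm]
    exact mul_mem_degA ((he d x).mpr hx) ((he j m.1).mpr hm)

/-- Simple sheaves are dual to themselves up to a shift. -/
theorem IsSimple.nonempty_shift_iso_homDual (or : Orientations Δ) (hL : L.IsSimple σ) :
    Nonempty (Iso (L.shift (2 * (dim σ : ℤ))) (homDual or L hL.isPure)) := by
  have hF := hL.isPure
  have hS := hL.isGradedSheaf
  have hD := homDual_isGradedSheaf or hF
  refine nonempty_iso_of_step hS hD _ fun γ β hβ => ?_
  by_cases h : σ ≤ γ
  · rcases h.eq_or_lt with rfl | h
    · obtain ⟨b, hb, hbd⟩ := hL.exists_center_iso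
      refine ⟨b, hb, fun d x hx => ?_, fun τ hτ x => ?_⟩
      · change b x ∈ L.degHom σ (d + 2 * (dim σ : ℤ) - 2 * (dim σ : ℤ))
        rw [add_sub_cancel_right]
        exact hbd d x hx
      · have := hL.subsingleton_homRel hτ.not_ge
        exact Subsingleton.elim (α := L.HomRel τ) _ _
    · have hfin := hF.finite γ
      have hfree := hF.free γ
      -- The degrees of forms on the finitely generated module F_(γ,∂γ) are bounded below, which
      -- graded Nakayama needs on the dual side; 2 dim γ is the shift built into `homDual`.
      obtain ⟨c, hc⟩ := exists_homDeg_eq_bot (R := A γ) (degA_of_neg γ) (isInternal_degRel hS γ)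
      refine exists_iso_step hS hD _ hβ (hL.resBd_surjective γ) (homDual_resBd_surjective or hF γ)
        (mem_maxIdeal_smul_of_resBd_eq_zero or hF (hL.rel_le h)) (c := c + 2 * (dim γ : ℤ)) ?_ ?_
      · intro d hd
        exact hc (d - 2 * (dim γ : ℤ)) (by linarith)
      · intro hfin'
        have : Module.Finite (A γ) (L.HomRel γ) := hfin'
        exact finrank_le_finrank_homRel hF γ
  · have h1 := hL.outside γ h
    have h2 := hL.subsingleton_homRel h
    refine ⟨0, ⟨fun x y _ => Subsingleton.elim _ _, fun y => ⟨0, Subsingleton.elim (α := L.HomRel γ) _ _⟩⟩,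
      fun d x _ => zero_mem _, fun τ hτ x => ?_⟩
    have h3 := hL.subsingleton_homRel fun h' => h (h'.trans hτ.le)
    exact Subsingleton.elim (α := L.HomRel τ) _ _

lemma _root_.Fan.dim_zeroCone (Δ : Fan V) : dim Δ.zeroCone = 0 := by
  have : Sp Δ.zeroCone = ⊥ := by
    rw [Submodule.span_eq_bot]
    exact fun x hx => (Submodule.mem_bot _).mp hx
  change Module.finrank ℝ (Sp Δ.zeroCone) = 0
  rw [this, finrank_bot]

end ConeSystem

theorem corollary2p6 {V : Type u} [AddCommGroup V] [Module ℝ V] [FiniteDimensional ℝ V]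
    (Δ : Fan V) (or : Fan.Orientations Δ) :
    (∀ σ : Δ.Cone,
      (∃ L : ConeSystem Δ, L.IsSimple σ) ∧
      ∀ L : ConeSystem Δ, L.IsSimple σ → ∃ hL : L.IsPure,
        (ConeSystem.dual or L hL).IsGradedSheaf ∧
        Nonempty (ConeSystem.Iso (ConeSystem.dual or L hL)
          (L.tensor (Fan.Det σ) (concentrated (Fan.Det σ) (2 * (Fan.dim σ : ℤ)))))) ∧
    (∀ E : ConeSystem Δ, E.IsSimple Δ.zeroCone → ∃ hE : E.IsPure,
      Nonempty (ConeSystem.Iso E (ConeSystem.dual or E hE))) := by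
  refine ⟨fun σ => ⟨ConeSystem.exists_isSimple σ, fun L hL => ⟨hL.isPure, ?_, ?_⟩⟩,
    fun E hE => ⟨hE.isPure, ?_⟩⟩
  · obtain ⟨φ⟩ := ConeSystem.nonempty_homDual_iso_dual or hL.isPure
    exact φ.isGradedSheaf (ConeSystem.homDual_isGradedSheaf or hL.isPure)
  · obtain ⟨φ⟩ := ConeSystem.nonempty_homDual_iso_dual or hL.isPure
    obtain ⟨ψ⟩ := hL.nonempty_shift_iso_homDual or
    obtain ⟨χ⟩ := L.nonempty_shift_iso_tensor (vol_ne_zero or σ) (det_eq_smul (vol_ne_zero or σ))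
      (2 * (Fan.dim σ : ℤ))
    exact ⟨(φ.symm.trans ψ.symm).trans χ⟩
  · obtain ⟨φ⟩ := ConeSystem.nonempty_homDual_iso_dual or hE.isPure
    obtain ⟨ψ⟩ := hE.nonempty_shift_iso_homDual or
    -- The zero cone has dimension 0, so the shift is trivial and can be dropped.
    have h0 : ∀ d : ℤ, d - 2 * (Fan.dim Δ.zeroCone : ℤ) = d := by
      rw [Fan.dim_zeroCone]
      simp
    let χ : ConeSystem.Iso E (E.shift (2 * (Fan.dim Δ.zeroCone : ℤ))) :=
      ⟨fun γ => LinearEquiv.refl (A γ) (E.stalk γ), fun γ d x => by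
        change x ∈ E.deg γ (d - 2 * (Fan.dim Δ.zeroCone : ℤ)) ↔ _
        rw [h0], fun h x => rfl⟩
    exact ⟨(χ.trans ψ).trans φ⟩

end
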